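/- **Setting.** Let $f_t=x^4+y^4+z^2+t\,x^2y^2$ with $t\in P:=\{t\in\mathbb C: t^2\neq 4\}$, let $\mathcal O=\mathbb C[[x,y,z]]$ with $x,y,z$ of weights $1,1,2$, let $m=(x,y,z)$, and let $I_k(t)=\langle f_t,\ m^kJ(f_t)\rangle$ for $k\in\mathbb Z_{\ge0}$, where $J(f_t)$ is the ideal of the partial derivatives, and $I_\infty(t)=\langle f_t\rangle$. Put $\mathcal A^k(t)=\mathcal O/I_k(t)$. Let $\operatorname{PGL}_3^{\mathbf w}$ be the group of weight preserving $\mathbb C$-algebra automorphisms of $\mathcal O$ modulo the automorphisms $(x,y,z)\mapsto(\lambda x,\lambda y,\lambda^2z)$, $\lambda\in\mathbb C^*$. The groupoid $\operatorname{Grp}^k$ has object set $P$, its morphisms $t\to s$ are the $\phi\in\operatorname{PGL}_3^{\mathbf w}$ with $\phi(I_k(t))=I_k(s)$, and composition is composition of maps. For $\alpha,\beta\in\{\pm1,\pm i\}$ and $\gamma\in\mathbb C^*$ let $$B_{\alpha,0}=\begin{pmatrix}1&0\\0&\alpha\end{pmatrix},\quad B_{0,\beta}=\begin{pmatrix}0&\beta\\1&0\end{pmatrix},\quad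 B_{\alpha,\beta}=\begin{pmatrix}1&\beta\\\alpha&-\alpha\beta\end{pmatrix},\quad \tilde B_{\alpha,\beta,\gamma}=\begin{pmatrix}B_{\alpha,\beta}&0\\0&\gamma\end{pmatrix},$$ where in $\tilde B_{\alpha,\beta,\gamma}$ one of $\alpha,\beta$ may be $0$. A matrix $\tilde B$ stands for the class in $\operatorname{PGL}_3^{\mathbf w}$ of the substitution $(x,y,z)^T=\tilde B\,(x',y',z')^T$. Let $G'\subset\operatorname{PGL}_2(\mathbb C)$ be the subgroup generated by $\begin{pmatrix}1&1\\i&-i\end{pmatrix}$, $\begin{pmatrix}1&0\\0&i\end{pmatrix}$, $\begin{pmatrix}0&1\\1&0\end{pmatrix}$, and let $H'$ be the group of transformations of $P$ generated by the six transformations $t\mapsto\pm t$, $t\mapsto\pm\frac{12-2t}{2+t}$, $t\mapsto\pm\frac{12+2t}{2-t}$. **Theorem B.** (0) $H'$ consists of these six transformations and is isomorphic to $S_3$; $G'$ consists of the classes of the matrices $B_{\alpha,0},B_{0,\beta},B_{\alpha,\beta}$ and is isomorphic to $S_4$. There is a surjective map $\pi':G'\to H'$, $$B_{\alpha,0},\,B_{0,\alpha}\mapsto[t\mapsto\alpha^2t],\qquad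 B_{\alpha,\beta}\mapsto\Bigl[t\mapsto\frac{\beta^2(12-2\alpha^2t)}{2+\alpha^2t}\Bigr],$$ which is a homomorphism if products in $H'$ are read from left to right, $\pi'(MN)=\pi'(N)\circ\pi'(M)$; its kernel $\{B_{\pm1,0},B_{0,\pm1}\}$ is a Klein four-group. The classes $\tilde B_{\alpha,\beta,\gamma}$ ($\alpha,\beta\in\{0,\pm1,\pm i\}$ not both $0$, $\gamma\in\mathbb C^*$) are pairwise distinct and form a subgroup $\tilde G$ of $\operatorname{PGL}_3^{\mathbf w}$. The group $\tilde G$, with composition of automorphisms, acts on $P$ by letting $\tilde B_{\alpha,\beta,\gamma}$ act as $\pi'(B_{\alpha,\beta})$, and $P\setminus\{0,\pm6\}$ is stable. (1) For $k=0,1$ the restriction of $\operatorname{Grp}^k$ to $P\setminus\{0,\pm6\}$ is the action groupoid of $\tilde G$: for $t,s\in P\setminus\{0,\pm6\}$ the morphisms $t\to s$ are exactly the $\tilde B_{\alpha,\beta,\gamma}$, $\gamma\in\mathbb C^*$ arbitrary, with $\pi'(B_{\alpha,\beta})(t)=s$. (2) For $2\le k\le\infty$ and all $t,s\in P$, the set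 $\operatorname{Grp}^k(t,s)$ consists exactly of the $\tilde B_{\alpha,0,\pm1}$ and $\tilde B_{0,\alpha,\pm1}$ with $\alpha\in\{\pm1,\pm i\}$ and $s=\alpha^2t$, together with the $\tilde B_{\alpha,\beta,\pm\sqrt{2+\alpha^2t}}$ with $\alpha,\beta\in\{\pm1,\pm i\}$ and $s=\frac{\beta^2(12-2\alpha^2t)}{2+\alpha^2t}$. In particular, if $t\ne0,\pm6$ and $t^2\neq-12$, then $\operatorname{Grp}^k(t,t)=\{\tilde B_{\pm1,0,\pm1},\tilde B_{0,\pm1,\pm1}\}$ (all eight sign choices), that is, the Klein four-group $\{\mathrm{Id},\tilde B_{-1,0,1},\tilde B_{0,1,1},\tilde B_{0,-1,1}\}$ up to the sign of $z$. (3) (Torelli-type theorem) Let $L^1(t)=\operatorname{Der}_{\mathbb C}(\mathcal A^1(t))$ be the first Yau algebra. For $t,s\in P\setminus\{0,\pm6\}$ the Lie algebras $L^1(t)$ and $L^1(s)$ are isomorphic if and only if $f_t$ and $f_s$ are contact equivalent, i.e. $\phi(f_t)=u f_s$ for some $\phi\in\operatorname{Aut}_{\mathbb C}(\mathcal O)$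 and some unit $u$ of $\mathcal O$. Moreover, for $t\in P\setminus\{0,\pm6\}$ the derivations $$h_1=(tx^2+2y^2)y\,\partial_x-(ty^2+2x^2)x\,\partial_y,\qquad h_2=\bigl((t^2-12)x^2y-4ty^3\bigr)\partial_x-\bigl((t^2-12)y^2x-4tx^3\bigr)\partial_y$$ belong to $L^1(t)$, the ordered quadruple of the lines $H_1,\dots,H_4$ spanned by $h_1$, $h_2$, $4t(t^2-36)h_1-(t^2+12)h_2$ and $5(t^2+12)^2h_1+4t(t^2-36)h_2$ is carried to the corresponding quadruple by every graded Lie algebra isomorphism $L^1(t)\to L^1(s)$, $s\in P\setminus\{0,\pm6\}$, and its cross-ratio is $\frac5{16}\cdot\frac{j}{1-j}$, where $j=\frac{(12+t^2)^3}{108(t^2-4)^2}$. (The cross-ratio of lines of slopes $u_1,\dots,u_4$ in a plane is $\frac{(u_3-u_1)(u_4-u_2)}{(u_3-u_2)(u_4-u_1)}$.) -/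

import Mathlib

open MvPowerSeries
open scoped MatrixGroups

noncomputable section

namespace E7

/-! ### The ring of formal power series, weights, moduli algebras -/

/-- The formal local ring `ℂ[[x, y, z]]`; the variables `x, y, z` are `X 0, X 1, X 2`. -/
abbrev O : Type := MvPowerSeries (Fin 3) ℂ

/-- The weights `(1, 1, 2)` of `(x, y, z)`. -/
def wt : Fin 3 → ℕ := ![1, 1, 2]

/-- The power series `f` is weighted homogeneous of weight `n`. -/
def WH (f : O) (n : ℕ) : Prop := ∀ d, coeff d f ≠ 0 → Finsupp.weight wt d = n

/-- The maximal ideal `m = (x, y, z)`. -/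
def maxIdeal : Ideal O := Ideal.span (Set.range fun i : Fin 3 => (X i : O))

/-- The Jacobi ideal `J(f)`. -/
def jacobiIdeal (f : O) : Ideal O := Ideal.span (Set.range fun i : Fin 3 => pderiv ℂ i f)

/-- The ideal `⟨f, m^k J(f)⟩` for `k < ∞`, and `⟨f⟩` for `k = ∞`. -/
def moduliIdeal (k : ℕ∞) (f : O) : Ideal O :=
  Ideal.span {f} ⊔ ENat.recTopCoe (C := fun _ => Ideal O) ⊥
    (fun n : ℕ => maxIdeal ^ n * jacobiIdeal f) k

/-- The polynomial `f_t = x⁴ + y⁴ + z² + t x² y²`. -/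
def fam (t : ℂ) : O := X 0 ^ 4 + X 1 ^ 4 + X 2 ^ 2 + C t * (X 0 ^ 2 * X 1 ^ 2)

/-- The ideal `I_k(t)`, with `I_∞(t) = ⟨f_t⟩`. -/
def I (k : ℕ∞) (t : ℂ) : Ideal O := moduliIdeal k (fam t)

/-- The `k`-th moduli algebra (the coordinate ring if `k = ∞`). -/
abbrev A (k : ℕ∞) (t : ℂ) : Type := O ⧸ I k t

/-- Contact equivalence of two power series. -/
def ContactEquiv (f g : O) : Prop := ∃ (φ : O ≃ₐ[ℂ] O) (u : Oˣ), φ f = u * g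

/-- The parameters for which the singularity is isolated. -/
abbrev Param : Type := {t : ℂ // t ^ 2 ≠ 4}

/-- `t` is not one of the jump points `0, 6, -6`. -/
def NonJump (t : Param) : Prop := t.1 ≠ 0 ∧ t.1 ≠ 6 ∧ t.1 ≠ -6

/-- Saito's `j`-function of the family. -/
def jFun (t : ℂ) : ℂ := (12 + t ^ 2) ^ 3 / (108 * (t ^ 2 - 4) ^ 2)

/-! ### Weighted automorphisms modulo the `ℂ*`-action -/

/-- The group (under composition) of the weight preserving automorphisms of `ℂ[[x, y, z]]`. -/
def WAut : Subgroup (O ≃ₐ[ℂ] O) where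
  carrier := {φ | ∀ (f : O) (n : ℕ), WH (φ f) n ↔ WH f n}
  mul_mem' {φ ψ} hφ hψ f n := (hφ (ψ f) n).trans (hψ f n)
  one_mem' _ _ := Iff.rfl
  inv_mem' {φ} hφ f n := by
    have h := hφ (φ⁻¹ f) n
    rw [← AlgEquiv.mul_apply, mul_inv_cancel, AlgEquiv.one_apply] at h
    exact h.symm

theorem exists_poly {f : O} {n : ℕ} (hf : WH f n) :
    ∃ p : MvPolynomial (Fin 3) ℂ, p.IsWeightedHomogeneous wt n ∧ (p : O) = f := by
  have hb : ∀ d, coeff d f ≠ 0 → d ≤ Finsupp.equivFunOnFinite.symm fun _ => n := by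
    intro d hd
    have h : Finsupp.weight wt d = n := hf d hd
    intro i
    have h1 : d i * wt i ≤ Finsupp.weight wt d := by
      rw [Finsupp.weight_apply, Finsupp.sum_fintype _ _ (by simp)]
      simpa using Finset.single_le_sum (f := fun j => d j • wt j) (fun _ _ => Nat.zero_le _)
        (Finset.mem_univ i)
    have h2 : 1 ≤ wt i := by fin_cases i <;> simp [wt]
    have h3 : d i ≤ n := by nlinarith
    simpa using h3
  refine ⟨MvPowerSeries.trunc' ℂ (Finsupp.equivFunOnFinite.symm fun _ => n) f, ?_, ?_⟩
  · intro d hd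
    rw [coeff_trunc'] at hd
    by_contra hne
    apply hd
    have : coeff d f = 0 := by
      by_contra h0
      exact hne (hf d h0)
    simp [this]
  · ext d
    rw [MvPolynomial.coeff_coe, coeff_trunc']
    split_ifs with hle
    · rfl
    · by_contra h0
      exact hle (hb d (Ne.symm h0))

theorem apply_coe (φ : O →ₐ[ℂ] O) (p : MvPolynomial (Fin 3) ℂ) :
    φ (p : O) = MvPolynomial.aeval (fun i => φ (X i)) p := by
  have h : φ.comp (MvPolynomial.coeToMvPowerSeries.algHom ℂ) =
      MvPolynomial.aeval (fun i => φ (X i)) := by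
    apply MvPolynomial.algHom_ext
    intro i
    simp
  have h' := DFunLike.congr_fun h p
  simpa [MvPolynomial.coeToMvPowerSeries.algHom_apply] using h'

theorem wh_zero (n : ℕ) : WH (0 : O) n := by
  intro d hd
  simp at hd

theorem wh_C (c : ℂ) : WH (C c : O) 0 := by
  intro d hd
  classical
  rw [coeff_C] at hd
  by_cases h : d = 0
  · simp [h]
  · simp [h] at hd

theorem wh_X (i : Fin 3) : WH (X i : O) (wt i) := by
  intro d hd
  classical
  rw [coeff_X] at hd
  by_cases h : d = Finsupp.single i 1
  · simp [h, Finsupp.weight_single]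
  · simp [h] at hd

theorem wh_add {f g : O} {n : ℕ} (hf : WH f n) (hg : WH g n) : WH (f + g) n := by
  intro d hd
  by_cases h : coeff d f = 0
  · exact hg d (by simpa [h] using hd)
  · exact hf d h

theorem wh_mul {f g : O} {n m : ℕ} (hf : WH f n) (hg : WH g m) : WH (f * g) (n + m) :=
  fun _ hd => IsWeightedHomogeneous.mul (w := wt) (f := f) (g := g) (fun {d} h => hf d h)
    (fun {d} h => hg d h) hd

theorem wh_sum {ι : Type} (s : Finset ι) (g : ι → O) (n : ℕ)
    (h : ∀ i ∈ s, WH (g i) n) :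
    WH (∑ i ∈ s, g i) n := by
  classical
  induction s using Finset.induction_on with
  | empty => simpa using wh_zero n
  | insert a s ha ih =>
    rw [Finset.sum_insert ha]
    exact wh_add (h a (Finset.mem_insert_self a s))
      (ih fun i hi => h i (Finset.mem_insert_of_mem hi))

theorem wh_pow {f : O} {n : ℕ} (h : WH f n) (m : ℕ) :
    WH (f ^ m) (m * n) := by
  induction m with
  | zero =>
    rw [pow_zero, Nat.zero_mul, ← map_one (C : ℂ →+* O)]
    exact wh_C 1
  | succ m ih =>
    rw [pow_succ, Nat.succ_mul]
    exact wh_mul ih h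

theorem wh_map (φ : O →ₐ[ℂ] O) (h : ∀ i, WH (φ (X i)) (wt i))
    {f : O} {n : ℕ} (hf : WH f n) : WH (φ f) n := by
  obtain ⟨p, hp, rfl⟩ := exists_poly hf
  rw [apply_coe, MvPolynomial.aeval_def, MvPolynomial.eval₂_eq']
  refine wh_sum _ _ _ fun d hd => ?_
  have hw : Finsupp.weight wt d = n := hp (MvPolynomial.mem_support_iff.mp hd)
  rw [Finsupp.weight_apply, Finsupp.sum_fintype _ _ (by simp)] at hw
  simp only [Fin.sum_univ_three, smul_eq_mul] at hw
  rw [← hw, Fin.prod_univ_three, ← zero_add (_ + _)]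
  exact wh_mul (wh_C _) (wh_mul (wh_mul (wh_pow (h 0) _) (wh_pow (h 1) _)) (wh_pow (h 2) _))

theorem mem_WAut (φ : O ≃ₐ[ℂ] O) (h : ∀ i, WH (φ (X i)) (wt i))
    (h' : ∀ i, WH (φ.symm (X i)) (wt i)) : φ ∈ WAut := by
  intro f n
  refine ⟨fun hf => ?_, fun hf => wh_map φ.toAlgHom h hf⟩
  have := wh_map φ.symm.toAlgHom h' hf
  simpa using this

/-- An automorphism of the form `x ↦ λ x, y ↦ λ y, z ↦ λ² z`. -/
def IsScaling (φ : O ≃ₐ[ℂ] O) (c : ℂˣ) : Prop :=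
  ∀ i, φ (X i) = C ((c : ℂ) ^ wt i) * X i

theorem algEquiv_C (φ : O ≃ₐ[ℂ] O) (c : ℂ) : φ (C c) = C c := φ.commutes c

theorem IsScaling.apply {φ : O ≃ₐ[ℂ] O} {c : ℂˣ} (h : IsScaling φ c) {f : O} {n : ℕ}
    (hf : WH f n) : φ f = C ((c : ℂ) ^ n) * f := by
  obtain ⟨p, hp, rfl⟩ := exists_poly hf
  have e1 : φ (p : O) = _ := apply_coe φ.toAlgHom p
  have e2 : (p : O) = _ := apply_coe (AlgHom.id ℂ O) p
  rw [e1]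
  conv_rhs => rw [e2]
  rw [MvPolynomial.aeval_def, MvPolynomial.aeval_def, MvPolynomial.eval₂_eq',
    MvPolynomial.eval₂_eq', Finset.mul_sum]
  refine Finset.sum_congr rfl fun d hd => ?_
  have hw : Finsupp.weight wt d = n := hp (MvPolynomial.mem_support_iff.mp hd)
  rw [Finsupp.weight_apply, Finsupp.sum_fintype _ _ (by simp)] at hw
  simp only [Fin.sum_univ_three, smul_eq_mul] at hw
  have hX : ∀ i, φ.toAlgHom (X i) = C ((c : ℂ) ^ wt i) * X i := h
  simp only [Fin.prod_univ_three, hX, AlgHom.coe_id, id_eq]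
  rw [← hw]
  simp only [mul_pow, map_pow, map_mul, pow_add, ← pow_mul, mul_comm (d _) (wt _)]
  ring

/-- The subgroup of the scalings. -/
def Scalings : Subgroup WAut where
  carrier := {φ | ∃ c : ℂˣ, IsScaling φ.1 c}
  mul_mem' := by
    rintro φ ψ ⟨c, hc⟩ ⟨d, hd⟩
    refine ⟨c * d, fun i => ?_⟩
    change φ.1 (ψ.1 (X i)) = _
    rw [hd i, map_mul, algEquiv_C, hc i, ← mul_assoc, ← map_mul, Units.val_mul, mul_pow,
      mul_comm ((c : ℂ) ^ _)]
  one_mem' := ⟨1, fun i => by simp⟩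
  inv_mem' := by
    rintro φ ⟨c, hc⟩
    refine ⟨c⁻¹, fun i => ?_⟩
    change φ.1.symm (X i) = _
    rw [AlgEquiv.symm_apply_eq, map_mul, algEquiv_C, hc i, ← mul_assoc, ← map_mul, ← mul_pow]
    simp

instance : Scalings.Normal where
  conj_mem := by
    rintro φ ⟨c, hc⟩ ψ
    refine ⟨c, fun i => ?_⟩
    change ψ.1 (φ.1 (ψ⁻¹.1 (X i))) = _
    have h : WH (ψ⁻¹.1 (X i)) (wt i) := (ψ⁻¹.2 (X i) (wt i)).mpr (wh_X i)
    rw [hc.apply h, map_mul, algEquiv_C]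
    congr 1
    exact ψ.1.apply_symm_apply (X i)

/-- `PGL₃ʷ(ℂ)`: the weight preserving automorphisms modulo the `ℂ*`-action. -/
abbrev PGLw : Type := WAut ⧸ Scalings

/-! ### The groupoids of the family -/

/-- The classes of the weight preserving automorphisms that carry `I_k(t)` onto `I_k(s)`. -/
def homSet (k : ℕ∞) (t s : ℂ) : Set PGLw :=
  {g | ∃ φ : WAut, QuotientGroup.mk φ = g ∧ (I k t).map φ.1 = I k s}

theorem one_mem_homSet (k : ℕ∞) (t : ℂ) : (1 : PGLw) ∈ homSet k t t :=
  ⟨1, rfl, Ideal.map_id _⟩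

theorem mul_mem_homSet {k : ℕ∞} {t s r : ℂ} {g h : PGLw} (hg : g ∈ homSet k t s)
    (hh : h ∈ homSet k s r) : h * g ∈ homSet k t r := by
  obtain ⟨φ, rfl, hφ⟩ := hg
  obtain ⟨ψ, rfl, hψ⟩ := hh
  refine ⟨ψ * φ, rfl, ?_⟩
  rw [← hψ, ← hφ]
  exact (Ideal.map_map (φ.1 : O →+* O) (ψ.1 : O →+* O)).symm

theorem inv_mem_homSet {k : ℕ∞} {t s : ℂ} {g : PGLw} (hg : g ∈ homSet k t s) :
    g⁻¹ ∈ homSet k s t := by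
  obtain ⟨φ, rfl, hφ⟩ := hg
  refine ⟨φ⁻¹, rfl, ?_⟩
  rw [← hφ]
  refine (Ideal.map_map (φ.1 : O →+* O) ((φ⁻¹ : WAut).1 : O →+* O)).trans ?_
  convert Ideal.map_id _
  ext1 f
  exact φ.1.symm_apply_apply f

/-- The objects of the groupoid `Grp^k`: the parameters `t`. -/
structure Grpd (k : ℕ∞) where
  /-- the parameter -/
  param : Param

/-- The groupoid `Grp^k`: a morphism `t ⟶ s` is a weight preserving automorphism carrying `I_k(t)`
onto `I_k(s)`, modulo `ℂ*`; morphisms are composed as maps. -/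
instance (k : ℕ∞) : CategoryTheory.Groupoid (Grpd k) where
  Hom t s := {g : PGLw // g ∈ homSet k t.param.1 s.param.1}
  id t := ⟨1, one_mem_homSet k t.param.1⟩
  comp f g := ⟨g.1 * f.1, mul_mem_homSet f.2 g.2⟩
  inv f := ⟨f.1⁻¹, inv_mem_homSet f.2⟩
  id_comp f := Subtype.ext (mul_one f.1)
  comp_id f := Subtype.ext (one_mul f.1)
  assoc f g h := Subtype.ext (mul_assoc h.1 g.1 f.1).symm
  inv_comp f := Subtype.ext (mul_inv_cancel f.1)
  comp_inv f := Subtype.ext (inv_mul_cancel f.1)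

/-- The set of morphisms from `t` to `s` in the groupoid `Grp^k`, inside `PGL₃ʷ(ℂ)`. -/
def homs (k : ℕ∞) (t s : Param) : Set PGLw :=
  Set.range fun φ : ((⟨t⟩ : Grpd k) ⟶ ⟨s⟩) => φ.1

/-! ### The matrices `B` and `B̃` -/

/-- The set `{±1, ±i}`. -/
abbrev Mu4 : Type := {α : ℂ // α = 1 ∨ α = -1 ∨ α = Complex.I ∨ α = -Complex.I}

theorem Mu4.ne_zero (α : Mu4) : α.1 ≠ 0 := by
  rcases α with ⟨α, rfl | rfl | rfl | rfl⟩ <;> simp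

/-- Index set of the matrices `B_{α,β}`: `diag α` stands for `B_{α,0}`, `anti β` for `B_{0,β}`,
and `full α β` for `B_{α,β}`, where `α, β ∈ {±1, ±i}`. -/
inductive BIdx
  | diag (α : Mu4)
  | anti (β : Mu4)
  | full (α β : Mu4)

/-- The matrices `B_{α,0}`, `B_{0,β}`, `B_{α,β}`. -/
def BIdx.mat : BIdx → Matrix (Fin 2) (Fin 2) ℂ
  | .diag α => !![1, 0; 0, α.1]
  | .anti β => !![0, β.1; 1, 0]
  | .full α β => !![1, β.1; α.1, -(α.1 * β.1)]

theorem BIdx.det_ne_zero (b : BIdx) : b.mat.det ≠ 0 := by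
  cases b with
  | diag α => simpa [BIdx.mat] using α.ne_zero
  | anti β => simpa [BIdx.mat] using β.ne_zero
  | full α β =>
    have h : (BIdx.full α β).mat.det = -2 * (α.1 * β.1) := by
      simp [BIdx.mat, Matrix.det_fin_two]; ring
    rw [h]
    exact mul_ne_zero (by norm_num) (mul_ne_zero α.ne_zero β.ne_zero)

/-- The matrices `B` as elements of `GL₂(ℂ)`. -/
def BIdx.gl (b : BIdx) : GL (Fin 2) ℂ := Matrix.GeneralLinearGroup.mkOfDetNeZero b.mat b.det_ne_zero

/-- The parameter transformations attached to the matrices: `t ↦ α² t` for `B_{α,0}` and `B_{0,α}`,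
and `t ↦ β² (12 - 2 α² t) / (2 + α² t)` for `B_{α,β}`. -/
def BIdx.trans : BIdx → ℂ → ℂ
  | .diag α, t => α.1 ^ 2 * t
  | .anti β, t => β.1 ^ 2 * t
  | .full α β, t => β.1 ^ 2 * (12 - 2 * α.1 ^ 2 * t) / (2 + α.1 ^ 2 * t)

/-- The coordinate change `(x, y, z) = (M (x', y'), γ z')`. -/
def blockVec (M : Matrix (Fin 2) (Fin 2) ℂ) (γ : ℂ) : Fin 3 → O :=
  ![C (M 0 0) * X 0 + C (M 0 1) * X 1, C (M 1 0) * X 0 + C (M 1 1) * X 1, C γ * X 2]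

theorem blockVec_hasSubst (M : Matrix (Fin 2) (Fin 2) ℂ) (γ : ℂ) : HasSubst (blockVec M γ) := by
  apply hasSubst_of_constantCoeff_zero
  intro i
  fin_cases i <;> simp [blockVec]

/-- Substitution of the coordinate change in power series. -/
def blockHom (M : Matrix (Fin 2) (Fin 2) ℂ) (γ : ℂ) : O →ₐ[ℂ] O :=
  substAlgHom (blockVec_hasSubst M γ)

theorem blockHom_X (M : Matrix (Fin 2) (Fin 2) ℂ) (γ : ℂ) (i : Fin 3) :
    blockHom M γ (X i) = blockVec M γ i := substAlgHom_X _ i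

theorem blockHom_comp (M N : Matrix (Fin 2) (Fin 2) ℂ) (γ δ : ℂ) (h : M * N = 1) (h' : γ * δ = 1)
    (f : O) : blockHom N δ (blockHom M γ f) = f := by
  have hc : ∀ c : ℂ, blockHom N δ (C c) = C c := fun c => (blockHom N δ).commutes c
  have e : (fun s => substAlgHom (blockVec_hasSubst N δ) (blockVec M γ s)) = (X : Fin 3 → O) := by
    have h00 : M 0 0 * N 0 0 + M 0 1 * N 1 0 = 1 := by
      simpa [Matrix.mul_apply] using congrFun (congrFun h 0) 0
    have h01 : M 0 0 * N 0 1 + M 0 1 * N 1 1 = 0 := by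
      simpa [Matrix.mul_apply] using congrFun (congrFun h 0) 1
    have h10 : M 1 0 * N 0 0 + M 1 1 * N 1 0 = 0 := by
      simpa [Matrix.mul_apply] using congrFun (congrFun h 1) 0
    have h11 : M 1 0 * N 0 1 + M 1 1 * N 1 1 = 1 := by
      simpa [Matrix.mul_apply] using congrFun (congrFun h 1) 1
    have g : ∀ {a b c d e : ℂ}, a * b + c * d = e → (C a * C b + C c * C d : O) = C e := by
      intro a b c d e he
      rw [← he, map_add, map_mul, map_mul]
    funext s
    change blockHom N δ (blockVec M γ s) = X s
    fin_cases s
    · simp only [blockVec, Fin.zero_eta, Matrix.cons_val_zero, map_add, map_mul, hc, blockHom_X,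
        Matrix.cons_val_one]
      linear_combination (X 0 : O) * (g h00) + (X 1 : O) * (g h01) +
        (X 0 : O) * (map_one (C : ℂ →+* O)) + (X 1 : O) * (map_zero (C : ℂ →+* O))
    · simp only [blockVec, Fin.mk_one, Matrix.cons_val_zero, map_add, map_mul, hc, blockHom_X,
        Matrix.cons_val_one]
      linear_combination (X 0 : O) * (g h10) + (X 1 : O) * (g h11) +
        (X 1 : O) * (map_one (C : ℂ →+* O)) + (X 0 : O) * (map_zero (C : ℂ →+* O))
    · have h2 := congrArg (C : ℂ → O) h'
      rw [map_mul, map_one] at h2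
      simp [blockVec, hc, blockHom_X, ← mul_assoc, h2]
  have hs := substAlgHom_comp_substAlgHom_apply (R := ℂ) (S := ℂ) (T := ℂ) (blockVec_hasSubst M γ)
    (blockVec_hasSubst N δ) f
  refine hs.trans ?_
  rw [substAlgHom_apply, e, subst_self]
  rfl

theorem blockVec_wh (M : Matrix (Fin 2) (Fin 2) ℂ) (γ : ℂ) (i : Fin 3) :
    WH (blockVec M γ i) (wt i) := by
  have h : ∀ (c : ℂ) (j : Fin 3), WH (C c * X j : O) (wt j) := fun c j => by
    simpa using wh_mul (wh_C c) (wh_X j)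
  fin_cases i
  · exact wh_add (h (M 0 0) 0) (h (M 0 1) 1)
  · exact wh_add (h (M 1 0) 0) (h (M 1 1) 1)
  · exact h γ 2

/-- The weight preserving automorphism `(x, y, z) = (M (x', y'), γ z')`. -/
def blockAut (M : GL (Fin 2) ℂ) (γ : ℂˣ) : WAut :=
  ⟨AlgEquiv.ofAlgHom (blockHom M.1 γ) (blockHom M⁻¹.1 (γ⁻¹ : ℂˣ))
      (AlgHom.ext fun f => blockHom_comp _ _ _ _ (Units.inv_mul M) (Units.inv_mul γ) f)
      (AlgHom.ext fun f => blockHom_comp _ _ _ _ (Units.mul_inv M) (Units.mul_inv γ) f),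
    mem_WAut _ (fun i => (blockHom_X M.1 γ i) ▸ blockVec_wh M.1 γ i)
      (fun i => (blockHom_X M⁻¹.1 (γ⁻¹ : ℂˣ) i) ▸ blockVec_wh M⁻¹.1 (γ⁻¹ : ℂˣ) i)⟩

/-- The class of the matrix `B̃_{α,β,γ}` in `PGL₃ʷ(ℂ)`. -/
def Bt (b : BIdx) (γ : ℂˣ) : PGLw := QuotientGroup.mk (blockAut b.gl γ)

/-! ### The groups `G'`, `H'`, and the group of the matrices `B̃` -/

/-- The element `1` of `{±1, ±i}`. -/
def mu1 : Mu4 := ⟨1, Or.inl rfl⟩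

/-- The element `i` of `{±1, ±i}`. -/
def muI : Mu4 := ⟨Complex.I, Or.inr (Or.inr (Or.inl rfl))⟩

/-- The class of the matrix `B` in `PGL₂(ℂ)`. -/
def Bcl (b : BIdx) : PGL(2, ℂ) := Matrix.ProjGenLinGroup.mk b.gl

/-- The subgroup `G'` of `PGL₂(ℂ)` generated by the classes of
`(1, 1; i, -i)`, `(1, 0; 0, i)` and `(0, 1; 1, 0)`. -/
def G' : Subgroup PGL(2, ℂ) :=
  Subgroup.closure {Bcl (.full muI mu1), Bcl (.diag muI), Bcl (.anti mu1)}

/-- The six transformations `±t`, `±(12 - 2t)/(2 + t)`, `±(12 + 2t)/(2 - t)` of the parameter. -/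
def sixTrans : Set (Equiv.Perm Param) :=
  {σ | ∃ ε : ℂ, (ε = 1 ∨ ε = -1) ∧
    ((∀ t, (σ t).1 = ε * t.1) ∨
      (∀ t, (σ t).1 = ε * ((12 - 2 * t.1) / (2 + t.1))) ∨
      (∀ t, (σ t).1 = ε * ((12 + 2 * t.1) / (2 - t.1))))}

/-- The group `H'` generated by the six transformations, under composition. -/
def H' : Subgroup (Equiv.Perm Param) := Subgroup.closure sixTrans

/-- The subgroup of `PGL₃ʷ(ℂ)` generated by the classes of the matrices `B̃_{α,β,γ}`. -/
def BtGroup : Subgroup PGLw := Subgroup.closure (Set.range fun p : BIdx × ℂˣ => Bt p.1 p.2)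

/-! ### The first Yau algebra -/

/-- The first Yau algebra: the Lie algebra of the `ℂ`-derivations of the first moduli algebra. -/
abbrev L1 (t : ℂ) : Type := Derivation ℂ (A 1 t) (A 1 t)

/-- The class of a power series in the first moduli algebra. -/
def cl (t : ℂ) (f : O) : A 1 t := Ideal.Quotient.mk (I 1 t) f

/-- The derivation `δ` is homogeneous of degree `i`: it maps classes of weighted homogeneous
elements of weight `n` to classes of elements of weight `n + i`. -/
def IsHomogDer (t : ℂ) (i : ℤ) (δ : L1 t) : Prop :=
  ∀ (n : ℕ) (f : O), WH f n →
    ∃ g : O, (∀ d, coeff d g ≠ 0 → ((Finsupp.weight wt d : ℕ) : ℤ) = n + i) ∧ δ (cl t f) = cl t g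

/-- The Lie algebra isomorphism `φ` is homogeneous. -/
def IsHomogIso {t s : ℂ} (φ : L1 t ≃ₗ⁅ℂ⁆ L1 s) : Prop :=
  ∀ (i : ℤ) (δ : L1 t), IsHomogDer t i δ ↔ IsHomogDer s i (φ δ)

/-- The ordered lines `ℓ 0, ℓ 1, ℓ 2, ℓ 3` lie in a plane, and their cross-ratio is defined
(`ℓ 0 ≠ ℓ 3` and `ℓ 1 ≠ ℓ 2`) and equal to `c`. In slopes `u` the cross-ratio is
`(u₂ - u₀) (u₃ - u₁) / ((u₂ - u₁) (u₃ - u₀))`. -/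
def HasCrossRatio {V : Type*} [AddCommMonoid V] [Module ℂ V] (l : Fin 4 → Submodule ℂ V)
    (c : ℂ) : Prop :=
  ∃ (p q : V) (a b : Fin 4 → ℂ), LinearIndependent ℂ ![p, q] ∧
    (∀ i, (a i ≠ 0 ∨ b i ≠ 0) ∧ l i = Submodule.span ℂ {a i • p + b i • q}) ∧
    a 0 * b 3 - a 3 * b 0 ≠ 0 ∧ a 1 * b 2 - a 2 * b 1 ≠ 0 ∧
    c = (a 0 * b 2 - a 2 * b 0) * (a 1 * b 3 - a 3 * b 1) /
      ((a 1 * b 2 - a 2 * b 1) * (a 0 * b 3 - a 3 * b 0))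

end E7

end

open E7

namespace E7

/-! ### Coefficients and powers of the maximal ideal -/

/-! Groups and groupoids. A weight preserving automorphism is given by an invertible matrix M on x,
y, a factor γ ≠ 0 of z, and a quadratic form added to γz (`exists_isTri`). Comparing coefficients of
low order shows that a morphism has no quadratic form. For k ≥ 2 the matrix M must carry q_t = x⁴ +
y⁴ + t x²y² to a multiple of q_s. Since the Hessian is a covariant, M preserves the pencil of x⁴ +
y⁴ and x²y², and is therefore a scalar times one of the 24 matrices B (`octShape_of_rel`); γ² is the
factor of the quartic. For k = 0, 1 the ideal contains f_t by Euler's relation and is J(f_t) or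
mJ(f_t). Rescaling z preserves it, so γ is free. In degree four I_1(s) is the kernel of one
functional on quartic forms (`socle`), which is apolar to the quartic with parameter -12/s. The
Hessian argument applied to this quartic and the transpose of M again gives the matrices B. It needs
s ≠ 0 and (-12/s)² ≠ 4, that is s ≠ ±6: these are the jump points.

The 24 matrices are encoded by exponents of i in the finite type `Oct`. Acting on the four diagonals
of a cube identifies them with S₄; acting on the three axes gives a map to S₃ with the same kernel
as the map to H', so H' is S₃.

Torelli. The algebra A^1 has a basis of 12 monomials, in which its derivations are computed
(`nf_der`, `exists_der`). Off the jump points the degree zero part of L^1 is spanned by the Euler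
field x∂_x + y∂_y and z∂_z. Degree one consists of the z∂_i, the f_i∂_z (with f_i the partials of
q_t) and the quadratic fields in x, y. The latter have three pairs of coordinates: g for linear
forms times the Euler field, m for the Hamiltonian fields of the partials of q_t, and n for those of
the partials of -1/24 times its Hessian.

A Lie isomorphism φ need not be graded, but the fields of degree one go to fields without part of
degree zero, degree three is preserved, and z∂_z separates the quadratic fields from the others.
Brackets of degree one can thus be compared modulo degree three (`Deg1.bracket`). Their relations
involve only A = t² + 12 and B = 4t(t² - 36), up to constants the two invariants of the quartic. On
the three pairs φ acts by G, ρG, ρ²G with one matrix G and one scalar ρ, and A_t = ρ²A_s, B_t =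
ρ³B_s (`exists_map_coords`). So A³/B² is an invariant of the Lie algebra, and equality of its values
splits into six factors, one for each transformation in H' (`exists_trans_eq`); each of these comes
from a contact equivalence.

The fields h₁ and h₂ are half the Hamiltonian field of q_t and that of -1/24 times the Hessian. A
graded isomorphism multiplies them by c and cρ, and the other two lines are spanned by combinations
that are homogeneous in ρ. -/

/-- The exponent `(i, j, k)`. -/
noncomputable def ex (i j k : ℕ) : Fin 3 →₀ ℕ := Finsupp.equivFunOnFinite.symm ![i, j, k]

/-- The coefficient at `x ^ i * y ^ j * z ^ k`. -/
noncomputable def cf (i j k : ℕ) : O →ₗ[ℂ] ℂ := coeff (ex i j k)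

theorem ex_zero (i j k : ℕ) : ex i j k 0 = i := rfl

theorem ex_one (i j k : ℕ) : ex i j k 1 = j := rfl

theorem ex_two (i j k : ℕ) : ex i j k 2 = k := rfl

theorem eq_ex (d : Fin 3 →₀ ℕ) : d = ex (d 0) (d 1) (d 2) := by
  ext i; fin_cases i <;> rfl

theorem ex_le {i j k a b c : ℕ} : ex a b c ≤ ex i j k ↔ a ≤ i ∧ b ≤ j ∧ c ≤ k := by
  constructor
  · intro h; exact ⟨h 0, h 1, h 2⟩
  · rintro ⟨h0, h1, h2⟩ s
    fin_cases s
    exacts [h0, h1, h2]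

theorem ex_sub (i j k a b c : ℕ) : ex i j k - ex a b c = ex (i - a) (j - b) (k - c) := by
  ext s; fin_cases s <;> rfl

theorem ex_weight (i j k : ℕ) : Finsupp.weight wt (ex i j k) = i + j + 2 * k := by
  rw [Finsupp.weight_apply, Finsupp.sum_fintype _ _ (by simp), Fin.sum_univ_three]
  simp [ex_zero, ex_one, ex_two, wt]; ring

theorem single_eq_ex0 (n : ℕ) : Finsupp.single 0 n = ex n 0 0 := by
  ext s; fin_cases s <;> simp [ex]

theorem single_eq_ex1 (n : ℕ) : Finsupp.single 1 n = ex 0 n 0 := by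
  ext s; fin_cases s <;> simp [ex]

theorem single_eq_ex2 (n : ℕ) : Finsupp.single 2 n = ex 0 0 n := by
  ext s; fin_cases s <;> simp [ex]

theorem cf_X0_pow_mul (i j k n : ℕ) (f : O) :
    cf i j k (X 0 ^ n * f) = if n ≤ i then cf (i - n) j k f else 0 := by
  simp [cf, X_pow_eq, coeff_monomial_mul, single_eq_ex0, ex_le, ex_sub]

theorem cf_X1_pow_mul (i j k n : ℕ) (f : O) :
    cf i j k (X 1 ^ n * f) = if n ≤ j then cf i (j - n) k f else 0 := by
  simp [cf, X_pow_eq, coeff_monomial_mul, single_eq_ex1, ex_le, ex_sub]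

theorem cf_X2_pow_mul (i j k n : ℕ) (f : O) :
    cf i j k (X 2 ^ n * f) = if n ≤ k then cf i j (k - n) f else 0 := by
  simp [cf, X_pow_eq, coeff_monomial_mul, single_eq_ex2, ex_le, ex_sub]

theorem cf_X0_mul (i j k : ℕ) (f : O) :
    cf i j k (X 0 * f) = if 1 ≤ i then cf (i - 1) j k f else 0 := by
  simpa using cf_X0_pow_mul i j k 1 f

theorem cf_X1_mul (i j k : ℕ) (f : O) :
    cf i j k (X 1 * f) = if 1 ≤ j then cf i (j - 1) k f else 0 := by
  simpa using cf_X1_pow_mul i j k 1 f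

theorem cf_X2_mul (i j k : ℕ) (f : O) :
    cf i j k (X 2 * f) = if 1 ≤ k then cf i j (k - 1) f else 0 := by
  simpa using cf_X2_pow_mul i j k 1 f

theorem cf_C_mul (i j k : ℕ) (c : ℂ) (f : O) : cf i j k (C c * f) = c * cf i j k f := by
  simp [cf]

theorem cf_one (i j k : ℕ) : cf i j k 1 = if i = 0 ∧ j = 0 ∧ k = 0 then 1 else 0 := by
  have h : (1 : O) = X 0 ^ 0 := by simp
  rw [h, cf, coeff_X_pow]
  congr 1
  simp only [single_eq_ex0, eq_iff_iff]
  constructor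
  · intro h
    exact ⟨DFunLike.congr_fun h 0, DFunLike.congr_fun h 1, DFunLike.congr_fun h 2⟩
  · rintro ⟨rfl, rfl, rfl⟩; rfl

theorem cf_C (i j k : ℕ) (c : ℂ) :
    cf i j k (C c) = if i = 0 ∧ j = 0 ∧ k = 0 then c else 0 := by
  have := cf_C_mul i j k c 1
  rw [mul_one, cf_one] at this
  simpa using this

/-- The coefficient at a power of a product of the variables. -/
theorem cf_mon (i j k a b c : ℕ) (r : ℂ) :
    cf i j k (C r * (X 0 ^ a * (X 1 ^ b * X 2 ^ c))) = if i = a ∧ j = b ∧ k = c then r else 0 := by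
  rw [cf_C_mul, cf_X0_pow_mul, cf_X1_pow_mul, ← mul_one (X 2 ^ c), cf_X2_pow_mul, cf_one]
  split_ifs <;> first | (exfalso; omega) | simp

theorem ext_cf {f g : O} (h : ∀ i j k, cf i j k f = cf i j k g) : f = g := by
  ext d
  rw [eq_ex d]
  exact h _ _ _

theorem mem_maxIdeal_X (i : Fin 3) : (X i : O) ∈ maxIdeal := Ideal.subset_span ⟨i, rfl⟩

/-- The coefficients which do not involve `x`. -/
theorem exists_decomp (f : O) :
    ∃ (c : ℂ) (f0 f1 f2 : O), f = C c + X 0 * f0 + X 1 * f1 + X 2 * f2 := by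
  let g : (Fin 3 →₀ ℕ) → Prop := fun d => d 0 = 0
  have split : ∀ (s : Fin 3) (f : O), ∃ q r : O, f = X s * q + r ∧
      ∀ d : Fin 3 →₀ ℕ, coeff d r = if d s = 0 then coeff d f else 0 := by
    intro s f
    let r : O := fun d => if d s = 0 then coeff d f else 0
    have hr : ∀ d, coeff d r = if d s = 0 then coeff d f else 0 := fun d => rfl
    have : X s ∣ f - r := by
      rw [X_dvd_iff]
      intro m hm
      simp [hr, hm]
    obtain ⟨q, hq⟩ := this
    exact ⟨q, r, by rw [← hq]; ring, hr⟩
  obtain ⟨f0, r0, h0, h0'⟩ := split 0 f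
  obtain ⟨f1, r1, h1, h1'⟩ := split 1 r0
  obtain ⟨f2, r2, h2, h2'⟩ := split 2 r1
  obtain ⟨c, hc⟩ : ∃ c, r2 = C c := by
    refine ⟨cf 0 0 0 f, ext_cf fun i j k => ?_⟩
    rw [cf_C]
    simp only [cf, h2', h1', h0', ex_zero, ex_one, ex_two]
    clear h0 h1 h2 h0' h1' h2'
    split_ifs <;> simp_all
  exact ⟨c, f0, f1, f2, by rw [h0, h1, h2, hc]; ring⟩

theorem mem_maxIdeal_iff {f : O} : f ∈ maxIdeal ↔ cf 0 0 0 f = 0 := by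
  constructor
  · intro h
    refine Submodule.span_induction ?_ (map_zero _) ?_ ?_ h
    · rintro _ ⟨i, rfl⟩
      fin_cases i
      · simpa using cf_X0_mul 0 0 0 1
      · simpa using cf_X1_mul 0 0 0 1
      · simpa using cf_X2_mul 0 0 0 1
    · intro x y _ _ hx hy; simp [hx, hy]
    · intro a x _ hx
      obtain ⟨c, f0, f1, f2, rfl⟩ := exists_decomp a
      simp [add_mul, mul_assoc, cf_X0_mul, cf_X1_mul, cf_X2_mul, cf_C_mul, hx]
  · intro h
    obtain ⟨c, f0, f1, f2, rfl⟩ := exists_decomp f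
    simp [cf_X0_mul, cf_X1_mul, cf_X2_mul, cf_C] at h
    subst h
    simp only [map_zero, zero_add]
    exact add_mem (add_mem (Ideal.mul_mem_right _ _ (mem_maxIdeal_X 0))
      (Ideal.mul_mem_right _ _ (mem_maxIdeal_X 1))) (Ideal.mul_mem_right _ _ (mem_maxIdeal_X 2))

/-- Being a nonunit is invariant under every ring automorphism, so `map_maxIdeal` needs no
continuity. -/
theorem mem_maxIdeal_iff_not_isUnit {f : O} : f ∈ maxIdeal ↔ ¬ IsUnit f := by
  rw [mem_maxIdeal_iff, MvPowerSeries.isUnit_iff_constantCoeff, isUnit_iff_ne_zero, not_not]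
  have : cf 0 0 0 f = constantCoeff f := by
    rw [cf, ← coeff_zero_eq_constantCoeff_apply]
    congr 1
    congr 1
    ext s; fin_cases s <;> rfl
  rw [this]

theorem map_mem_maxIdeal (φ : O ≃ₐ[ℂ] O) {f : O} : φ f ∈ maxIdeal ↔ f ∈ maxIdeal := by
  rw [mem_maxIdeal_iff_not_isUnit, mem_maxIdeal_iff_not_isUnit, MulEquiv.isUnit_map]

theorem map_maxIdeal (φ : O ≃ₐ[ℂ] O) : maxIdeal.map φ = maxIdeal := by
  apply le_antisymm
  · rw [Ideal.map_le_iff_le_comap]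
    intro f hf
    exact (map_mem_maxIdeal φ).mpr hf
  · intro f hf
    rw [← φ.apply_symm_apply f]
    exact Ideal.mem_map_of_mem _ ((map_mem_maxIdeal φ.symm).mpr hf)

theorem cf_of_mem_pow {n : ℕ} {f : O} (hf : f ∈ maxIdeal ^ n) {i j k : ℕ} (h : i + j + k < n) :
    cf i j k f = 0 := by
  induction n generalizing f i j k with
  | zero => omega
  | succ n ih =>
    rw [pow_succ'] at hf
    refine Submodule.mul_induction_on hf ?_ ?_
    · intro a ha b hb
      obtain ⟨c, f0, f1, f2, rfl⟩ := exists_decomp a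
      rw [mem_maxIdeal_iff] at ha
      simp [cf_X0_mul, cf_X1_mul, cf_X2_mul, cf_C] at ha
      subst ha
      have e : (C 0 + X 0 * f0 + X 1 * f1 + X 2 * f2) * b =
        X 0 * (f0 * b) + X 1 * (f1 * b) + X 2 * (f2 * b) := by rw [map_zero]; ring
      have m : ∀ (g : O) {i j k : ℕ}, i + j + k < n → cf i j k (g * b) = 0 :=
        fun g => ih (Ideal.mul_mem_left _ _ hb)
      have m0 : (if 1 ≤ i then cf (i - 1) j k (f0 * b) else 0) = 0 := by
        split_ifs
        exacts [m f0 (by omega), rfl]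
      have m1 : (if 1 ≤ j then cf i (j - 1) k (f1 * b) else 0) = 0 := by
        split_ifs
        exacts [m f1 (by omega), rfl]
      have m2 : (if 1 ≤ k then cf i j (k - 1) (f2 * b) else 0) = 0 := by
        split_ifs
        exacts [m f2 (by omega), rfl]
      rw [e, map_add, map_add, cf_X0_mul, cf_X1_mul, cf_X2_mul, m0, m1, m2]
      simp
    · intro a b ha hb; simp [ha, hb]

/-- A coefficient of total degree d vanishes on the power d + 1 of m. Together with the density of
polynomials this replaces continuity in the uniqueness statements below. -/
theorem eq_zero_of_mem_pow {f : O} (h : ∀ n, f ∈ maxIdeal ^ n) : f = 0 := by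
  apply ext_cf
  intro i j k
  rw [map_zero]
  exact cf_of_mem_pow (h (i + j + k + 1)) (Nat.lt_succ_self _)

/-! ### Density of polynomials; automorphisms and derivations are determined by the variables. -/

/-- Polynomials are dense. -/
theorem exists_poly_sub_mem (n : ℕ) (f : O) :
    ∃ p : MvPolynomial (Fin 3) ℂ, f - (p : O) ∈ maxIdeal ^ n := by
  induction n generalizing f with
  | zero => exact ⟨0, by simp⟩
  | succ n ih =>
    obtain ⟨c, f0, f1, f2, rfl⟩ := exists_decomp f
    obtain ⟨p0, h0⟩ := ih f0
    obtain ⟨p1, h1⟩ := ih f1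
    obtain ⟨p2, h2⟩ := ih f2
    refine ⟨MvPolynomial.C c + MvPolynomial.X 0 * p0 + MvPolynomial.X 1 * p1 +
      MvPolynomial.X 2 * p2, ?_⟩
    have e : C c + X 0 * f0 + X 1 * f1 + X 2 * f2 - ((MvPolynomial.C c + MvPolynomial.X 0 * p0 +
        MvPolynomial.X 1 * p1 + MvPolynomial.X 2 * p2 : MvPolynomial (Fin 3) ℂ) : O) =
        X 0 * (f0 - (p0 : O)) + X 1 * (f1 - (p1 : O)) + X 2 * (f2 - (p2 : O)) := by
      simp only [MvPolynomial.coe_add, MvPolynomial.coe_mul, MvPolynomial.coe_X, MvPolynomial.coe_C]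
      ring
    rw [e, pow_succ']
    exact add_mem (add_mem (Ideal.mul_mem_mul (mem_maxIdeal_X 0) h0)
      (Ideal.mul_mem_mul (mem_maxIdeal_X 1) h1)) (Ideal.mul_mem_mul (mem_maxIdeal_X 2) h2)

theorem map_mem_pow (φ : O ≃ₐ[ℂ] O) {n : ℕ} {f : O} (hf : f ∈ maxIdeal ^ n) :
    φ f ∈ maxIdeal ^ n := by
  rw [← map_maxIdeal φ, ← Ideal.map_pow]
  exact Ideal.mem_map_of_mem _ hf

/-- An automorphism is determined by the images of the variables. -/
theorem algEquiv_ext {φ ψ : O ≃ₐ[ℂ] O} (h : ∀ i, φ (X i) = ψ (X i)) : φ = ψ := by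
  ext1 f
  rw [← sub_eq_zero]
  apply eq_zero_of_mem_pow
  intro n
  obtain ⟨p, hp⟩ := exists_poly_sub_mem n f
  have e : φ (p : O) = ψ (p : O) := by
    have e1 : φ (p : O) = _ := apply_coe φ.toAlgHom p
    have e2 : ψ (p : O) = _ := apply_coe ψ.toAlgHom p
    rw [e1, e2]
    congr 2
    funext i
    exact h i
  have : φ f - ψ f = φ (f - p) - ψ (f - p) := by rw [map_sub, map_sub, e]; ring
  rw [this]
  exact sub_mem (map_mem_pow φ hp) (map_mem_pow ψ hp)

/-- The product rule lowers the m-adic order by at most one, so derivations are automatically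
continuous. -/
theorem derivation_mem_pow (D : Derivation ℂ O O) {n : ℕ} {f : O} (hf : f ∈ maxIdeal ^ (n + 1)) :
    D f ∈ maxIdeal ^ n := by
  induction n generalizing f with
  | zero => simp
  | succ n ih =>
    rw [pow_succ'] at hf
    refine Submodule.mul_induction_on hf ?_ ?_
    · intro a ha b hb
      rw [Derivation.leibniz, smul_eq_mul, smul_eq_mul]
      refine add_mem ?_ (Ideal.mul_mem_right _ _ hb)
      rw [pow_succ']
      exact Ideal.mul_mem_mul ha (ih hb)
    · intro a b ha hb; rw [map_add]; exact add_mem ha hb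

/-- A derivation of the power series ring is determined by the images of the variables. -/
theorem derivation_ext {D E : Derivation ℂ O O} (h : ∀ i, D (X i) = E (X i)) : D = E := by
  ext1 f
  rw [← sub_eq_zero]
  apply eq_zero_of_mem_pow
  intro n
  obtain ⟨p, hp⟩ := exists_poly_sub_mem (n + 1) f
  have e : ∀ p : MvPolynomial (Fin 3) ℂ, D (p : O) = E (p : O) := by
    intro p
    induction p using MvPolynomial.induction_on with
    | C a =>
      rw [MvPolynomial.coe_C]
      exact (D.map_algebraMap a).trans (E.map_algebraMap a).symm
    | add p q hp hq => rw [MvPolynomial.coe_add, map_add, map_add, hp, hq]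
    | mul_X p i hp => rw [MvPolynomial.coe_mul, MvPolynomial.coe_X, Derivation.leibniz,
        Derivation.leibniz, hp, h]
  have : D f - E f = D (f - p) - E (f - p) := by rw [map_sub, map_sub, e]; ring
  rw [this]
  exact sub_mem (derivation_mem_pow D hp) (derivation_mem_pow E hp)

/-- The derivation `P ∂ₓ + Q ∂_y + R ∂_z`. -/
noncomputable def vf (P : Fin 3 → O) : Derivation ℂ O O := ∑ i, P i • pderiv ℂ i

theorem vf_apply (P : Fin 3 → O) (f : O) :
    vf P f = P 0 * pderiv ℂ 0 f + P 1 * pderiv ℂ 1 f + P 2 * pderiv ℂ 2 f := by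
  simp [vf, Fin.sum_univ_three]

theorem vf_X (P : Fin 3 → O) (i : Fin 3) : vf P (X i) = P i := by
  rw [vf_apply]
  fin_cases i <;> simp

theorem derivation_eq_vf (D : Derivation ℂ O O) : D = vf fun i => D (X i) :=
  derivation_ext fun i => (vf_X (fun i => D (X i)) i).symm

/-! ### Moduli ideals under automorphisms and contact equivalence -/
-- A chain rule without coordinates: conjugating ∂_i by φ gives a derivation, and every derivation
-- of the power series ring is a combination of the partials.
theorem map_jacobiIdeal_le (φ : O ≃ₐ[ℂ] O) (f : O) :
    (jacobiIdeal f).map φ ≤ jacobiIdeal (φ f) := by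
  rw [jacobiIdeal, Ideal.map_span, Ideal.span_le]
  rintro _ ⟨_, ⟨i, rfl⟩, rfl⟩
  let D : Derivation ℂ O O := Derivation.mk'
    (φ.toLinearMap ∘ₗ (pderiv ℂ i).toLinearMap ∘ₗ φ.symm.toLinearMap) (by
      intro a b
      simp [Derivation.leibniz])
  have h : φ (pderiv ℂ i f) = D (φ f) := by
    change _ = φ (pderiv ℂ i (φ.symm (φ f)))
    rw [AlgEquiv.symm_apply_apply]
  change φ (pderiv ℂ i f) ∈ jacobiIdeal (φ f)
  rw [h, derivation_eq_vf D, vf_apply]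
  have m : ∀ j, pderiv ℂ j (φ f) ∈ jacobiIdeal (φ f) := fun j => Ideal.subset_span ⟨j, rfl⟩
  exact add_mem (add_mem (Ideal.mul_mem_left _ _ (m 0)) (Ideal.mul_mem_left _ _ (m 1)))
    (Ideal.mul_mem_left _ _ (m 2))

theorem map_symm_map (φ : O ≃ₐ[ℂ] O) (K : Ideal O) : (K.map φ.symm).map φ = K := by
  refine (Ideal.map_map (φ.symm : O →+* O) (φ : O →+* O)).trans ?_
  convert Ideal.map_id _
  ext1 f
  exact φ.apply_symm_apply f

theorem map_jacobiIdeal (φ : O ≃ₐ[ℂ] O) (f : O) :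
    (jacobiIdeal f).map φ = jacobiIdeal (φ f) := by
  apply le_antisymm (map_jacobiIdeal_le φ f)
  have h := Ideal.map_mono (f := φ) (map_jacobiIdeal_le φ.symm (φ f))
  rwa [map_symm_map, AlgEquiv.symm_apply_apply] at h

theorem moduliIdeal_top (f : O) : moduliIdeal ⊤ f = Ideal.span {f} := by
  simp [moduliIdeal]

theorem moduliIdeal_coe (n : ℕ) (f : O) :
    moduliIdeal n f = Ideal.span {f} ⊔ maxIdeal ^ n * jacobiIdeal f := by
  simp [moduliIdeal]

theorem map_moduliIdeal (φ : O ≃ₐ[ℂ] O) (k : ℕ∞) (f : O) :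
    (moduliIdeal k f).map φ = moduliIdeal k (φ f) := by
  have h : (Ideal.span {f}).map φ = Ideal.span {φ f} := by
    rw [Ideal.map_span, Set.image_singleton]
  induction k using ENat.recTopCoe with
  | top => rw [moduliIdeal_top, moduliIdeal_top, h]
  | coe n =>
    rw [moduliIdeal_coe, moduliIdeal_coe, Ideal.map_sup, h, Ideal.map_mul, Ideal.map_pow,
      map_maxIdeal, map_jacobiIdeal]

theorem jacobiIdeal_mul_le (u f : O) : jacobiIdeal (u * f) ≤ Ideal.span {f} ⊔ jacobiIdeal f := by
  rw [jacobiIdeal, Ideal.span_le]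
  rintro _ ⟨i, rfl⟩
  change pderiv ℂ i (u * f) ∈ _
  rw [Derivation.leibniz, smul_eq_mul, smul_eq_mul]
  refine add_mem (Ideal.mul_mem_left _ _ (Ideal.mem_sup_right (Ideal.subset_span ⟨i, rfl⟩)))
    (Ideal.mul_mem_right _ _ (Ideal.mem_sup_left (Ideal.mem_span_singleton_self f)))

/-- By the product rule the partials of u f lie in J(f) up to multiples of f, which the ideal
contains anyway. -/
theorem moduliIdeal_mul_le (k : ℕ∞) (u f : O) : moduliIdeal k (u * f) ≤ moduliIdeal k f := by
  have h : Ideal.span {u * f} ≤ Ideal.span {f} := by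
    rw [Ideal.span_singleton_le_span_singleton]
    exact Dvd.intro_left u rfl
  induction k using ENat.recTopCoe with
  | top => rwa [moduliIdeal_top, moduliIdeal_top]
  | coe n =>
    rw [moduliIdeal_coe, moduliIdeal_coe]
    refine sup_le (h.trans le_sup_left) ((Ideal.mul_mono_right (jacobiIdeal_mul_le u f)).trans ?_)
    rw [Ideal.mul_sup]
    exact sup_le_sup Ideal.mul_le_right le_rfl

theorem moduliIdeal_unit_mul (k : ℕ∞) (u : Oˣ) (f : O) :
    moduliIdeal k (u * f) = moduliIdeal k f := by
  apply le_antisymm (moduliIdeal_mul_le k u f)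
  have h := moduliIdeal_mul_le k (↑u⁻¹ : O) (u * f)
  rwa [Units.inv_mul_cancel_left] at h

theorem map_I_of_contact {t s : ℂ} {φ : O ≃ₐ[ℂ] O} {u : Oˣ} (h : φ (fam t) = u * fam s) (k : ℕ∞) :
    (I k t).map φ = I k s := by
  rw [I, map_moduliIdeal, h, moduliIdeal_unit_mul, I]

theorem pderiv_fam (t : ℂ) :
    pderiv ℂ 0 (fam t) = C 4 * X 0 ^ 3 + C (2 * t) * (X 0 * X 1 ^ 2) ∧
    pderiv ℂ 1 (fam t) = C 4 * X 1 ^ 3 + C (2 * t) * (X 0 ^ 2 * X 1) ∧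
    pderiv ℂ 2 (fam t) = C 2 * X 2 := by
  have h2 : (C 2 : O) = 2 := map_ofNat C 2
  have h4 : (C 4 : O) = 4 := map_ofNat C 4
  have x01 : pderiv ℂ 0 (X 1 : O) = 0 := pderiv_X_of_ne (by decide)
  have x02 : pderiv ℂ 0 (X 2 : O) = 0 := pderiv_X_of_ne (by decide)
  have x10 : pderiv ℂ 1 (X 0 : O) = 0 := pderiv_X_of_ne (by decide)
  have x12 : pderiv ℂ 1 (X 2 : O) = 0 := pderiv_X_of_ne (by decide)
  have x20 : pderiv ℂ 2 (X 0 : O) = 0 := pderiv_X_of_ne (by decide)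
  have x21 : pderiv ℂ 2 (X 1 : O) = 0 := pderiv_X_of_ne (by decide)
  refine ⟨?_, ?_, ?_⟩ <;>
  · simp only [fam, map_add, Derivation.leibniz, Derivation.leibniz_pow, pderiv_X_self, x01, x02, x10,
      x12, x20, x21, pderiv_C, smul_eq_mul, nsmul_eq_mul, map_mul, h2, h4]
    push_cast
    ring

theorem jacobiIdeal_fam (t : ℂ) : jacobiIdeal (fam t) =
    Ideal.span {C 4 * X 0 ^ 3 + C (2 * t) * (X 0 * X 1 ^ 2),
      C 4 * X 1 ^ 3 + C (2 * t) * (X 0 ^ 2 * X 1), C 2 * X 2} := by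
  obtain ⟨h0, h1, h2⟩ := pderiv_fam t
  rw [jacobiIdeal]
  apply le_antisymm
  · rw [Ideal.span_le]
    rintro _ ⟨i, rfl⟩
    fin_cases i
    · exact Ideal.subset_span (Or.inl h0)
    · exact Ideal.subset_span (Or.inr (Or.inl h1))
    · exact Ideal.subset_span (Or.inr (Or.inr h2))
  · rw [Ideal.span_le]
    rintro _ (rfl | rfl | rfl)
    · exact Ideal.subset_span ⟨0, h0⟩
    · exact Ideal.subset_span ⟨1, h1⟩
    · exact Ideal.subset_span ⟨2, h2⟩

/-- Euler's relation for the weights 1/4, 1/4, 1/2. It makes the generator f redundant for k = 0 and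
k = 1. -/
theorem fam_mem (t : ℂ) : fam t ∈ maxIdeal * jacobiIdeal (fam t) := by
  generalize hJ : jacobiIdeal (fam t) = J
  have m : ∀ j, pderiv ℂ j (fam t) ∈ J := fun j => hJ ▸ Ideal.subset_span ⟨j, rfl⟩
  have e : fam t = C (1 / 4) * (X 0 * pderiv ℂ 0 (fam t)) + C (1 / 4) * (X 1 * pderiv ℂ 1 (fam t)) +
      C (1 / 2) * (X 2 * pderiv ℂ 2 (fam t)) := by
    obtain ⟨h0, h1, h2⟩ := pderiv_fam t
    have e1 : (C (1 / 4) * C 4 : O) = 1 := by rw [← map_mul]; norm_num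
    have e2 : (C (1 / 2) * C 2 : O) = 1 := by rw [← map_mul]; norm_num
    have e3 : (C (1 / 4) * C (2 * t) : O) = C (1 / 2) * C t := by
      rw [← map_mul, ← map_mul]; congr 1; ring
    have e4 : (C (1 / 2) * C t + C (1 / 2) * C t : O) = C t := by
      rw [← map_mul, ← map_add]; congr 1; ring
    rw [h0, h1, h2, fam]
    linear_combination (-(X 0 : O) ^ 4 - X 1 ^ 4) * e1 - X 2 ^ 2 * e2 - (2 * X 0 ^ 2 * X 1 ^ 2) * e3 -
      (X 0 ^ 2 * X 1 ^ 2) * e4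
  rw [e]
  exact add_mem (add_mem (Ideal.mul_mem_left _ _ (Ideal.mul_mem_mul (mem_maxIdeal_X 0) (m 0)))
    (Ideal.mul_mem_left _ _ (Ideal.mul_mem_mul (mem_maxIdeal_X 1) (m 1))))
    (Ideal.mul_mem_left _ _ (Ideal.mul_mem_mul (mem_maxIdeal_X 2) (m 2)))

theorem I_zero (t : ℂ) : I 0 t = jacobiIdeal (fam t) := by
  have h := moduliIdeal_coe 0 (fam t)
  rw [pow_zero, one_mul] at h
  refine h.trans (sup_eq_right.mpr ?_)
  rw [Ideal.span_singleton_le_iff_mem]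
  exact Ideal.mul_le_right (fam_mem t)

theorem I_one (t : ℂ) : I 1 t = maxIdeal * jacobiIdeal (fam t) := by
  have h := moduliIdeal_coe 1 (fam t)
  rw [pow_one] at h
  refine h.trans (sup_eq_right.mpr ?_)
  rw [Ideal.span_singleton_le_iff_mem]
  exact fam_mem t

/-- Holds because I_1 = m I_0. Necessary conditions need then be derived only for k = 1, and
existence shown only for k = 0. -/
theorem map_I_one_of_zero {t s : ℂ} {φ : O ≃ₐ[ℂ] O} (h : (I 0 t).map φ = I 0 s) :
    (I 1 t).map φ = I 1 s := by
  rw [I_one, I_one, Ideal.map_mul, map_maxIdeal, ← I_zero, ← I_zero, h]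

/-! ### Weight preserving automorphisms in coordinates -/

/-- The automorphism sends `x, y, z` to `a x + b y`, `c x + d y`, `γ z + q₀ x² + q₁ x y + q₂ y²`. -/
structure IsTri (φ : O ≃ₐ[ℂ] O) (a b c d γ q0 q1 q2 : ℂ) : Prop where
  h0 : φ (X 0) = C a * X 0 + C b * X 1
  h1 : φ (X 1) = C c * X 0 + C d * X 1
  h2 : φ (X 2) = C γ * X 2 + (C q0 * X 0 ^ 2 + C q1 * (X 0 * X 1) + C q2 * X 1 ^ 2)

theorem WH.cf_eq_zero {f : O} {n : ℕ} (h : WH f n) {i j k : ℕ} (hn : i + j + 2 * k ≠ n) :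
    cf i j k f = 0 := by
  by_contra h0
  exact hn ((ex_weight i j k).symm.trans (h _ h0))

theorem WH.eq_of_one {f : O} (h : WH f 1) :
    f = C (cf 1 0 0 f) * X 0 + C (cf 0 1 0 f) * X 1 := by
  apply ext_cf
  intro i j k
  have e0 := cf_mon i j k 1 0 0 (cf 1 0 0 f)
  have e1 := cf_mon i j k 0 1 0 (cf 0 1 0 f)
  simp only [pow_zero, pow_one, mul_one, one_mul] at e0 e1
  rw [map_add, e0, e1]
  by_cases hw : i + j + 2 * k = 1
  · have : (i = 1 ∧ j = 0 ∧ k = 0) ∨ (i = 0 ∧ j = 1 ∧ k = 0) := by omega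
    rcases this with ⟨rfl, rfl, rfl⟩ | ⟨rfl, rfl, rfl⟩ <;> simp
  · rw [h.cf_eq_zero hw, if_neg (by omega), if_neg (by omega), add_zero]

theorem WH.eq_of_two {f : O} (h : WH f 2) :
    f = C (cf 0 0 1 f) * X 2 + (C (cf 2 0 0 f) * X 0 ^ 2 + C (cf 1 1 0 f) * (X 0 * X 1) +
      C (cf 0 2 0 f) * X 1 ^ 2) := by
  apply ext_cf
  intro i j k
  have e0 := cf_mon i j k 0 0 1 (cf 0 0 1 f)
  have e1 := cf_mon i j k 2 0 0 (cf 2 0 0 f)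
  have e2 := cf_mon i j k 1 1 0 (cf 1 1 0 f)
  have e3 := cf_mon i j k 0 2 0 (cf 0 2 0 f)
  simp only [pow_zero, pow_one, mul_one, one_mul] at e0 e1 e2 e3
  rw [map_add, map_add, map_add, e0, e1, e2, e3]
  by_cases hw : i + j + 2 * k = 2
  · have : (i = 0 ∧ j = 0 ∧ k = 1) ∨ (i = 2 ∧ j = 0 ∧ k = 0) ∨ (i = 1 ∧ j = 1 ∧ k = 0) ∨
      (i = 0 ∧ j = 2 ∧ k = 0) := by omega
    rcases this with ⟨rfl, rfl, rfl⟩ | ⟨rfl, rfl, rfl⟩ | ⟨rfl, rfl, rfl⟩ | ⟨rfl, rfl, rfl⟩ <;> simp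
  · rw [h.cf_eq_zero hw, if_neg (by omega), if_neg (by omega), if_neg (by omega),
      if_neg (by omega)]
    simp

theorem wAut_wh_X (φ : WAut) (i : Fin 3) : WH (φ.1 (X i)) (wt i) := (φ.2 (X i) (wt i)).mpr (E7.wh_X i)

theorem exists_isTri (φ : WAut) : ∃ a b c d γ q0 q1 q2, IsTri φ.1 a b c d γ q0 q1 q2 :=
  ⟨_, _, _, _, _, _, _, _, (wAut_wh_X φ 0 : WH _ 1).eq_of_one, (wAut_wh_X φ 1 : WH _ 1).eq_of_one,
    (wAut_wh_X φ 2 : WH _ 2).eq_of_two⟩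

theorem cf_linear (a b : ℂ) :
    cf 1 0 0 (C a * X 0 + C b * X 1) = a ∧ cf 0 1 0 (C a * X 0 + C b * X 1) = b := by
  have e0 := fun i j => cf_mon i j 0 1 0 0 a
  have e1 := fun i j => cf_mon i j 0 0 1 0 b
  simp only [pow_zero, pow_one, mul_one, one_mul] at e0 e1
  simp [e0, e1]

/-- The inverse automorphism has the same form; the coefficients of the composite are compared with
those of the identity. -/
theorem IsTri.det_ne_zero {φ : WAut} {a b c d γ q0 q1 q2 : ℂ}
    (h : IsTri φ.1 a b c d γ q0 q1 q2) : a * d - b * c ≠ 0 ∧ γ ≠ 0 := by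
  obtain ⟨a', b', c', d', γ', p0, p1, p2, h'⟩ := exists_isTri φ⁻¹
  have inv : ∀ f, φ.1 ((φ⁻¹).1 f) = f := fun f => φ.1.apply_symm_apply f
  have k0 := inv (X 0)
  have k1 := inv (X 1)
  have k2 := inv (X 2)
  rw [h'.h0, map_add, map_mul, map_mul, algEquiv_C, algEquiv_C, h.h0, h.h1] at k0
  rw [h'.h1, map_add, map_mul, map_mul, algEquiv_C, algEquiv_C, h.h0, h.h1] at k1
  rw [h'.h2] at k2
  simp only [map_add, map_mul, map_pow, algEquiv_C, h.h0, h.h1, h.h2] at k2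
  have l0 : C (a' * a + b' * c) * X 0 + C (a' * b + b' * d) * X 1 = C 1 * X 0 + C 0 * (X 1 : O) := by
    simp only [map_add, map_mul, map_one, map_zero]
    linear_combination k0
  have l1 : C (c' * a + d' * c) * X 0 + C (c' * b + d' * d) * X 1 = C 0 * X 0 + C 1 * (X 1 : O) := by
    simp only [map_add, map_mul, map_one, map_zero]
    linear_combination k1
  have m00 := congrArg (cf 1 0 0) l0
  have m01 := congrArg (cf 0 1 0) l0
  have m10 := congrArg (cf 1 0 0) l1
  have m11 := congrArg (cf 0 1 0) l1
  rw [(cf_linear _ _).1, (cf_linear _ _).1] at m00 m10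
  rw [(cf_linear _ _).2, (cf_linear _ _).2] at m01 m11
  constructor
  · intro hd
    have : (a' * d' - b' * c') * (a * d - b * c) = 1 := by
      linear_combination m00 * (c' * b + d' * d) + m11 - m01 * (c' * a + d' * c)
    rw [hd] at this
    simp at this
  · rintro rfl
    -- For γ = 0 the image of z involves only x and y, so z would lie in the ideal (x, y).
    have e : C 0 * X 0 + (X 2 : O) = X 0 * (C p0 * (C a * (C a * X 0 + C b * X 1)) +
      C p1 * (C a * (C c * X 0 + C d * X 1)) + C p2 * (C c * (C c * X 0 + C d * X 1)) + C γ' * (C q0 * X 0 + C q1 * X 1)) +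
      X 1 * (C p0 * (C b * (C a * X 0 + C b * X 1)) +
      C p1 * (C b * (C c * X 0 + C d * X 1)) + C p2 * (C d * (C c * X 0 + C d * X 1)) + C γ' * (C q2 * X 1)) := by
      rw [← k2, map_zero]
      ring
    have e' := congrArg (cf 0 0 1) e
    have e2 := cf_mon 0 0 1 0 0 1 1
    simp only [pow_zero, pow_one, one_mul, map_one] at e2
    rw [map_add, map_add, cf_X0_mul, cf_X1_mul, cf_C_mul, e2] at e'
    simp at e'

theorem isTri_blockAut (M : GL (Fin 2) ℂ) (γ : ℂˣ) :
    IsTri (blockAut M γ).1 (M 0 0) (M 0 1) (M 1 0) (M 1 1) γ 0 0 0 := by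
  refine ⟨blockHom_X M.1 γ 0, blockHom_X M.1 γ 1, ?_⟩
  refine (blockHom_X M.1 γ 2).trans ?_
  simp [blockVec]

theorem IsTri.ext {φ ψ : WAut} {a b c d γ q0 q1 q2 : ℂ} (h : IsTri φ.1 a b c d γ q0 q1 q2)
    (h' : IsTri ψ.1 a b c d γ q0 q1 q2) : φ = ψ := by
  apply Subtype.ext
  apply algEquiv_ext
  intro i
  fin_cases i
  · exact h.h0.trans h'.h0.symm
  · exact h.h1.trans h'.h1.symm
  · exact h.h2.trans h'.h2.symm

/-! ### Coordinate changes between the binary quartics `x⁴ + y⁴ + t x² y²` -/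

/-- The substitution `(x, y) ↦ (a x + b y, c x + d y)` carries `x⁴ + y⁴ + t x² y²` to
`l (x⁴ + y⁴ + s x² y²)`. -/
structure QuarticRel (t s l a b c d : ℂ) : Prop where
  h1 : a ^ 4 + c ^ 4 + t * (a ^ 2 * c ^ 2) = l
  h2 : b ^ 4 + d ^ 4 + t * (b ^ 2 * d ^ 2) = l
  h3 : 4 * (a ^ 3 * b + c ^ 3 * d) + 2 * t * (a ^ 2 * c * d + a * b * c ^ 2) = 0
  h4 : 4 * (a * b ^ 3 + c * d ^ 3) + 2 * t * (a * b * d ^ 2 + b ^ 2 * c * d) = 0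
  h5 : 6 * (a ^ 2 * b ^ 2 + c ^ 2 * d ^ 2) + t * (a ^ 2 * d ^ 2 + 4 * a * b * c * d + b ^ 2 * c ^ 2) =
    l * s

theorem mu4_of_pow {α : ℂ} (h : α ^ 4 = 1) : α = 1 ∨ α = -1 ∨ α = Complex.I ∨ α = -Complex.I := by
  have : (α - 1) * ((α + 1) * ((α - Complex.I) * (α + Complex.I))) = 0 := by
    linear_combination h + (1 - α ^ 2) * Complex.I_sq
  rcases mul_eq_zero.mp this with h | h
  · exact Or.inl (sub_eq_zero.mp h)
  rcases mul_eq_zero.mp h with h | h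
  · exact Or.inr (Or.inl (eq_neg_of_add_eq_zero_left h))
  rcases mul_eq_zero.mp h with h | h
  · exact Or.inr (Or.inr (Or.inl (sub_eq_zero.mp h)))
  · exact Or.inr (Or.inr (Or.inr (eq_neg_of_add_eq_zero_left h)))

theorem Mu4.pow_four (α : Mu4) : α.1 ^ 4 = 1 := by
  have h : Complex.I ^ 4 = 1 := Complex.I_pow_four
  rcases α with ⟨α, rfl | rfl | rfl | rfl⟩
  · simp
  · norm_num
  · exact h
  · rw [Even.neg_pow (by decide)]; exact h

theorem Mu4.sq (α : Mu4) : α.1 ^ 2 = 1 ∨ α.1 ^ 2 = -1 := by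
  have h : (α.1 ^ 2 - 1) * (α.1 ^ 2 + 1) = 0 := by linear_combination α.pow_four
  rcases mul_eq_zero.mp h with h | h
  · exact Or.inl (sub_eq_zero.mp h)
  · exact Or.inr (eq_neg_of_add_eq_zero_left h)

/-- The three shapes of the matrices of the octahedral group. -/
def OctShape (a b c d : ℂ) : Prop :=
  (b = 0 ∧ c = 0 ∧ d ^ 4 = a ^ 4) ∨ (a = 0 ∧ d = 0 ∧ b ^ 4 = c ^ 4) ∨
    (a * d = -(b * c) ∧ c ^ 4 = a ^ 4 ∧ b ^ 4 = a ^ 4)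

/-- The Hessian is a covariant, so a coordinate change between two quartics of the family preserves
the pencil spanned by `x⁴ + y⁴` and `x² y²`. -/
theorem octShape_of_rel {t a b c d : ℂ} (ht : t ^ 2 ≠ 4) (hd : a * d - b * c ≠ 0)
    (h12 : a ^ 4 + c ^ 4 + t * (a ^ 2 * c ^ 2) = b ^ 4 + d ^ 4 + t * (b ^ 2 * d ^ 2))
    (h3 : 4 * (a ^ 3 * b + c ^ 3 * d) + 2 * t * (a ^ 2 * c * d + a * b * c ^ 2) = 0)
    (h4 : 4 * (a * b ^ 3 + c * d ^ 3) + 2 * t * (a * b * d ^ 2 + b ^ 2 * c * d) = 0) :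
    OctShape a b c d := by
  have hr : 36 * (4 - t ^ 2) ≠ 0 := mul_ne_zero (by norm_num) (sub_ne_zero.mpr (Ne.symm ht))
  have hd2 : (a * d - b * c) ^ 2 * (36 * (4 - t ^ 2)) ≠ 0 := mul_ne_zero (pow_ne_zero 2 hd) hr
  set Q := 6 * (a ^ 2 * b ^ 2 + c ^ 2 * d ^ 2) +
    t * (a ^ 2 * d ^ 2 + 4 * a * b * c * d + b ^ 2 * c ^ 2) with hQ
  set A := a ^ 4 + c ^ 4 + t * (a ^ 2 * c ^ 2) with hA
  -- The Hessian of q = x⁴ + y⁴ + t x²y² is 24t(x⁴ + y⁴) + (144 - 12t²)x²y², and Hess(q∘M) = det(M)²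
  -- Hess(q)∘M. Since q∘M has no odd terms and equal outer coefficients, so has Hess(q)∘M.
  have key3 : (a * d - b * c) ^ 2 * (24 * t * (4 * (a ^ 3 * b + c ^ 3 * d)) +
      (144 - 12 * t ^ 2) * (2 * (a ^ 2 * c * d + a * b * c ^ 2))) = 0 := by
    linear_combination 72 * A * h4 - 12 * Q * h3
  have key4 : (a * d - b * c) ^ 2 * (24 * t * (4 * (a * b ^ 3 + c * d ^ 3)) +
      (144 - 12 * t ^ 2) * (2 * (a * b * d ^ 2 + b ^ 2 * c * d))) = 0 := by
    linear_combination 72 * (b ^ 4 + d ^ 4 + t * (b ^ 2 * d ^ 2)) * h3 - 12 * Q * h4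
  have key12 : (a * d - b * c) ^ 2 * (24 * t * (a ^ 4 + c ^ 4 - b ^ 4 - d ^ 4) +
      (144 - 12 * t ^ 2) * (a ^ 2 * c ^ 2 - b ^ 2 * d ^ 2)) = 0 := by
    linear_combination 24 * Q * h12 -
      9 * (4 * (a ^ 3 * b + c ^ 3 * d) + 2 * t * (a ^ 2 * c * d + a * b * c ^ 2)) * h3 +
      9 * (4 * (a * b ^ 3 + c * d ^ 3) + 2 * t * (a * b * d ^ 2 + b ^ 2 * c * d)) * h4
  -- Hess(q) - 24t q = 36(4 - t²)x²y², so x²y²∘M lies in the pencil too. Its odd coefficients are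
  -- 2ac(ad + bc) and 2bd(ad + bc).
  have p3 : a ^ 2 * c * d + a * b * c ^ 2 = 0 := by
    have : ((a * d - b * c) ^ 2 * (36 * (4 - t ^ 2))) * (2 * (a ^ 2 * c * d + a * b * c ^ 2)) = 0 := by
      linear_combination key3 - (a * d - b * c) ^ 2 * 24 * t * h3
    simpa using (mul_eq_zero.mp this).resolve_left hd2
  have p4 : a * b * d ^ 2 + b ^ 2 * c * d = 0 := by
    have : ((a * d - b * c) ^ 2 * (36 * (4 - t ^ 2))) * (2 * (a * b * d ^ 2 + b ^ 2 * c * d)) = 0 := by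
      linear_combination key4 - (a * d - b * c) ^ 2 * 24 * t * h4
    simpa using (mul_eq_zero.mp this).resolve_left hd2
  have p12 : a ^ 2 * c ^ 2 - b ^ 2 * d ^ 2 = 0 := by
    have : ((a * d - b * c) ^ 2 * (36 * (4 - t ^ 2))) * (a ^ 2 * c ^ 2 - b ^ 2 * d ^ 2) = 0 := by
      linear_combination key12 - (a * d - b * c) ^ 2 * 24 * t * h12
    exact (mul_eq_zero.mp this).resolve_left hd2
  have q3 : a ^ 3 * b + c ^ 3 * d = 0 := by
    linear_combination (1 / 4 : ℂ) * h3 - (t / 2) * p3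
  have q12 : a ^ 4 + c ^ 4 = b ^ 4 + d ^ 4 := by linear_combination h12 - t * p12
  -- Either ad + bc = 0, which leads to the full shape, or ac = bd = 0, and the matrix is diagonal
  -- or antidiagonal.
  by_cases hs : a * d + b * c = 0
  · refine Or.inr (Or.inr ?_)
    have had : a * d ≠ 0 := fun h => hd (by linear_combination 2 * h - hs)
    have hbc : b * c ≠ 0 := fun h => hd (by linear_combination hs - 2 * h)
    have ha : a ≠ 0 := left_ne_zero_of_mul had
    have hb : b ≠ 0 := left_ne_zero_of_mul hbc
    have hc : c ≠ 0 := right_ne_zero_of_mul hbc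
    refine ⟨eq_neg_of_add_eq_zero_left hs, ?_, ?_⟩
    · have : b * (c ^ 4 - a ^ 4) = 0 := by linear_combination c ^ 3 * hs - a * q3
      exact sub_eq_zero.mp ((mul_eq_zero.mp this).resolve_left hb)
    · have : c ^ 2 * (b ^ 4 - a ^ 4) = 0 := by
        linear_combination (-a ^ 2) * p12 - b ^ 2 * (a * d - b * c) * hs
      exact sub_eq_zero.mp ((mul_eq_zero.mp this).resolve_left (pow_ne_zero 2 hc))
  · have hac : a * c = 0 := by
      have : (a * d + b * c) * (a * c) = 0 := by linear_combination p3
      exact (mul_eq_zero.mp this).resolve_left hs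
    have hbd : b * d = 0 := by
      have : (a * d + b * c) * (b * d) = 0 := by linear_combination p4
      exact (mul_eq_zero.mp this).resolve_left hs
    rcases mul_eq_zero.mp hac with rfl | rfl
    · have hd0 : d = 0 := by
        rcases mul_eq_zero.mp hbd with rfl | h
        · simp at hs
        · exact h
      subst hd0
      exact Or.inr (Or.inl ⟨rfl, rfl, by linear_combination -q12⟩)
    · have hb0 : b = 0 := by
        rcases mul_eq_zero.mp hbd with h | rfl
        · exact h
        · simp at hs
      subst hb0
      exact Or.inl ⟨rfl, rfl, by linear_combination -q12⟩

/-- The scalar e is the entry normalised to 1 in B: it is a, or c in the antidiagonal case. The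
remaining ratios are fourth roots of unity. -/
theorem OctShape.exists_bIdx {a b c d : ℂ} (h : OctShape a b c d) (hd : a * d - b * c ≠ 0) :
    ∃ (β : BIdx) (e : ℂ), e ≠ 0 ∧ a = e * β.mat 0 0 ∧ b = e * β.mat 0 1 ∧ c = e * β.mat 1 0 ∧
      d = e * β.mat 1 1 := by
  have mu : ∀ {u v : ℂ}, u ^ 4 = v ^ 4 → v ≠ 0 → (u / v) ^ 4 = 1 := by
    intro u v h hv
    rw [div_pow, h, div_self (pow_ne_zero 4 hv)]
  rcases h with ⟨rfl, rfl, h⟩ | ⟨rfl, rfl, h⟩ | ⟨h, hc, hb⟩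
  · have ha : a ≠ 0 := by rintro rfl; simp at hd
    exact ⟨.diag ⟨d / a, mu4_of_pow (mu h ha)⟩, a, ha, by simp [BIdx.mat], by simp [BIdx.mat],
      by simp [BIdx.mat], by simp [BIdx.mat]; field_simp⟩
  · have hc : c ≠ 0 := by rintro rfl; simp at hd
    exact ⟨.anti ⟨b / c, mu4_of_pow (mu h hc)⟩, c, hc, by simp [BIdx.mat],
      by simp [BIdx.mat]; field_simp, by simp [BIdx.mat], by simp [BIdx.mat]⟩
  · have ha : a ≠ 0 := by
      rintro rfl
      have : c = 0 := by simpa using hc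
      subst this
      simp at hd
    refine ⟨.full ⟨c / a, mu4_of_pow (mu hc ha)⟩ ⟨b / a, mu4_of_pow (mu hb ha)⟩, a, ha,
      by simp [BIdx.mat], by simp [BIdx.mat]; field_simp, by simp [BIdx.mat]; field_simp, ?_⟩
    simp [BIdx.mat]
    field_simp
    linear_combination h

/-- The factor by which `B` multiplies the quartic. -/
noncomputable def BIdx.lam : BIdx → ℂ → ℂ
  | .full α _, t => 2 + α.1 ^ 2 * t
  | _, _ => 1

theorem lam_full_ne_zero (α : Mu4) {t : ℂ} (ht : t ^ 2 ≠ 4) : 2 + α.1 ^ 2 * t ≠ 0 := by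
  intro h
  apply ht
  rcases α.sq with h' | h' <;> rw [h'] at h
  · linear_combination (t - 2) * h
  · linear_combination (-t - 2) * h

theorem BIdx.lam_ne_zero (b : BIdx) {t : ℂ} (ht : t ^ 2 ≠ 4) : b.lam t ≠ 0 := by
  cases b with
  | full α β => exact lam_full_ne_zero α ht
  | _ => exact one_ne_zero

theorem BIdx.quarticRel (b : BIdx) {t : ℂ} (ht : t ^ 2 ≠ 4) (e : ℂ) :
    QuarticRel t (b.trans t) (e ^ 4 * b.lam t) (e * b.mat 0 0) (e * b.mat 0 1) (e * b.mat 1 0)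
      (e * b.mat 1 1) := by
  cases b with
  | diag α =>
    have h := α.pow_four
    constructor <;> simp [BIdx.mat, BIdx.lam, BIdx.trans] 
    all_goals first | ring1 | linear_combination e ^ 4 * h
  | anti α =>
    have h := α.pow_four
    constructor <;> simp [BIdx.mat, BIdx.lam, BIdx.trans] 
    all_goals first | ring1 | linear_combination e ^ 4 * h
  | full α β =>
    have h := α.pow_four
    have h' := β.pow_four
    have hl := lam_full_ne_zero α ht
    constructor <;> simp [BIdx.mat, BIdx.lam, BIdx.trans]
    · linear_combination e ^ 4 * h
    · linear_combination e ^ 4 * β.1 ^ 4 * h + e ^ 4 * (2 + t * α.1 ^ 2) * h'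
    · linear_combination -4 * e ^ 4 * β.1 * h
    · linear_combination -4 * e ^ 4 * β.1 ^ 3 * h
    · field_simp
      linear_combination 6 * e ^ 4 * β.1 ^ 2 * h

/-! ### The action on the family -/
-- The condition γ² = l makes z² scale by the same factor as the quartic.
theorem IsTri.map_fam {φ : O ≃ₐ[ℂ] O} {a b c d γ t s l : ℂ} (h : IsTri φ a b c d γ 0 0 0)
    (hq : QuarticRel t s l a b c d) (hγ : γ ^ 2 = l) : φ (fam t) = C l * fam s := by
  have h1 := congrArg (C : ℂ → O) hq.h1
  have h2 := congrArg (C : ℂ → O) hq.h2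
  have h3 := congrArg (C : ℂ → O) hq.h3
  have h4 := congrArg (C : ℂ → O) hq.h4
  have h5 := congrArg (C : ℂ → O) hq.h5
  have h6 := congrArg (C : ℂ → O) hγ
  have c2 : (C 2 : O) = 2 := map_ofNat C 2
  have c4 : (C 4 : O) = 4 := map_ofNat C 4
  have c6 : (C 6 : O) = 6 := map_ofNat C 6
  simp only [map_add, map_mul, map_pow, map_zero, c2, c4, c6] at h1 h2 h3 h4 h5 h6
  simp only [fam, map_add, map_mul, map_pow, algEquiv_C, h.h0, h.h1, h.h2, map_zero]
  linear_combination X 0 ^ 4 * h1 + X 1 ^ 4 * h2 + X 0 ^ 3 * X 1 * h3 + X 0 * X 1 ^ 3 * h4 +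
    X 0 ^ 2 * X 1 ^ 2 * h5 + X 2 ^ 2 * h6

theorem isUnit_C {l : ℂ} (hl : l ≠ 0) : ∃ u : Oˣ, (u : O) = C l :=
  (IsUnit.map (C : ℂ →+* O) (isUnit_iff_ne_zero.mpr hl))

theorem blockAut_comp_zscale (M : GL (Fin 2) ℂ) (γ δ : ℂˣ) :
    blockAut M (γ * δ) = blockAut M γ * blockAut 1 δ := by
  refine (isTri_blockAut M (γ * δ)).ext ⟨?_, ?_, ?_⟩
  all_goals
    have h := isTri_blockAut M γ
    have h' := isTri_blockAut 1 δ
    change (blockAut M γ).1 ((blockAut 1 δ).1 _) = _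
  · rw [h'.h0]; simp [h.h0]
  · rw [h'.h1]; simp [h.h1]
  · rw [h'.h2]; simp [algEquiv_C, h.h2, ← mul_assoc]
    left; ring

/-- The Jacobi ideal is generated by a multiple of z and by forms in x, y. This is why γ is
arbitrary for k = 0, 1. -/
theorem map_zscale (δ : ℂˣ) (t : ℂ) : (I 0 t).map (blockAut 1 δ).1 = I 0 t := by
  have le : ∀ δ : ℂˣ, (I 0 t).map (blockAut 1 δ).1 ≤ I 0 t := by
    intro δ
    have h' := isTri_blockAut 1 δ
    rw [I_zero, jacobiIdeal_fam, Ideal.map_span, Ideal.span_le]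
    have e0 : (blockAut 1 δ).1 (X 0) = X 0 := by rw [h'.h0]; simp
    have e1 : (blockAut 1 δ).1 (X 1) = X 1 := by rw [h'.h1]; simp
    have e2 : (blockAut 1 δ).1 (X 2) = C (δ : ℂ) * X 2 := by rw [h'.h2]; simp
    rintro _ ⟨_, rfl | rfl | rfl, rfl⟩
    · refine Ideal.subset_span (Or.inl ?_)
      simp [algEquiv_C, e0, e1]
    · refine Ideal.subset_span (Or.inr (Or.inl ?_))
      simp [algEquiv_C, e0, e1]
    · have e : (blockAut 1 δ).1 (C 2 * X 2) = C (δ : ℂ) * (C 2 * X 2) := by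
        rw [map_mul (blockAut 1 δ).1, algEquiv_C, e2, mul_left_comm]
      rw [e]
      exact Ideal.mul_mem_left _ _ (Ideal.subset_span (Or.inr (Or.inr rfl)))
  apply le_antisymm (le δ)
  have h := Ideal.map_mono (f := (blockAut 1 δ).1) (le δ⁻¹)
  refine le_trans (le_of_eq ?_) h
  have e : (blockAut 1 δ⁻¹).1 = (blockAut 1 δ).1.symm := by
    have : blockAut 1 δ⁻¹ = (blockAut 1 δ)⁻¹ := by
      rw [eq_inv_iff_mul_eq_one, ← blockAut_comp_zscale]
      simp only [inv_mul_cancel]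
      refine (isTri_blockAut 1 1).ext ⟨?_, ?_, ?_⟩ <;> simp
    rw [this]
    rfl
  rw [e, map_symm_map]

/-- With g² = l in place of γ the map is a contact equivalence; the remaining factor γ/g only
rescales z. -/
theorem map_I_zero {M : GL (Fin 2) ℂ} {t s l : ℂ} (γ : ℂˣ)
    (hq : QuarticRel t s l (M 0 0) (M 0 1) (M 1 0) (M 1 1)) (hl : l ≠ 0) :
    (I 0 t).map (blockAut M γ).1 = I 0 s := by
  obtain ⟨g, hg⟩ := IsAlgClosed.exists_pow_nat_eq l (n := 2) (by norm_num)
  have hg0 : g ≠ 0 := by rintro rfl; simp at hg; exact hl hg.symm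
  obtain ⟨u, hu⟩ := isUnit_C hl
  have h1 : (blockAut M (Units.mk0 g hg0)).1 (fam t) = u * fam s := by
    rw [hu]; exact (isTri_blockAut M _).map_fam hq hg
  have e : blockAut M γ = blockAut M (Units.mk0 g hg0) * blockAut 1 ((Units.mk0 g hg0)⁻¹ * γ) := by
    rw [← blockAut_comp_zscale, mul_inv_cancel_left]
  rw [e]
  refine (Ideal.map_map ((blockAut 1 ((Units.mk0 g hg0)⁻¹ * γ)).1 : O →+* O)
    ((blockAut M (Units.mk0 g hg0)).1 : O →+* O)).symm.trans ?_
  refine (congrArg (Ideal.map _) (map_zscale _ t)).trans ?_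
  exact map_I_of_contact h1 0

/-! ### Linear functionals that vanish on the moduli ideals -/

/-- The monomial `x ^ a * y ^ b * z ^ c`. -/
noncomputable def mon (a b c : ℕ) : O := X 0 ^ a * (X 1 ^ b * X 2 ^ c)

theorem cf_mul_mon (i j k a b c : ℕ) (g : O) : cf i j k (g * mon a b c) =
    if a ≤ i ∧ b ≤ j ∧ c ≤ k then cf (i - a) (j - b) (k - c) g else 0 := by
  have e : g * mon a b c = X 0 ^ a * (X 1 ^ b * (X 2 ^ c * g)) := by rw [mon]; ring
  rw [e, cf_X0_pow_mul, cf_X1_pow_mul, cf_X2_pow_mul]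
  split_ifs <;> first | rfl | (exfalso; omega)

theorem cf_mul_C_mul_mon (i j k a b c : ℕ) (g : O) (r : ℂ) : cf i j k (g * (C r * mon a b c)) =
    r * if a ≤ i ∧ b ≤ j ∧ c ≤ k then cf (i - a) (j - b) (k - c) g else 0 := by
  rw [mul_left_comm, cf_C_mul, cf_mul_mon]

theorem cf_C_mul_mon (i j k a b c : ℕ) (r : ℂ) :
    cf i j k (C r * mon a b c) = if i = a ∧ j = b ∧ k = c then r else 0 :=
  cf_mon i j k a b c r

theorem fin3_cases : ∀ i : Fin 3, i = 0 ∨ i = 1 ∨ i = 2 := by decide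

theorem mem_of_eq {K : Ideal O} {f g : O} (h : f = g) (hg : g ∈ K) : f ∈ K := h ▸ hg

theorem eq_zero_on_span {S : Set O} (p : O →ₗ[ℂ] ℂ) (h : ∀ x ∈ S, ∀ g, p (g * x) = 0) {f : O}
    (hf : f ∈ Ideal.span S) : p f = 0 := by
  have : ∀ g, p (g * f) = 0 := by
    refine Submodule.span_induction h (fun g => by simp) ?_ ?_ hf
    · intro x y _ _ hx hy g; rw [mul_add, map_add, hx, hy, add_zero]
    · intro a x _ hx g; rw [smul_eq_mul, ← mul_assoc, hx]
  simpa using this 1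

/-- Generators of the first moduli ideal. -/
noncomputable def gens (t : ℂ) : Set O :=
  {mon 1 0 1, mon 0 1 1, mon 0 0 2, mon 3 1 0, mon 1 3 0, C 2 * mon 4 0 0 + C t * mon 2 2 0,
    C 2 * mon 0 4 0 + C t * mon 2 2 0}

-- The products y f_x and x f_y are combinations of x³y and xy³ with determinant 16 - 4t² up to
-- sign. It is nonzero for t² ≠ 4, so both monomials lie in the ideal.
open scoped Pointwise in
theorem I_one_eq {t : ℂ} (ht : t ^ 2 ≠ 4) : I 1 t = Ideal.span (gens t) := by
  have c2 : (C 2 : O) = 2 := map_ofNat C 2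
  have c4 : (C 4 : O) = 4 := map_ofNat C 4
  have half : (C (1 / 2) * 2 : O) = 1 := by rw [← c2, ← map_mul]; norm_num
  rw [I_one, jacobiIdeal_fam, maxIdeal, Ideal.span_mul_span']
  apply le_antisymm
  · rw [Ideal.span_le]
    rintro _ ⟨_, ⟨i, rfl⟩, _, hv, rfl⟩
    have m1 : mon 1 0 1 ∈ Ideal.span (gens t) := Ideal.subset_span (by simp [gens])
    have m2 : mon 0 1 1 ∈ Ideal.span (gens t) := Ideal.subset_span (by simp [gens])
    have m3 : mon 0 0 2 ∈ Ideal.span (gens t) := Ideal.subset_span (by simp [gens])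
    have m4 : mon 3 1 0 ∈ Ideal.span (gens t) := Ideal.subset_span (by simp [gens])
    have m5 : mon 1 3 0 ∈ Ideal.span (gens t) := Ideal.subset_span (by simp [gens])
    have m6 : C 2 * mon 4 0 0 + C t * mon 2 2 0 ∈ Ideal.span (gens t) :=
      Ideal.subset_span (by simp [gens])
    have m7 : C 2 * mon 0 4 0 + C t * mon 2 2 0 ∈ Ideal.span (gens t) :=
      Ideal.subset_span (by simp [gens])
    simp only [mon, pow_zero, pow_one, mul_one, one_mul] at m1 m2 m3 m4 m5 m6 m7
    simp only [Set.mem_insert_iff, Set.mem_singleton_iff] at hv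
    change X i * _ ∈ _
    rcases hv with rfl | rfl | rfl
    · rcases fin3_cases i with rfl | rfl | rfl
      · refine mem_of_eq ?_ (Ideal.mul_mem_left _ 2 m6)
        simp only [map_mul, c2, c4]; ring
      · refine mem_of_eq ?_ (add_mem (Ideal.mul_mem_left _ 4 m4)
          (Ideal.mul_mem_left _ (2 * C t) m5))
        simp only [map_mul, c2, c4]; ring
      · refine mem_of_eq ?_ (Ideal.mul_mem_left _
          (4 * X 0 ^ 2 + 2 * C t * X 1 ^ 2) m1)
        simp only [map_mul, c2, c4]; ring
    · rcases fin3_cases i with rfl | rfl | rfl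
      · refine mem_of_eq ?_ (add_mem (Ideal.mul_mem_left _ 4 m5)
          (Ideal.mul_mem_left _ (2 * C t) m4))
        simp only [map_mul, c2, c4]; ring
      · refine mem_of_eq ?_ (Ideal.mul_mem_left _ 2 m7)
        simp only [map_mul, c2, c4]; ring
      · refine mem_of_eq ?_ (Ideal.mul_mem_left _
          (4 * X 1 ^ 2 + 2 * C t * X 0 ^ 2) m2)
        simp only [map_mul, c2, c4]; ring
    · rcases fin3_cases i with rfl | rfl | rfl
      · refine mem_of_eq ?_ (Ideal.mul_mem_left _ 2 m1)
        simp only [c2]; ring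
      · refine mem_of_eq ?_ (Ideal.mul_mem_left _ 2 m2)
        simp only [c2]; ring
      · refine mem_of_eq ?_ (Ideal.mul_mem_left _ 2 m3)
        simp only [c2]; ring
  · rw [Ideal.span_le]
    generalize hF0 : (C 4 * X 0 ^ 3 + C (2 * t) * (X 0 * X 1 ^ 2) : O) = F0
    generalize hF1 : (C 4 * X 1 ^ 3 + C (2 * t) * (X 0 ^ 2 * X 1) : O) = F1
    set K := Ideal.span (Set.range (fun i : Fin 3 => (X i : O)) * ({F0, F1, C 2 * X 2} : Set O)) with hK
    have mem : ∀ (i : Fin 3) (v : O), v ∈ ({F0, F1, (C 2 * X 2 : O)} : Set O) → X i * v ∈ K :=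
      fun i v hv => Ideal.subset_span (Set.mul_mem_mul ⟨i, rfl⟩ hv)
    have n0 := fun i => mem i F0 (by simp)
    have n1 := fun i => mem i F1 (by simp)
    have n2 := fun i => mem i (C 2 * X 2) (by simp)
    have hr : (16 - 4 * t ^ 2) ≠ 0 := by
      intro h; apply ht; linear_combination (-1 / 4 : ℂ) * h
    have hinv : (C (1 / (16 - 4 * t ^ 2)) * (16 - 4 * C t ^ 2) : O) = 1 := by
      have : (16 - 4 * C t ^ 2 : O) = C (16 - 4 * t ^ 2) := by
        simp only [map_sub, map_mul, map_pow, c4, map_ofNat]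
      rw [this, ← map_mul, one_div_mul_cancel hr, map_one]
    simp only [map_mul, c2, c4] at hF0 hF1 n2
    rintro _ (rfl | rfl | rfl | rfl | rfl | rfl | rfl) <;>
      simp only [mon, pow_zero, pow_one, mul_one, one_mul, SetLike.mem_coe]
    · refine mem_of_eq ?_ (Ideal.mul_mem_left _ (C (1 / 2)) (n2 0))
      linear_combination (-(X 0 * X 2) : O) * half
    · refine mem_of_eq ?_ (Ideal.mul_mem_left _ (C (1 / 2)) (n2 1))
      linear_combination (-(X 1 * X 2) : O) * half
    · refine mem_of_eq ?_ (Ideal.mul_mem_left _ (C (1 / 2)) (n2 2))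
      linear_combination (-(X 2 * X 2) : O) * half
    · refine mem_of_eq ?_ (sub_mem
        (Ideal.mul_mem_left _ (C (1 / (16 - 4 * t ^ 2)) * 4) (n0 1))
        (Ideal.mul_mem_left _ (C (1 / (16 - 4 * t ^ 2)) * (2 * C t)) (n1 0)))
      rw [← hF0, ← hF1]
      linear_combination (-(X 0 ^ 3 * X 1) : O) * hinv
    · refine mem_of_eq ?_ (sub_mem
        (Ideal.mul_mem_left _ (C (1 / (16 - 4 * t ^ 2)) * 4) (n1 0))
        (Ideal.mul_mem_left _ (C (1 / (16 - 4 * t ^ 2)) * (2 * C t)) (n0 1)))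
      rw [← hF0, ← hF1]
      linear_combination (-(X 0 * X 1 ^ 3) : O) * hinv
    · refine mem_of_eq ?_ (Ideal.mul_mem_left _ (C (1 / 2)) (n0 0))
      rw [← hF0, c2]
      linear_combination (-(2 * X 0 ^ 4 + C t * (X 0 ^ 2 * X 1 ^ 2)) : O) * half
    · refine mem_of_eq ?_ (Ideal.mul_mem_left _ (C (1 / 2)) (n1 1))
      rw [← hF1, c2]
      linear_combination (-(2 * X 1 ^ 4 + C t * (X 0 ^ 2 * X 1 ^ 2)) : O) * half

/-- The functional on quartic forms that vanishes on the first moduli ideal. -/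
noncomputable def socle (t : ℂ) : O →ₗ[ℂ] ℂ := cf 2 2 0 - (t / 2) • (cf 4 0 0 + cf 0 4 0)

theorem socle_apply (t : ℂ) (f : O) :
    socle t f = cf 2 2 0 f - t / 2 * (cf 4 0 0 f + cf 0 4 0 f) := rfl

/-- Modulo I_1 the forms x⁴ and y⁴ become -t/2 times x²y², while x³y and xy³ vanish; the functional
reads off the resulting coefficient of x²y². -/
theorem socle_eq_zero {t : ℂ} (ht : t ^ 2 ≠ 4) {f : O} (hf : f ∈ I 1 t) : socle t f = 0 := by
  rw [I_one_eq ht] at hf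
  refine eq_zero_on_span _ ?_ hf
  rintro _ (rfl | rfl | rfl | rfl | rfl | rfl | rfl) g <;>
    simp [socle_apply, cf_mul_mon, cf_mul_C_mul_mon, mul_add]
  all_goals ring

theorem cf_eq_zero_of_mem {t : ℂ} (ht : t ^ 2 ≠ 4) {f : O} (hf : f ∈ I 1 t) {i j k : ℕ}
    (h : (k = 0 ∧ i + j ≤ 3) ∨ (k = 1 ∧ i = 0 ∧ j = 0)) : cf i j k f = 0 := by
  rw [I_one_eq ht] at hf
  refine eq_zero_on_span _ ?_ hf
  rintro _ (rfl | rfl | rfl | rfl | rfl | rfl | rfl) g <;>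
    simp only [cf_mul_mon, cf_mul_C_mul_mon, mul_add, map_add] <;>
    simp (disch := omega) only [if_neg, mul_zero, add_zero]

theorem cf_mul_fam (i j k : ℕ) (s : ℂ) (g : O) : cf i j k (g * fam s) =
    cf i j k (g * mon 4 0 0) + cf i j k (g * mon 0 4 0) + cf i j k (g * mon 0 0 2) +
      s * cf i j k (g * mon 2 2 0) := by
  have e : g * fam s = g * mon 4 0 0 + g * mon 0 4 0 + g * mon 0 0 2 + C s * (g * mon 2 2 0) := by
    simp only [fam, mon, pow_zero, mul_one, one_mul]; ring
  rw [e, map_add, map_add, map_add, cf_C_mul]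

theorem jacobiIdeal_fam_le (s : ℂ) :
    jacobiIdeal (fam s) ≤ maxIdeal ^ 3 ⊔ Ideal.span {(X 2 : O)} := by
  have p : ∀ i j k : Fin 3, (X i * (X j * X k) : O) ∈ maxIdeal ^ 3 := by
    intro i j k
    rw [pow_succ', pow_succ', pow_one]
    exact Ideal.mul_mem_mul (mem_maxIdeal_X i)
      (Ideal.mul_mem_mul (mem_maxIdeal_X j) (mem_maxIdeal_X k))
  rw [jacobiIdeal_fam, Ideal.span_le]
  rintro _ (rfl | rfl | rfl)
  · refine Ideal.mem_sup_left (mem_of_eq ?_ (add_mem (Ideal.mul_mem_left _ (C 4)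
      (p 0 0 0)) (Ideal.mul_mem_left _ (C (2 * s)) (p 0 1 1))))
    ring
  · refine Ideal.mem_sup_left (mem_of_eq ?_ (add_mem (Ideal.mul_mem_left _ (C 4)
      (p 1 1 1)) (Ideal.mul_mem_left _ (C (2 * s)) (p 0 0 1))))
    ring
  · exact Ideal.mem_sup_right (Ideal.mul_mem_left _ _ (Ideal.mem_span_singleton_self _))

/-- The partials of f_s lie in m³ or are multiples of z, so modulo f_s an element of I_n is of high
order up to z times an element of mⁿ. -/
theorem exists_cf_of_mem {n : ℕ} {s : ℂ} {f : O} (hf : f ∈ I n s) :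
    ∃ g v u : O, f = g * fam s + u + X 2 * v ∧ u ∈ maxIdeal ^ (n + 3) ∧ v ∈ maxIdeal ^ n := by
  have h : I n s ≤ Ideal.span {fam s} ⊔ (maxIdeal ^ (n + 3) ⊔ maxIdeal ^ n * Ideal.span {X 2}) := by
    refine (moduliIdeal_coe n (fam s)).le.trans (sup_le_sup le_rfl ?_)
    refine (Ideal.mul_mono_right (jacobiIdeal_fam_le s)).trans ?_
    rw [Ideal.mul_sup, ← pow_add]
  obtain ⟨a, ha, b, hb, rfl⟩ := Submodule.mem_sup.mp (h hf)
  obtain ⟨u, hu, w, hw, rfl⟩ := Submodule.mem_sup.mp hb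
  obtain ⟨g, rfl⟩ := Ideal.mem_span_singleton'.mp ha
  rw [mul_comm] at hw
  obtain ⟨v, hv, rfl⟩ := Ideal.mem_span_singleton_mul.mp hw
  exact ⟨g, v, u, by ring, hu, hv⟩

/-- The low order coefficients of the elements of `I_k(s)`, `k ≥ 2`. -/
theorem cf_of_mem_I {k : ℕ∞} (hk : 2 ≤ k) {s : ℂ} {f : O} (hf : f ∈ I k s) :
    ∃ l : ℂ, cf 4 0 0 f = l ∧ cf 3 1 0 f = 0 ∧ cf 2 2 0 f = l * s ∧ cf 1 3 0 f = 0 ∧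
      cf 0 4 0 f = l ∧ cf 0 0 2 f = l ∧
      (k ≠ 2 → cf 2 0 1 f = 0 ∧ cf 1 1 1 f = 0 ∧ cf 0 2 1 f = 0) := by
  have base : ∀ g : O, cf 4 0 0 (g * fam s) = cf 0 0 0 g ∧ cf 3 1 0 (g * fam s) = 0 ∧
      cf 2 2 0 (g * fam s) = cf 0 0 0 g * s ∧ cf 1 3 0 (g * fam s) = 0 ∧
      cf 0 4 0 (g * fam s) = cf 0 0 0 g ∧ cf 0 0 2 (g * fam s) = cf 0 0 0 g ∧
      cf 2 0 1 (g * fam s) = 0 ∧ cf 1 1 1 (g * fam s) = 0 ∧ cf 0 2 1 (g * fam s) = 0 := by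
    intro g
    simp [cf_mul_fam, cf_mul_mon, mul_comm]
  induction k using ENat.recTopCoe with
  | top =>
    rw [I, moduliIdeal_top] at hf
    obtain ⟨g, rfl⟩ := Ideal.mem_span_singleton'.mp hf
    obtain ⟨b1, b2, b3, b4, b5, b6, b7⟩ := base g
    exact ⟨_, b1, b2, b3, b4, b5, b6, fun _ => b7⟩
  | coe n =>
    have hn : 2 ≤ n := by exact_mod_cast hk
    obtain ⟨g, v, u, rfl, hu, hv⟩ := exists_cf_of_mem hf
    obtain ⟨b1, b2, b3, b4, b5, b6, b7, b8, b9⟩ := base g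
    have cu : ∀ {i j k : ℕ}, i + j + k < n + 3 → cf i j k u = 0 := fun h => cf_of_mem_pow hu h
    have cv : ∀ {i j k : ℕ}, i + j + k < n → cf i j k v = 0 := fun h => cf_of_mem_pow hv h
    refine ⟨cf 0 0 0 g, ?_, ?_, ?_, ?_, ?_, ?_, fun h2 => ?_⟩
    iterate 6
      · simp (disch := omega) [b1, b2, b3, b4, b5, b6, cf_X2_mul, cu, cv]
    -- For n = 2 the ideal z m² contains x²z, xyz, y²z, so these three coefficients are controlled
    -- only from n = 3 on.
    have hn3 : 3 ≤ n := by
      rcases Nat.lt_or_ge 2 n with h | h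
      · exact h
      · exfalso; apply h2; have : n = 2 := le_antisymm h hn
        rw [this]; rfl
    simp (disch := omega) [b7, b8, b9, cf_X2_mul, cu, cv]

/-! ### The morphisms of the groupoids -/
theorem cf_add (i j k : ℕ) (f g : O) : cf i j k (f + g) = cf i j k f + cf i j k g := map_add _ _ _

theorem IsTri.map_x3y {φ : O ≃ₐ[ℂ] O} {a b c d γ q0 q1 q2 : ℂ} (h : IsTri φ a b c d γ q0 q1 q2) :
    φ (mon 3 1 0) = C (a ^ 3 * c) * mon 4 0 0 + C (a ^ 3 * d + 3 * (a ^ 2 * b * c)) * mon 3 1 0 +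
      C (3 * (a ^ 2 * b * d) + 3 * (a * b ^ 2 * c)) * mon 2 2 0 +
      C (3 * (a * b ^ 2 * d) + b ^ 3 * c) * mon 1 3 0 + C (b ^ 3 * d) * mon 0 4 0 := by
  have c3 : (C 3 : O) = 3 := map_ofNat C 3
  simp only [mon, pow_zero, pow_one, map_mul, map_pow, map_one, map_add, h.h0, h.h1, c3]
  ring

theorem IsTri.map_xy3 {φ : O ≃ₐ[ℂ] O} {a b c d γ q0 q1 q2 : ℂ} (h : IsTri φ a b c d γ q0 q1 q2) :
    φ (mon 1 3 0) = C (a * c ^ 3) * mon 4 0 0 + C (3 * (a * c ^ 2 * d) + b * c ^ 3) * mon 3 1 0 +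
      C (3 * (a * c * d ^ 2) + 3 * (b * c ^ 2 * d)) * mon 2 2 0 +
      C (a * d ^ 3 + 3 * (b * c * d ^ 2)) * mon 1 3 0 + C (b * d ^ 3) * mon 0 4 0 := by
  have c3 : (C 3 : O) = 3 := map_ofNat C 3
  simp only [mon, pow_zero, pow_one, map_mul, map_pow, map_one, map_add, h.h0, h.h1, c3]
  ring

theorem IsTri.map_x4_y4 {φ : O ≃ₐ[ℂ] O} {a b c d γ q0 q1 q2 : ℂ}
    (h : IsTri φ a b c d γ q0 q1 q2) :
    φ (mon 4 0 0 - mon 0 4 0) = C (a ^ 4 - c ^ 4) * mon 4 0 0 +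
      C (4 * (a ^ 3 * b - c ^ 3 * d)) * mon 3 1 0 + C (6 * (a ^ 2 * b ^ 2 - c ^ 2 * d ^ 2)) * mon 2 2 0 +
      C (4 * (a * b ^ 3 - c * d ^ 3)) * mon 1 3 0 + C (b ^ 4 - d ^ 4) * mon 0 4 0 := by
  have c4 : (C 4 : O) = 4 := map_ofNat C 4
  have c6 : (C 6 : O) = 6 := map_ofNat C 6
  simp only [mon, pow_zero, map_mul, map_pow, map_one, map_sub, h.h0, h.h1, c4, c6]
  ring

theorem IsTri.map_xz {φ : O ≃ₐ[ℂ] O} {a b c d γ q0 q1 q2 : ℂ} (h : IsTri φ a b c d γ q0 q1 q2) :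
    φ (mon 1 0 1) = C (a * γ) * mon 1 0 1 + C (b * γ) * mon 0 1 1 + (C (a * q0) * mon 3 0 0 +
      C (a * q1 + b * q0) * mon 2 1 0 + C (a * q2 + b * q1) * mon 1 2 0 + C (b * q2) * mon 0 3 0) := by
  simp only [mon, pow_zero, pow_one, map_mul, map_one, map_add, h.h0, h.h2]
  ring

theorem IsTri.map_fam_eq {φ : O ≃ₐ[ℂ] O} {a b c d γ q0 q1 q2 : ℂ} (h : IsTri φ a b c d γ q0 q1 q2)
    (t : ℂ) : φ (fam t) =
      C (a ^ 4 + c ^ 4 + t * (a ^ 2 * c ^ 2) + q0 ^ 2) * mon 4 0 0 +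
      C (4 * (a ^ 3 * b + c ^ 3 * d) + 2 * t * (a ^ 2 * c * d + a * b * c ^ 2) + 2 * (q0 * q1)) *
        mon 3 1 0 +
      C (6 * (a ^ 2 * b ^ 2 + c ^ 2 * d ^ 2) + t * (a ^ 2 * d ^ 2 + 4 * a * b * c * d + b ^ 2 * c ^ 2) +
        (2 * (q0 * q2) + q1 ^ 2)) * mon 2 2 0 +
      C (4 * (a * b ^ 3 + c * d ^ 3) + 2 * t * (a * b * d ^ 2 + b ^ 2 * c * d) + 2 * (q1 * q2)) *
        mon 1 3 0 +
      C (b ^ 4 + d ^ 4 + t * (b ^ 2 * d ^ 2) + q2 ^ 2) * mon 0 4 0 + C (γ ^ 2) * mon 0 0 2 +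
      C (2 * (γ * q0)) * mon 2 0 1 + C (2 * (γ * q1)) * mon 1 1 1 + C (2 * (γ * q2)) * mon 0 2 1 := by
  have c2 : (C 2 : O) = 2 := map_ofNat C 2
  have c4 : (C 4 : O) = 4 := map_ofNat C 4
  have c6 : (C 6 : O) = 6 := map_ofNat C 6
  simp only [mon, fam, pow_zero, map_mul, map_pow, map_add, algEquiv_C, h.h0, h.h1, h.h2, c2, c4, c6]
  ring

theorem IsTri.map_x2z {φ : O ≃ₐ[ℂ] O} {a b c d γ q0 q1 q2 : ℂ} (h : IsTri φ a b c d γ q0 q1 q2)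
    (u v : ℂ) :
    φ ((C u * X 0 + C v * X 1) ^ 2 * X 2) =
      C ((u * a + v * c) ^ 2 * q0) * mon 4 0 0 +
      C ((u * a + v * c) ^ 2 * q1 + 2 * ((u * a + v * c) * (u * b + v * d) * q0)) * mon 3 1 0 +
      C ((u * a + v * c) ^ 2 * q2 + 2 * ((u * a + v * c) * (u * b + v * d) * q1) +
        (u * b + v * d) ^ 2 * q0) * mon 2 2 0 +
      C ((u * b + v * d) ^ 2 * q1 + 2 * ((u * a + v * c) * (u * b + v * d) * q2)) * mon 1 3 0 +
      C ((u * b + v * d) ^ 2 * q2) * mon 0 4 0 +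
      (C ((u * a + v * c) ^ 2 * γ) * mon 2 0 1 +
      C (2 * ((u * a + v * c) * (u * b + v * d)) * γ) * mon 1 1 1 +
      C ((u * b + v * d) ^ 2 * γ) * mon 0 2 1) := by
  have c2 : (C 2 : O) = 2 := map_ofNat C 2
  simp only [mon, pow_zero, map_mul, map_pow, map_add, algEquiv_C, h.h0, h.h1, h.h2, c2]
  ring

/-- The equations say that ax + by times q₀x² + q₁xy + q₂y² is zero, and the linear form is nonzero.
-/
theorem quadratic_eq_zero {a b c d q0 q1 q2 : ℂ} (hd : a * d - b * c ≠ 0)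
    (e0 : a * q0 = 0) (e1 : a * q1 + b * q0 = 0) (e2 : a * q2 + b * q1 = 0) (e3 : b * q2 = 0) :
    q0 = 0 ∧ q1 = 0 ∧ q2 = 0 := by
  by_cases ha : a = 0
  · subst ha
    have hb : b ≠ 0 := by rintro rfl; simp at hd
    simp_all
  · have h0 : q0 = 0 := (mul_eq_zero.mp e0).resolve_left ha
    subst h0
    have h1 : q1 = 0 := by simpa [ha] using e1
    subst h1
    simp_all

/-- The same cancellation with the square of the linear form. -/
theorem sq_mul_quadratic_eq_zero {a b c d q0 q1 q2 : ℂ} (hd : a * d - b * c ≠ 0)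
    (e0 : a ^ 2 * q0 = 0) (e1 : a ^ 2 * q1 + 2 * (a * b * q0) = 0)
    (e2 : a ^ 2 * q2 + 2 * (a * b * q1) + b ^ 2 * q0 = 0) (e3 : b ^ 2 * q1 + 2 * (a * b * q2) = 0)
    (e4 : b ^ 2 * q2 = 0) : q0 = 0 ∧ q1 = 0 ∧ q2 = 0 := by
  by_cases ha : a = 0
  · subst ha
    have hb : b ≠ 0 := by rintro rfl; simp at hd
    simp_all
  · have h0 : q0 = 0 := (mul_eq_zero.mp e0).resolve_left (pow_ne_zero 2 ha)
    subst h0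
    have h1 : q1 = 0 := by simpa [ha] using e1
    subst h1
    simp_all

/-- The scaling `(x, y, z) ↦ (e x, e y, e² z)`. -/
noncomputable def scal (e : ℂˣ) : WAut := blockAut (Matrix.GeneralLinearGroup.scalar (Fin 2) e) (e ^ 2)

theorem isTri_scal (e : ℂˣ) : IsTri (scal e).1 e 0 0 e (e ^ 2) 0 0 0 := by
  have h := isTri_blockAut (Matrix.GeneralLinearGroup.scalar (Fin 2) e) (e ^ 2)
  have he : ∀ i j, (Matrix.GeneralLinearGroup.scalar (Fin 2) e).1 i j = if i = j then (e : ℂ) else 0 := by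
    intro i j
    simp [Matrix.GeneralLinearGroup.scalar, Matrix.diagonal_apply]
  simp only [he, if_true, Fin.isValue, Units.val_pow_eq_pow_val, zero_ne_one, one_ne_zero, if_false] at h
  exact h

theorem scal_mem (e : ℂˣ) : scal e ∈ Scalings := by
  refine ⟨e, fun i => ?_⟩
  have h := isTri_scal e
  rcases fin3_cases i with rfl | rfl | rfl
  · rw [h.h0]; simp [wt]
  · rw [h.h1]; simp [wt]
  · rw [h.h2]; simp [wt]

theorem isTri_Bt (b : BIdx) (γ : ℂˣ) :
    IsTri (blockAut b.gl γ).1 (b.mat 0 0) (b.mat 0 1) (b.mat 1 0) (b.mat 1 1) γ 0 0 0 :=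
  isTri_blockAut b.gl γ

/-- The common factor e of the 2×2 block is absorbed by a scaling, which multiplies z by e²; the
factor of z becomes γ/e². -/
theorem IsTri.mk_eq_Bt {φ : WAut} {b : BIdx} {e γ : ℂ} (he : e ≠ 0) (hγ : γ ≠ 0)
    (h : IsTri φ.1 (e * b.mat 0 0) (e * b.mat 0 1) (e * b.mat 1 0) (e * b.mat 1 1) γ 0 0 0) :
    (QuotientGroup.mk φ : PGLw) = Bt b (Units.mk0 γ hγ / Units.mk0 e he ^ 2) := by
  have key : φ = blockAut b.gl (Units.mk0 γ hγ / Units.mk0 e he ^ 2) * scal (Units.mk0 e he) := by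
    refine h.ext ⟨?_, ?_, ?_⟩
    all_goals
      have h1 := isTri_Bt b (Units.mk0 γ hγ / Units.mk0 e he ^ 2)
      have h2 := isTri_scal (Units.mk0 e he)
      change (blockAut _ _).1 ((scal _).1 _) = _
    · rw [h2.h0]
      simp only [map_add, map_mul, algEquiv_C, h1.h0, h1.h1, Units.val_mk0, map_zero]
      ring
    · rw [h2.h1]
      simp only [map_add, map_mul, algEquiv_C, h1.h0, h1.h1, Units.val_mk0, map_zero]
      ring
    · rw [h2.h2]
      simp only [map_mul, algEquiv_C, h1.h2, map_zero, zero_mul, add_zero, ← mul_assoc]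
      rw [← map_mul]
      congr 2
      simp
      field_simp
  rw [key, Bt]
  exact QuotientGroup.mk_mul_of_mem _ (scal_mem _)

theorem homs_eq (k : ℕ∞) (t s : Param) : homs k t s = homSet k t.1 s.1 :=
  Subtype.range_val

/-- Up to the order visible in `cf_of_mem_I`, the image of f_t is a multiple of f_s. This kills the
quadratic part of the map and leaves a problem on binary quartics; conversely each solution is a
contact equivalence and so works for every k. -/
theorem mem_homSet_of_two_le {k : ℕ∞} (hk : 2 ≤ k) {t s : ℂ} (ht : t ^ 2 ≠ 4) {g : PGLw} :
    g ∈ homSet k t s ↔ ∃ (b : BIdx) (γ : ℂˣ), g = Bt b γ ∧ s = b.trans t ∧ (γ : ℂ) ^ 2 = b.lam t := by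
  constructor
  · rintro ⟨φ, rfl, hφ⟩
    obtain ⟨a, b, c, d, γ, q0, q1, q2, h⟩ := exists_isTri φ
    obtain ⟨hd, hγ⟩ := h.det_ne_zero
    have hf : φ.1 (fam t) ∈ I k s := by
      rw [← hφ]
      refine Ideal.mem_map_of_mem _ ?_
      exact Ideal.mem_sup_left (Ideal.mem_span_singleton_self _)
    have hq : q0 = 0 ∧ q1 = 0 ∧ q2 = 0 := by
      -- For k = 2 the coefficients of x²z, xyz, y²z in the image of f_t give no information; the
      -- element x²z of I_2(t) is used instead.
      by_cases h2 : k = 2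
      · subst h2
        have hx : φ.1 (X 0 ^ 2 * X 2) ∈ I 2 s := by
          rw [← hφ]
          refine Ideal.mem_map_of_mem _ ?_
          have e : I 2 t = _ := moduliIdeal_coe 2 (fam t)
          rw [e]
          refine Ideal.mem_sup_right (Ideal.mul_mem_mul (Ideal.pow_mem_pow (mem_maxIdeal_X 0) 2) ?_)
          rw [jacobiIdeal_fam]
          refine mem_of_eq ?_ (Ideal.mul_mem_left _ (C (1 / 2))
            (Ideal.subset_span (Or.inr (Or.inr rfl))))
          rw [← mul_assoc, ← map_mul]; norm_num
        have e := h.map_x2z 1 0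
        simp only [map_one, map_zero, one_mul, zero_mul, add_zero] at e
        rw [e] at hx
        obtain ⟨l, l1, l2, l3, l4, l5, l6, -⟩ := cf_of_mem_I le_rfl hx
        simp only [cf_add, cf_C_mul_mon] at l1 l2 l3 l4 l5 l6
        norm_num at l1 l2 l3 l4 l5 l6
        -- The image of x²z has no term z², so l = 0 and its whole quartic part (ax + by)²(q₀x² +
        -- q₁xy + q₂y²) vanishes.
        subst l6
        exact sq_mul_quadratic_eq_zero hd (by simpa using l1) (by simpa using l2) (by simpa using l3)
          (by simpa using l4) (by simpa using l5)
      · rw [h.map_fam_eq] at hf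
        obtain ⟨l, -, -, -, -, -, -, l7⟩ := cf_of_mem_I hk hf
        obtain ⟨e0, e1, e2⟩ := l7 h2
        simp only [cf_add, cf_C_mul_mon] at e0 e1 e2
        norm_num at e0 e1 e2
        exact ⟨e0.resolve_left hγ, e1.resolve_left hγ, e2.resolve_left hγ⟩
    obtain ⟨rfl, rfl, rfl⟩ := hq
    rw [h.map_fam_eq] at hf
    obtain ⟨l, l1, l2, l3, l4, l5, l6, -⟩ := cf_of_mem_I hk hf
    simp only [cf_add, cf_C_mul_mon] at l1 l2 l3 l4 l5 l6
    norm_num at l1 l2 l3 l4 l5 l6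
    obtain ⟨β, e, he, ra, rb, rc, rd⟩ := (octShape_of_rel ht hd (l1.trans l5.symm) l2 l4).exists_bIdx hd
    subst ra rb rc rd
    have hr := β.quarticRel ht e
    have hl : l = e ^ 4 * β.lam t := l1.symm.trans hr.h1
    have hl0 : l ≠ 0 := by rw [← l6]; exact pow_ne_zero 2 hγ
    refine ⟨β, _, h.mk_eq_Bt he hγ, ?_, ?_⟩
    · have := l3.symm.trans hr.h5
      rw [← hl] at this
      exact mul_left_cancel₀ hl0 this
    · simp only [Units.val_div_eq_div_val, Units.val_mk0, Units.val_pow_eq_pow_val]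
      rw [div_pow, l6, hl]
      field_simp
  · rintro ⟨b, γ, rfl, rfl, hγ⟩
    refine ⟨blockAut b.gl γ, rfl, ?_⟩
    have hr := b.quarticRel ht 1
    simp only [one_mul, one_pow] at hr
    obtain ⟨u, hu⟩ := isUnit_C (b.lam_ne_zero ht)
    exact map_I_of_contact (u := u) (by rw [hu]; exact (isTri_Bt b γ).map_fam hr hγ) k

theorem Bt_mem_homSet_zero (b : BIdx) (γ : ℂˣ) {t : ℂ} (ht : t ^ 2 ≠ 4) :
    (I 0 t).map (blockAut b.gl γ).1 = I 0 (b.trans t) := by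
  have hr := b.quarticRel ht 1
  simp only [one_mul, one_pow] at hr
  exact map_I_zero (M := b.gl) γ hr (b.lam_ne_zero ht)

/-- The functional belonging to s takes the value t - s on the element 2x⁴ + t x²y² of I_1(t). -/
theorem I_one_injective {t s : ℂ} (hs : s ^ 2 ≠ 4) (ht : t ^ 2 ≠ 4) (h : I 1 t = I 1 s) : t = s := by
  have m : C 2 * mon 4 0 0 + C t * mon 2 2 0 ∈ I 1 s := by
    rw [← h, I_one_eq ht]
    exact Ideal.subset_span (by simp [gens])
  have := socle_eq_zero hs m
  simp only [socle_apply, cf_add, cf_C_mul_mon] at this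
  norm_num at this
  linear_combination this

theorem BIdx.trans_sq_ne (b : BIdx) {t : ℂ} (ht : t ^ 2 ≠ 4) : b.trans t ^ 2 ≠ 4 := by
  cases b with
  | diag α =>
    intro h; apply ht; simp only [BIdx.trans] at h; linear_combination h - t ^ 2 * α.pow_four
  | anti α =>
    intro h; apply ht; simp only [BIdx.trans] at h; linear_combination h - t ^ 2 * α.pow_four
  | full α β =>
    intro h
    have hl := lam_full_ne_zero α ht
    simp only [BIdx.trans] at h
    field_simp at h
    have h2 : α.1 ^ 2 * t = 2 := by
      linear_combination (-1 / 64 : ℂ) * h + (1 / 64 : ℂ) * (12 - 2 * α.1 ^ 2 * t) ^ 2 * β.pow_four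
    apply ht
    linear_combination (α.1 ^ 2 * t + 2) * h2 - t ^ 2 * α.pow_four

/-- The matrix is restricted by the images of x³y, xy³ and x⁴ - y⁴, which must be killed by the
functional of s; the parameter is then recovered from the ideal. -/
theorem mem_homSet_of_le_one {k : ℕ∞} (hk : k = 0 ∨ k = 1) {t s : ℂ} (ht : t ^ 2 ≠ 4)
    (hs : s ^ 2 ≠ 4) (hs0 : s ≠ 0) (hs6 : s ^ 2 ≠ 36) {g : PGLw} :
    g ∈ homSet k t s ↔ ∃ (b : BIdx) (γ : ℂˣ), g = Bt b γ ∧ s = b.trans t := by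
  constructor
  · rintro ⟨φ, rfl, hφ⟩
    have hφ1 : (I 1 t).map φ.1 = I 1 s := by
      rcases hk with rfl | rfl
      · exact map_I_one_of_zero hφ
      · exact hφ
    have mem : ∀ f ∈ gens t, φ.1 f ∈ I 1 s := by
      intro f hf
      rw [← hφ1]
      refine Ideal.mem_map_of_mem _ ?_
      rw [I_one_eq ht]
      exact Ideal.subset_span hf
    obtain ⟨a, b, c, d, γ, q0, q1, q2, h⟩ := exists_isTri φ
    obtain ⟨hd, hγ⟩ := h.det_ne_zero
    -- The cubic part of the image of xz is the linear form ax + by times the quadratic form, and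
    -- I_1(s) has no cubic terms in x, y.
    have hq : q0 = 0 ∧ q1 = 0 ∧ q2 = 0 := by
      have m := mem (mon 1 0 1) (by simp [gens])
      rw [h.map_xz] at m
      have e0 := cf_eq_zero_of_mem hs m (i := 3) (j := 0) (k := 0) (by omega)
      have e1 := cf_eq_zero_of_mem hs m (i := 2) (j := 1) (k := 0) (by omega)
      have e2 := cf_eq_zero_of_mem hs m (i := 1) (j := 2) (k := 0) (by omega)
      have e3 := cf_eq_zero_of_mem hs m (i := 0) (j := 3) (k := 0) (by omega)
      simp only [cf_add, cf_C_mul_mon] at e0 e1 e2 e3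
      norm_num at e0 e1 e2 e3
      exact quadratic_eq_zero hd (by simpa using e0) e1 e2 (by simpa using e3)
    obtain ⟨rfl, rfl, rfl⟩ := hq
    have e3 := socle_eq_zero hs (mem (mon 3 1 0) (by simp [gens]))
    have e4 := socle_eq_zero hs (mem (mon 1 3 0) (by simp [gens]))
    have e12 : socle s (φ.1 (mon 4 0 0 - mon 0 4 0)) = 0 := by
      apply socle_eq_zero hs
      have m6 := mem (C 2 * mon 4 0 0 + C t * mon 2 2 0) (by simp [gens])
      have m7 := mem (C 2 * mon 0 4 0 + C t * mon 2 2 0) (by simp [gens])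
      refine mem_of_eq ?_ (Ideal.mul_mem_left _ (C (1 / 2)) (sub_mem m6 m7))
      rw [← map_sub, ← algEquiv_C φ.1, ← map_mul]
      congr 1
      have : (C (1 / 2) * C 2 : O) = 1 := by rw [← map_mul]; norm_num
      linear_combination (mon 0 4 0 - mon 4 0 0) * this
    rw [h.map_x3y] at e3
    rw [h.map_xy3] at e4
    rw [h.map_x4_y4] at e12
    simp only [socle_apply, cf_add, cf_C_mul_mon] at e3 e4 e12
    norm_num at e3 e4 e12
    -- Under the apolar pairing the functional of s corresponds to x⁴ + y⁴ - (12/s)x²y², up to a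
    -- factor. The three equations say that the transposed matrix carries this quartic into the
    -- family, up to a factor.
    have hu : (-12 / s) ^ 2 ≠ 4 := by
      intro hh
      apply hs6
      field_simp at hh
      linear_combination (-1 / 4 : ℂ) * hh
    have shape : OctShape a c b d := by
      refine octShape_of_rel hu (by intro hh; apply hd; linear_combination hh) ?_ ?_ ?_
      · field_simp
        linear_combination (-2 : ℂ) * e12
      · field_simp
        linear_combination (-8 : ℂ) * e3
      · field_simp
        linear_combination (-8 : ℂ) * e4
    have shape' : OctShape a b c d := by
      rcases shape with ⟨h1, h2, h3⟩ | ⟨h1, h2, h3⟩ | ⟨h1, h2, h3⟩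
      · exact Or.inl ⟨h2, h1, h3⟩
      · exact Or.inr (Or.inl ⟨h1, h2, h3.symm⟩)
      · exact Or.inr (Or.inr ⟨by linear_combination h1, h3, h2⟩)
    obtain ⟨β, e, he, ra, rb, rc, rd⟩ := shape'.exists_bIdx hd
    subst ra rb rc rd
    refine ⟨β, _, h.mk_eq_Bt he hγ, ?_⟩
    have hr := β.quarticRel ht e
    set M : GL (Fin 2) ℂ := Matrix.GeneralLinearGroup.mkOfDetNeZero
      !![e * β.mat 0 0, e * β.mat 0 1; e * β.mat 1 0, e * β.mat 1 1]
      (by rw [Matrix.det_fin_two_of]; exact hd) with hM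
    have hφM : φ = blockAut M (Units.mk0 γ hγ) := h.ext (isTri_blockAut M (Units.mk0 γ hγ))
    -- Being a multiple of B, the same map carries I_1(t) to the ideal of the transformed parameter,
    -- which therefore equals I_1(s).
    have hs' := map_I_one_of_zero (map_I_zero (M := M) (Units.mk0 γ hγ) hr
      (mul_ne_zero (pow_ne_zero 4 he) (β.lam_ne_zero ht)))
    rw [← hφM, hφ1] at hs'
    exact I_one_injective (β.trans_sq_ne ht) hs hs'
  · rintro ⟨b, γ, rfl, rfl⟩
    refine ⟨blockAut b.gl γ, rfl, ?_⟩
    rcases hk with rfl | rfl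
    · exact Bt_mem_homSet_zero b γ ht
    · exact map_I_one_of_zero (Bt_mem_homSet_zero b γ ht)

/-! ### The octahedral group -/

/-- Exponents of the entries of the matrices `B`: the summands stand for `B_{α,0}`, `B_{0,β}` and
`B_{α,β}`, where `α = iᵃ` and `β = iᵇ`. -/
abbrev Oct : Type := ZMod 4 ⊕ ZMod 4 ⊕ (ZMod 4 × ZMod 4)

/-- The product of the matrices `B` up to scalars, in exponents. -/
def Oct.mul : Oct → Oct → Oct
  | .inl a, .inl c => .inl (a + c)
  | .inl a, .inr (.inl d) => .inr (.inl (d - a))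
  | .inl a, .inr (.inr (c, d)) => .inr (.inr (a + c, d))
  | .inr (.inl b), .inl c => .inr (.inl (b + c))
  | .inr (.inl b), .inr (.inl d) => .inl (d - b)
  | .inr (.inl b), .inr (.inr (c, d)) => .inr (.inr (-(b + c), d + 2))
  | .inr (.inr (a, b)), .inl c => .inr (.inr (a, b + c))
  | .inr (.inr (a, b)), .inr (.inl d) => .inr (.inr (a + 2, d - b))
  | .inr (.inr (a, b)), .inr (.inr (c, d)) =>
    if b + c = 0 then .inl (a + d) else if b + c = 2 then .inr (.inl (d - a)) else
      .inr (.inr (a - (b + c), d - (b + c)))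

/-- The permutation of the four diagonals of the cube. -/
def Oct.permFun : Oct → ZMod 4 → ZMod 4
  | .inl a, x => x + a
  | .inr (.inl b), x => 1 - (x + b)
  | .inr (.inr (a, b)), x => Equiv.swap 1 2 (x + b) + a

/-- The permutation of the three axes of the cube. -/
def Oct.axisFun : Oct → Fin 3 → Fin 3
  | .inl a, x => if a = 0 ∨ a = 2 then x else Equiv.swap 0 1 x
  | .inr (.inl a), x => if a = 0 ∨ a = 2 then x else Equiv.swap 0 1 x
  | .inr (.inr (a, b)), x =>
    (fun y => if a = 0 ∨ a = 2 then y else Equiv.swap 0 1 y)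
      (Equiv.swap 1 2 ((fun y => if b = 0 ∨ b = 2 then y else Equiv.swap 0 1 y) x))

/-- A finite check. With injectivity and a count of 24 elements it identifies `Oct` with a symmetric
group, so the group laws of `Oct.mul` need no separate proof. -/
theorem Oct.permFun_mul : ∀ (k l : Oct) (x : ZMod 4),
    (k.mul l).permFun x = k.permFun (l.permFun x) := by decide +kernel

theorem Oct.axisFun_mul : ∀ (k l : Oct) (x : Fin 3),
    (k.mul l).axisFun x = k.axisFun (l.axisFun x) := by decide +kernel

theorem Oct.permFun_injective : ∀ k l : Oct, (∀ x, k.permFun x = l.permFun x) → k = l := by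
  decide +kernel

theorem Oct.exists_inv : ∀ k : Oct, ∃ l : Oct, k.mul l = .inl 0 ∧ l.mul k = .inl 0 := by
  decide +kernel

theorem Oct.permFun_one (x : ZMod 4) : Oct.permFun (.inl 0) x = x := add_zero x

theorem Oct.axisFun_one (x : Fin 3) : Oct.axisFun (.inl 0) x = x := by simp [Oct.axisFun]

theorem Oct.permFun_bijective (k : Oct) : Function.Bijective k.permFun := by
  obtain ⟨l, h1, h2⟩ := k.exists_inv
  refine Function.bijective_iff_has_inverse.mpr ⟨l.permFun, fun x => ?_, fun x => ?_⟩
  · rw [← Oct.permFun_mul, h2, Oct.permFun_one]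
  · rw [← Oct.permFun_mul, h1, Oct.permFun_one]

/-- The permutation of the diagonals as an element of the symmetric group. -/
noncomputable def Oct.perm (k : Oct) : Equiv.Perm (ZMod 4) := Equiv.ofBijective _ k.permFun_bijective

theorem Oct.perm_mul (k l : Oct) : (k.mul l).perm = k.perm * l.perm :=
  Equiv.ext fun x => Oct.permFun_mul k l x

theorem Oct.perm_bijective : Function.Bijective Oct.perm := by
  have hi : Function.Injective Oct.perm := fun k l h =>
    Oct.permFun_injective k l fun x => DFunLike.congr_fun h x
  rw [Fintype.bijective_iff_injective_and_card]
  refine ⟨hi, ?_⟩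
  rw [Fintype.card_perm]
  rfl

/-- The exponents of the matrices `B` correspond to the permutations of the four diagonals. -/
noncomputable def octEquiv : Oct ≃ Equiv.Perm (ZMod 4) := Equiv.ofBijective _ Oct.perm_bijective

theorem octEquiv_symm_mul (σ τ : Equiv.Perm (ZMod 4)) :
    octEquiv.symm (σ * τ) = (octEquiv.symm σ).mul (octEquiv.symm τ) := by
  rw [Equiv.symm_apply_eq]
  refine Eq.trans ?_ (Oct.perm_mul _ _).symm
  exact congrArg₂ _ (octEquiv.apply_symm_apply σ).symm (octEquiv.apply_symm_apply τ).symm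

theorem octEquiv_symm_one : octEquiv.symm 1 = .inl 0 := by
  rw [Equiv.symm_apply_eq]
  exact Equiv.ext fun x => (Oct.permFun_one x).symm

/-! ### The matrices -/

/-- The power of `i` with the given exponent. -/
noncomputable def muExp (a : ZMod 4) : Mu4 :=
  ⟨Complex.I ^ a.val, mu4_of_pow (by rw [← pow_mul, mul_comm, pow_mul, Complex.I_pow_four, one_pow])⟩

theorem I_pow_val (n : ℕ) : Complex.I ^ n = (muExp (n : ZMod 4)).1 := by
  change _ = Complex.I ^ (n : ZMod 4).val
  rw [ZMod.val_natCast, ← Complex.I_pow_eq_pow_mod]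

theorem muExp_add (a b : ZMod 4) : (muExp (a + b)).1 = (muExp a).1 * (muExp b).1 := by
  have h : a + b = ((a.val + b.val : ℕ) : ZMod 4) := by simp
  rw [h, ← I_pow_val, pow_add]
  rfl

theorem muExp_zero : (muExp 0).1 = 1 := by simp [muExp]

theorem muExp_one : (muExp 1).1 = Complex.I := by
  have : (1 : ZMod 4).val = 1 := rfl
  simp [muExp, this]

theorem muExp_two : (muExp 2).1 = -1 := by
  have : (2 : ZMod 4).val = 2 := rfl
  simp [muExp, this]

theorem muExp_three : (muExp 3).1 = -Complex.I := by
  have : (3 : ZMod 4).val = 3 := rfl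
  simp [muExp, this]

theorem muExp_sub (a b : ZMod 4) : (muExp (a - b)).1 = (muExp a).1 / (muExp b).1 := by
  rw [eq_div_iff (muExp b).ne_zero, ← muExp_add, sub_add_cancel]

theorem muExp_neg (a : ZMod 4) : (muExp (-a)).1 = ((muExp a).1)⁻¹ := by
  have h := muExp_sub 0 a
  rwa [zero_sub, muExp_zero, one_div] at h

theorem muExp_bijective : Function.Bijective muExp := by
  constructor
  · intro a b h
    have h' : (muExp a).1 = (muExp b).1 := congrArg _ h
    have hI1 : (Complex.I : ℂ) ≠ 1 := fun h => by simpa using congrArg Complex.im h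
    have hI2 : (Complex.I : ℂ) ≠ -1 := fun h => by simpa using congrArg Complex.im h
    have h1 : (muExp (a - b)).1 = 1 := by rw [muExp_sub, h', div_self (muExp b).ne_zero]
    have key : ∀ c : ZMod 4, (muExp c).1 = 1 → c = 0 := by
      intro c hc
      have : c = 0 ∨ c = 1 ∨ c = 2 ∨ c = 3 := by clear hc; revert c; decide
      rcases this with rfl | rfl | rfl | rfl
      · rfl
      · rw [muExp_one] at hc; exact absurd hc hI1
      · rw [muExp_two] at hc; norm_num at hc
      · rw [muExp_three, neg_eq_iff_eq_neg] at hc; exact absurd hc hI2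
    exact sub_eq_zero.mp (key _ h1)
  · rintro ⟨α, rfl | rfl | rfl | rfl⟩
    · exact ⟨0, Subtype.ext muExp_zero⟩
    · exact ⟨2, Subtype.ext muExp_two⟩
    · exact ⟨1, Subtype.ext muExp_one⟩
    · exact ⟨3, Subtype.ext muExp_three⟩

/-- The index of the matrix with the given exponents. -/
noncomputable def Oct.idx : Oct → BIdx
  | .inl a => .diag (muExp a)
  | .inr (.inl b) => .anti (muExp b)
  | .inr (.inr (a, b)) => .full (muExp a) (muExp b)

theorem Oct.idx_bijective : Function.Bijective Oct.idx := by
  have hi := muExp_bijective.1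
  constructor
  · rintro (a | b | ⟨a, b⟩) (c | d | ⟨c, d⟩) h <;> simp [Oct.idx, hi.eq_iff] at h ⊢ <;> exact h
  · rintro (α | β | ⟨α, β⟩)
    · obtain ⟨a, rfl⟩ := muExp_bijective.2 α; exact ⟨.inl a, rfl⟩
    · obtain ⟨a, rfl⟩ := muExp_bijective.2 β; exact ⟨.inr (.inl a), rfl⟩
    · obtain ⟨a, rfl⟩ := muExp_bijective.2 α
      obtain ⟨b, rfl⟩ := muExp_bijective.2 β
      exact ⟨.inr (.inr (a, b)), rfl⟩

/-- The product of two matrices `B` is a multiple of a matrix `B`. -/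
theorem mat_mul (k l : Oct) : ∃ e : ℂ, e ≠ 0 ∧ k.idx.mat * l.idx.mat = e • (k.mul l).idx.mat := by
  have ne := fun a => (muExp a).ne_zero
  rcases k with a | b | ⟨a, b⟩ <;> rcases l with c | d | ⟨c, d⟩
  · exact ⟨1, one_ne_zero, by simp [Oct.mul, Oct.idx, BIdx.mat, muExp_add]⟩
  · refine ⟨(muExp a).1, ne a, ?_⟩
    simp [Oct.mul, Oct.idx, BIdx.mat, muExp_sub]
    have := ne a
    field_simp
  · refine ⟨1, one_ne_zero, ?_⟩
    simp [Oct.mul, Oct.idx, BIdx.mat, muExp_add]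
    ring
  · refine ⟨1, one_ne_zero, ?_⟩
    simp [Oct.mul, Oct.idx, BIdx.mat, muExp_add]
  · refine ⟨(muExp b).1, ne b, ?_⟩
    simp [Oct.mul, Oct.idx, BIdx.mat, muExp_sub]
    have := ne b
    field_simp
  · refine ⟨(muExp b).1 * (muExp c).1, mul_ne_zero (ne b) (ne c), ?_⟩
    simp [Oct.mul, Oct.idx, BIdx.mat, muExp_neg, muExp_add, muExp_two]
    have := ne b
    have := ne c
    field_simp
    simp
  · refine ⟨1, one_ne_zero, ?_⟩
    simp [Oct.mul, Oct.idx, BIdx.mat, muExp_add]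
    ring
  · refine ⟨(muExp b).1, ne b, ?_⟩
    simp [Oct.mul, Oct.idx, BIdx.mat, muExp_sub, muExp_add, muExp_two]
    have := ne b
    field_simp
    simp
  · have hu : (muExp (b + c)).1 = (muExp b).1 * (muExp c).1 := muExp_add b c
    -- With u = i^(b+c) the rows of the product are (1 + u, δ(1 - u)) and (α(1 - u), αδ(1 + u)),
    -- where α = i^a and δ = i^d. It is diagonal for u = 1 and antidiagonal for u = -1; for u = ±i
    -- one has (1 - u)/(1 + u) = u⁻¹.
    have cases4 : ∀ u : ZMod 4, u = 0 ∨ u = 2 ∨ u = 1 ∨ u = 3 := by decide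
    rcases cases4 (b + c) with h | h | h | h
    · rw [h, muExp_zero] at hu
      refine ⟨2, two_ne_zero, ?_⟩
      simp only [Oct.mul, h, if_true]
      ext i j
      fin_cases i <;> fin_cases j <;> simp [Oct.idx, BIdx.mat, Matrix.mul_apply, muExp_add]
      · linear_combination -hu
      · linear_combination (muExp d).1 * hu
      · linear_combination (muExp a).1 * hu
      · linear_combination -(muExp a).1 * (muExp d).1 * hu
    · rw [h, muExp_two] at hu
      refine ⟨2 * (muExp a).1, mul_ne_zero two_ne_zero (ne a), ?_⟩
      have h20 : (2 : ZMod 4) ≠ 0 := by decide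
      simp only [Oct.mul, h, if_true, h20, if_false]
      have := ne a
      ext i j
      fin_cases i <;> fin_cases j <;> simp [Oct.idx, BIdx.mat, Matrix.mul_apply, muExp_sub]
      · linear_combination -hu
      · field_simp
        linear_combination (muExp d).1 * hu
      · linear_combination (muExp a).1 * hu
      · linear_combination -(muExp a).1 * (muExp d).1 * hu
    all_goals
      obtain ⟨hU, hU1, h0, h2⟩ : (muExp (b + c)).1 ^ 2 = -1 ∧ 1 + (muExp (b + c)).1 ≠ 0 ∧ b + c ≠ 0 ∧
          b + c ≠ 2 := by
        rw [h]
        first | rw [muExp_one] | rw [muExp_three]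
        refine ⟨by simp, fun h => by simpa using congrArg Complex.im h, by decide, by decide⟩
      clear h
      have hinv : ((muExp (b + c)).1)⁻¹ = -(muExp (b + c)).1 := by
        refine inv_eq_of_mul_eq_one_right ?_
        linear_combination -hU
      refine ⟨_, hU1, ?_⟩
      simp only [Oct.mul, h0, h2, if_false]
      ext i j
      fin_cases i <;> fin_cases j <;>
        simp only [Oct.idx, BIdx.mat, Matrix.mul_apply, muExp_sub, div_eq_mul_inv, hinv, Fin.sum_univ_two] <;>
        simp
      · linear_combination -hu
      · linear_combination (muExp d).1 * hu + (muExp d).1 * hU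
      · linear_combination (muExp a).1 * hu + (muExp a).1 * hU
      · linear_combination -(muExp a).1 * (muExp d).1 * hu + (muExp a).1 * (muExp d).1 * (1 + (muExp (b + c)).1) * hU

/-! ### The group `G'` -/

/-- The matrix index attached to a permutation of the diagonals. -/
noncomputable def permIdx (σ : Equiv.Perm (ZMod 4)) : BIdx := (octEquiv.symm σ).idx

theorem permIdx_bijective : Function.Bijective permIdx :=
  Oct.idx_bijective.comp octEquiv.symm.bijective

theorem permIdx_octEquiv (k : Oct) : permIdx (octEquiv k) = k.idx := by
  rw [permIdx, Equiv.symm_apply_apply]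

theorem permIdx_mat_mul (σ τ : Equiv.Perm (ZMod 4)) : ∃ e : ℂ, e ≠ 0 ∧
    (permIdx σ).mat * (permIdx τ).mat = e • (permIdx (σ * τ)).mat := by
  rw [permIdx, permIdx, permIdx, octEquiv_symm_mul]
  exact mat_mul _ _

theorem permIdx_one : permIdx 1 = .diag (muExp 0) := by
  rw [permIdx, octEquiv_symm_one]
  rfl

theorem permIdx_one_mat : (permIdx 1).mat = 1 := by
  rw [permIdx_one, BIdx.mat, muExp_zero, Matrix.one_fin_two]

theorem mat_mul_scalar (M : Matrix (Fin 2) (Fin 2) ℂ) (e : ℂ) :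
    M * Matrix.scalar (Fin 2) e = e • M := by
  ext i j
  simp [Matrix.scalar_apply, Matrix.mul_diagonal, mul_comm]

theorem Bcl_eq_of_smul {b : BIdx} {M : GL (Fin 2) ℂ} {e : ℂ} (he : e ≠ 0) (h : M.1 = e • b.mat) :
    Matrix.ProjGenLinGroup.mk M = Bcl b := by
  symm
  rw [Bcl, Matrix.ProjGenLinGroup.mk_eq_mk_iff]
  refine ⟨Units.mk0 e he, Units.ext ?_⟩
  rw [h]
  change b.mat * Matrix.scalar (Fin 2) e = _
  rw [mat_mul_scalar]

theorem exists_smul_of_Bcl_eq {b c : BIdx} (h : Bcl b = Bcl c) : ∃ e : ℂ, e • b.mat = c.mat := by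
  rw [Bcl, Bcl, Matrix.ProjGenLinGroup.mk_eq_mk_iff] at h
  obtain ⟨u, hu⟩ := h
  refine ⟨u, ?_⟩
  have h' : b.mat * Matrix.scalar (Fin 2) (u : ℂ) = c.mat := congrArg Units.val hu
  rw [← h', mat_mul_scalar]

/-- In every matrix B the first nonzero entry of the first column is 1, so proportional ones are
equal. -/
theorem BIdx.eq_of_smul {b c : BIdx} {e : ℂ} (h : e • b.mat = c.mat) : e = 1 ∧ b = c := by
  have h00 := congrFun (congrFun h 0) 0
  have h01 := congrFun (congrFun h 0) 1
  have h10 := congrFun (congrFun h 1) 0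
  have h11 := congrFun (congrFun h 1) 1
  have ne := Mu4.ne_zero
  cases b with
  | diag α =>
    cases c with
    | diag β =>
      simp [BIdx.mat] at h00 h11
      subst h00
      exact ⟨rfl, by rw [Subtype.ext ((one_mul _).symm.trans h11)]⟩
    | anti β => simp [BIdx.mat] at h00 h10
    | full β γ => simp [BIdx.mat] at h10; exact absurd h10.symm (ne β)
  | anti α =>
    cases c with
    | diag β => simp [BIdx.mat] at h00
    | anti β =>
      simp [BIdx.mat] at h01 h10
      subst h10
      exact ⟨rfl, by rw [Subtype.ext ((one_mul _).symm.trans h01)]⟩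
    | full β γ => simp [BIdx.mat] at h00
  | full α δ =>
    cases c with
    | diag β =>
      simp [BIdx.mat] at h00 h01
      subst h00
      simp at h01
      exact absurd h01 (ne δ)
    | anti β =>
      simp [BIdx.mat] at h00 h10
      subst h00
      simp at h10
    | full β γ =>
      simp [BIdx.mat] at h00 h01 h10
      subst h00
      refine ⟨rfl, ?_⟩
      rw [Subtype.ext ((one_mul _).symm.trans h01), Subtype.ext ((one_mul _).symm.trans h10)]

theorem Bcl_injective : Function.Injective Bcl := fun b c h => by
  obtain ⟨e, he⟩ := exists_smul_of_Bcl_eq h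
  exact (BIdx.eq_of_smul he).2

/-- The representation of the symmetric group by the classes of the matrices `B`. -/
noncomputable def octRep : Equiv.Perm (ZMod 4) →* PGL(2, ℂ) :=
  MonoidHom.mk' (fun σ => Bcl (permIdx σ)) fun σ τ => by
    obtain ⟨e, he, h⟩ := permIdx_mat_mul σ τ
    refine (Bcl_eq_of_smul (M := (permIdx σ).gl * (permIdx τ).gl) he h).symm.trans ?_
    exact map_mul _ _ _

theorem octRep_apply (σ : Equiv.Perm (ZMod 4)) : octRep σ = Bcl (permIdx σ) := rfl

theorem octRep_injective : Function.Injective octRep := fun _ _ h =>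
  permIdx_bijective.1 (Bcl_injective h)

theorem range_octRep : Set.range octRep = Set.range Bcl :=
  permIdx_bijective.2.range_comp Bcl

theorem octRep_octEquiv (k : Oct) : octRep (octEquiv k) = Bcl k.idx := by
  rw [octRep_apply, permIdx_octEquiv]

theorem Bcl_mul (k l : Oct) : Bcl (k.mul l).idx = Bcl k.idx * Bcl l.idx := by
  rw [← octRep_octEquiv, ← octRep_octEquiv, ← octRep_octEquiv, ← map_mul]
  congr 1
  exact Oct.perm_mul k l

theorem G'_eq : G' = octRep.range := by
  have e1 : Bcl (.full muI mu1) = Bcl (Oct.idx (.inr (.inr (1, 0)))) :=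
    congrArg Bcl (congrArg₂ BIdx.full (Subtype.ext muExp_one.symm) (Subtype.ext muExp_zero.symm))
  have e2 : Bcl (.diag muI) = Bcl (Oct.idx (.inl 1)) :=
    congrArg Bcl (congrArg BIdx.diag (Subtype.ext muExp_one.symm))
  have e3 : Bcl (.anti mu1) = Bcl (Oct.idx (.inr (.inl 0))) :=
    congrArg Bcl (congrArg BIdx.anti (Subtype.ext muExp_zero.symm))
  apply le_antisymm
  · rw [G', Subgroup.closure_le]
    rintro _ (rfl | rfl | rfl)
    · rw [e1, ← octRep_octEquiv]; exact ⟨_, rfl⟩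
    · rw [e2, ← octRep_octEquiv]; exact ⟨_, rfl⟩
    · rw [e3, ← octRep_octEquiv]; exact ⟨_, rfl⟩
  · have g1 : Bcl (Oct.idx (.inr (.inr (1, 0)))) ∈ G' := e1 ▸ Subgroup.subset_closure (by simp)
    have g2 : Bcl (Oct.idx (.inl 1)) ∈ G' := e2 ▸ Subgroup.subset_closure (by simp)
    have g3 : Bcl (Oct.idx (.inr (.inl 0))) ∈ G' := e3 ▸ Subgroup.subset_closure (by simp)
    have mul : ∀ k l m : Oct, k.mul l = m → Bcl k.idx ∈ G' → Bcl l.idx ∈ G' → Bcl m.idx ∈ G' := by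
      rintro k l _ rfl hk hl
      rw [Bcl_mul]
      exact mul_mem hk hl
    have d2 := mul (.inl 1) (.inl 1) (.inl 2) rfl g2 g2
    have d3 := mul (.inl 1) (.inl 2) (.inl 3) rfl g2 d2
    have d0 := mul (.inl 1) (.inl 3) (.inl 0) rfl g2 d3
    have hd : ∀ a : ZMod 4, Bcl (Oct.idx (.inl a)) ∈ G' := by
      intro a
      have : ∀ a : ZMod 4, a = 0 ∨ a = 1 ∨ a = 2 ∨ a = 3 := by decide
      rcases this a with rfl | rfl | rfl | rfl <;> assumption
    -- Multiplying the diagonal classes on the right by the antidiagonal generator, or on both sides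
    -- of the full one, reaches the remaining classes; for the antidiagonal ones the generator
    -- stands on the left.
    have hs : ∀ k : Oct, Bcl k.idx ∈ G' := by
      rintro (a | b | ⟨a, b⟩)
      · exact hd a
      · exact mul (.inr (.inl 0)) (.inl b) _ (by simp [Oct.mul]) g3 (hd b)
      · refine mul (.inr (.inr (a, 0))) (.inl b) _ (by simp [Oct.mul]) ?_ (hd b)
        exact mul (.inl (a - 1)) (.inr (.inr (1, 0))) _ (by simp [Oct.mul]) (hd _) g1
    rintro _ ⟨σ, rfl⟩
    exact hs _

/-- `G'` is the symmetric group. -/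
noncomputable def permEquivG' : Equiv.Perm (ZMod 4) ≃* G' :=
  (MonoidHom.ofInjective octRep_injective).trans (MulEquiv.subgroupCongr G'_eq.symm)

theorem permEquivG'_coe (σ : Equiv.Perm (ZMod 4)) : (permEquivG' σ).1 = Bcl (permIdx σ) := rfl

/-! ### The transformations of the parameter -/
-- Substituting one matrix after the other carries the quartic of t to a multiple of a quartic of
-- the family, and this determines the new parameter because the factor is nonzero. The left matrix
-- acts first, whence the order reversal.
theorem trans_mul (k l : Oct) {t : ℂ} (ht : t ^ 2 ≠ 4) :
    (k.mul l).idx.trans t = l.idx.trans (k.idx.trans t) := by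
  have hk := k.idx.quarticRel ht 1
  have hl := l.idx.quarticRel (k.idx.trans_sq_ne ht) 1
  have hm := (k.mul l).idx.quarticRel ht 1
  obtain ⟨e, he, h⟩ := mat_mul k l
  have h00 := congrFun (congrFun h 0) 0
  have h01 := congrFun (congrFun h 0) 1
  have h10 := congrFun (congrFun h 1) 0
  have h11 := congrFun (congrFun h 1) 1
  simp only [Matrix.mul_apply, Fin.sum_univ_two, Matrix.smul_apply, smul_eq_mul] at h00 h01 h10 h11
  have hm' := (k.mul l).idx.quarticRel ht e
  rw [← h00, ← h01, ← h10, ← h11] at hm'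
  have hlam := (k.mul l).idx.lam_ne_zero ht
  generalize (k.mul l).idx.trans t = T at *
  generalize (k.mul l).idx.lam t = L at *
  simp only [one_mul, one_pow] at hk hl
  set s := k.idx.trans t
  set u := l.idx.trans s
  obtain ⟨k1, k2, k3, k4, k5⟩ := hk
  obtain ⟨l1, l2, l3, l4, l5⟩ := hl
  generalize l.idx.mat 0 0 = a' at *
  generalize l.idx.mat 0 1 = b' at *
  generalize l.idx.mat 1 0 = c' at *
  generalize l.idx.mat 1 1 = d' at *
  generalize k.idx.mat 0 0 = a at *
  generalize k.idx.mat 0 1 = b at *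
  generalize k.idx.mat 1 0 = c at *
  generalize k.idx.mat 1 1 = d at *
  generalize k.idx.lam t = lk at *
  generalize l.idx.lam s = ll at *
  have n1 := hm'.h1
  have n5 := hm'.h5
  have m1 : e ^ 4 * L = lk * ll := by
    rw [← n1]
    linear_combination a' ^ 4 * k1 + c' ^ 4 * k2 + a' ^ 3 * c' * k3 + a' * c' ^ 3 * k4 +
      a' ^ 2 * c' ^ 2 * k5 + lk * l1
  have m5 : e ^ 4 * L * T = lk * ll * u := by
    rw [← n5]
    linear_combination 6 * a' ^ 2 * b' ^ 2 * k1 + 6 * c' ^ 2 * d' ^ 2 * k2 +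
      (3 * a' ^ 2 * b' * d' + 3 * a' * b' ^ 2 * c') * k3 + (3 * a' * c' * d' ^ 2 + 3 * b' * c' ^ 2 * d') * k4 +
      (a' ^ 2 * d' ^ 2 + 4 * a' * b' * c' * d' + b' ^ 2 * c' ^ 2) * k5 + lk * l5
  rw [m1] at m5
  refine mul_left_cancel₀ ?_ m5
  rw [← m1]
  exact mul_ne_zero (pow_ne_zero 4 he) hlam

/-- The action of the symmetric group on the parameters, from the right. -/
noncomputable instance : MulAction (Equiv.Perm (ZMod 4))ᵐᵒᵖ Param where
  smul σ t := ⟨(permIdx σ.unop).trans t.1, (permIdx σ.unop).trans_sq_ne t.2⟩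
  one_smul t := Subtype.ext (by
    change (permIdx 1).trans t.1 = t.1
    rw [permIdx_one, BIdx.trans, muExp_zero]
    simp)
  mul_smul σ τ t := Subtype.ext (by
    change (permIdx (τ.unop * σ.unop)).trans t.1 = (permIdx σ.unop).trans ((permIdx τ.unop).trans t.1)
    rw [permIdx, octEquiv_symm_mul]
    exact trans_mul _ _ t.2)

/-- The group of the six transformations is the image of the symmetric group. -/
theorem coe_range_toPermHom :
    ((MulAction.toPermHom (Equiv.Perm (ZMod 4))ᵐᵒᵖ Param).range : Set (Equiv.Perm Param)) =
      sixTrans := by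
  ext τ
  constructor
  · rintro ⟨σ, rfl⟩
    have key : ∀ b : BIdx, ∃ ε : ℂ, (ε = 1 ∨ ε = -1) ∧
        ((∀ t : Param, b.trans t.1 = ε * t.1) ∨
          (∀ t : Param, b.trans t.1 = ε * ((12 - 2 * t.1) / (2 + t.1))) ∨
          (∀ t : Param, b.trans t.1 = ε * ((12 + 2 * t.1) / (2 - t.1)))) := by
      intro b
      cases b with
      | diag α => exact ⟨α.1 ^ 2, α.sq, Or.inl fun t => rfl⟩
      | anti α => exact ⟨α.1 ^ 2, α.sq, Or.inl fun t => rfl⟩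
      | full α β =>
        refine ⟨β.1 ^ 2, β.sq, Or.inr ?_⟩
        rcases α.sq with h | h
        · refine Or.inl fun t => ?_
          simp only [BIdx.trans, h]; ring
        · refine Or.inr fun t => ?_
          simp only [BIdx.trans, h]; ring
    exact key (permIdx σ.unop)
  · rintro ⟨ε, hε, h⟩
    obtain ⟨β, hβ⟩ : ∃ β : Mu4, β.1 ^ 2 = ε := by
      rcases hε with rfl | rfl
      · exact ⟨mu1, one_pow 2⟩
      · exact ⟨muI, Complex.I_sq⟩
    have fin : ∀ b : BIdx, (∀ t : Param, (τ t).1 = b.trans t.1) →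
        τ ∈ (MulAction.toPermHom (Equiv.Perm (ZMod 4))ᵐᵒᵖ Param).range := by
      intro b hb
      obtain ⟨σ, hσ⟩ := permIdx_bijective.2 b
      refine ⟨MulOpposite.op σ, Equiv.ext fun t => Subtype.ext ?_⟩
      rw [hb t, ← hσ]
      rfl
    rcases h with h | h | h
    · exact fin (.diag β) fun t => by rw [h t, BIdx.trans, hβ]
    · refine fin (.full mu1 β) fun t => ?_
      rw [h t, BIdx.trans, hβ]
      simp only [mu1]; ring
    · refine fin (.full muI β) fun t => ?_
      rw [h t, BIdx.trans, hβ]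
      simp only [muI, Complex.I_sq]; ring

/-- The six transformations are the range of a homomorphism, so they already form a subgroup and
taking the closure adds nothing. -/
theorem H'_eq : H' = (MulAction.toPermHom (Equiv.Perm (ZMod 4))ᵐᵒᵖ Param).range := by
  rw [H', ← coe_range_toPermHom, Subgroup.closure_eq]

theorem coe_H' : (H' : Set (Equiv.Perm Param)) = sixTrans := by
  rw [H'_eq, coe_range_toPermHom]

/-- The homomorphism onto `H'`. -/
noncomputable def toH' : (Equiv.Perm (ZMod 4))ᵐᵒᵖ →* H' :=
  (MulAction.toPermHom (Equiv.Perm (ZMod 4))ᵐᵒᵖ Param).codRestrict H' fun σ => by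
    rw [H'_eq]; exact ⟨σ, rfl⟩

theorem toH'_apply (σ : (Equiv.Perm (ZMod 4))ᵐᵒᵖ) (t : Param) :
    ((toH' σ).1 t).1 = (permIdx σ.unop).trans t.1 := rfl

theorem toH'_surjective : Function.Surjective toH' := by
  rintro ⟨τ, hτ⟩
  rw [H'_eq] at hτ
  obtain ⟨σ, hσ⟩ := hτ
  exact ⟨σ, Subtype.ext hσ⟩

theorem trans_eq_id_iff (b : BIdx) : (∀ t : Param, b.trans t.1 = t.1) ↔
    ∃ α : Mu4, α.1 ^ 2 = 1 ∧ (b = .diag α ∨ b = .anti α) := by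
  -- Two test points suffice: t = 1 detects α², and t = 0 is moved to 6β² by the full matrices.
  have p1 : (1 : ℂ) ^ 2 ≠ 4 := by norm_num
  have p0 : (0 : ℂ) ^ 2 ≠ 4 := by norm_num
  constructor
  · intro h
    cases b with
    | diag α => exact ⟨α, by simpa [BIdx.trans] using h ⟨1, p1⟩, Or.inl rfl⟩
    | anti α => exact ⟨α, by simpa [BIdx.trans] using h ⟨1, p1⟩, Or.inr rfl⟩
    | full α β =>
      have := h ⟨0, p0⟩
      simp [BIdx.trans] at this
      exact absurd this β.ne_zero
  · rintro ⟨α, hα, rfl | rfl⟩ t <;> simp [BIdx.trans, hα]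

theorem mem_ker_toH' (σ : (Equiv.Perm (ZMod 4))ᵐᵒᵖ) : σ ∈ toH'.ker ↔
    ∃ α : Mu4, α.1 ^ 2 = 1 ∧ (permIdx σ.unop = .diag α ∨ permIdx σ.unop = .anti α) := by
  rw [MonoidHom.mem_ker, ← trans_eq_id_iff]
  constructor
  · intro h t
    rw [← toH'_apply, h]
    rfl
  · intro h
    exact Subtype.ext (Equiv.ext fun t => Subtype.ext (h t))

/-! ### The group `H'` as a symmetric group -/
theorem Oct.axisFun_bijective (k : Oct) : Function.Bijective k.axisFun := by
  obtain ⟨l, h1, h2⟩ := k.exists_inv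
  refine Function.bijective_iff_has_inverse.mpr ⟨l.axisFun, fun x => ?_, fun x => ?_⟩
  · rw [← Oct.axisFun_mul, h2, Oct.axisFun_one]
  · rw [← Oct.axisFun_mul, h1, Oct.axisFun_one]

/-- The permutation of the axes induced by a permutation of the diagonals. -/
noncomputable def axisHom : Equiv.Perm (ZMod 4) →* Equiv.Perm (Fin 3) :=
  MonoidHom.mk' (fun σ => Equiv.ofBijective _ (octEquiv.symm σ).axisFun_bijective) fun σ τ =>
    Equiv.ext fun x => by
      rw [Equiv.ofBijective_apply, octEquiv_symm_mul, Oct.axisFun_mul]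
      rfl

theorem axisHom_octEquiv (k : Oct) (x : Fin 3) : axisHom (octEquiv k) x = k.axisFun x := by
  change (octEquiv.symm (octEquiv k)).axisFun x = _
  rw [Equiv.symm_apply_apply]

theorem Oct.exists_axisFun (f : Equiv.Perm (Fin 3)) : ∃ k : Oct, ∀ x, k.axisFun x = f x := by
  revert f
  decide +kernel

theorem axisHom_surjective : Function.Surjective axisHom := fun f => by
  obtain ⟨k, hk⟩ := Oct.exists_axisFun f
  exact ⟨octEquiv k, Equiv.ext fun x => (axisHom_octEquiv k x).trans (hk x)⟩

theorem Oct.axisFun_eq_id_iff (k : Oct) : (∀ x, k.axisFun x = x) ↔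
    ∃ a : ZMod 4, 2 * a = 0 ∧ (k = .inl a ∨ k = .inr (.inl a)) := by
  revert k
  decide +kernel

theorem muExp_sq_eq_one_iff (a : ZMod 4) : (muExp a).1 ^ 2 = 1 ↔ 2 * a = 0 := by
  rw [sq, ← muExp_add, ← two_mul, ← muExp_bijective.1.eq_iff (a := 2 * a), Subtype.ext_iff, muExp_zero]

theorem mem_ker_toH'_octEquiv (k : Oct) : MulOpposite.op (octEquiv k) ∈ toH'.ker ↔
    ∃ a : ZMod 4, 2 * a = 0 ∧ (k = .inl a ∨ k = .inr (.inl a)) := by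
  rw [mem_ker_toH', MulOpposite.unop_op, permIdx_octEquiv]
  constructor
  · rintro ⟨α, hα, h⟩
    obtain ⟨a, rfl⟩ := muExp_bijective.2 α
    refine ⟨a, (muExp_sq_eq_one_iff a).1 hα, ?_⟩
    rcases h with h | h
    · exact Or.inl (Oct.idx_bijective.1 h)
    · exact Or.inr (Oct.idx_bijective.1 h)
  · rintro ⟨a, ha, h⟩
    refine ⟨muExp a, (muExp_sq_eq_one_iff a).2 ha, ?_⟩
    rcases h with rfl | rfl
    · exact Or.inl rfl
    · exact Or.inr rfl

/-- The homomorphism onto `H'` as a left action. -/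
noncomputable def toH'Left : Equiv.Perm (ZMod 4) →* H' :=
  toH'.comp (MulEquiv.inv' (Equiv.Perm (ZMod 4))).toMonoidHom

theorem toH'Left_surjective : Function.Surjective toH'Left :=
  toH'_surjective.comp (MulEquiv.inv' (Equiv.Perm (ZMod 4))).surjective

/-- Both maps are surjective on the same group, so equal kernels identify H' with the permutations
of the axes, without any multiplication table for H'. -/
theorem ker_toH'Left : toH'Left.ker = axisHom.ker := by
  ext σ
  obtain ⟨k, rfl⟩ := octEquiv.surjective σ
  have e : octEquiv k ∈ toH'Left.ker ↔ MulOpposite.op (octEquiv k) ∈ toH'.ker := by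
    rw [MonoidHom.mem_ker, MonoidHom.mem_ker]
    change toH' (MulOpposite.op (octEquiv k)⁻¹) = 1 ↔ _
    rw [MulOpposite.op_inv, map_inv, inv_eq_one]
  rw [e, mem_ker_toH'_octEquiv, ← Oct.axisFun_eq_id_iff, MonoidHom.mem_ker]
  constructor
  · intro h
    exact Equiv.ext fun x => (axisHom_octEquiv k x).trans (h x)
  · intro h x
    rw [← axisHom_octEquiv, h]
    rfl

/-- `H'` is the symmetric group of the axes. -/
noncomputable def equivH' : H' ≃* Equiv.Perm (Fin 3) :=
  (QuotientGroup.quotientKerEquivOfSurjective _ toH'Left_surjective).symm.trans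
    ((QuotientGroup.quotientMulEquivOfEq ker_toH'Left).trans
      (QuotientGroup.quotientKerEquivOfSurjective _ axisHom_surjective))

/-! ### The homomorphism from `G'` to `H'` -/

/-- The homomorphism from `G'` to the opposite of `H'`. -/
noncomputable def piG : G' →* (H')ᵐᵒᵖ :=
  ((MonoidHom.op toH').comp (MulEquiv.opOp _).toMonoidHom).comp permEquivG'.symm.toMonoidHom

theorem piG_permEquivG' (σ : Equiv.Perm (ZMod 4)) :
    piG (permEquivG' σ) = MulOpposite.op (toH' (MulOpposite.op σ)) := by
  change MulOpposite.op (toH' (MulOpposite.op (permEquivG'.symm (permEquivG' σ)))) = _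
  rw [MulEquiv.symm_apply_apply]

theorem piG_apply (b : BIdx) (g : G') (h : g.1 = Bcl b) (t : Param) :
    ((piG g).unop.1 t).1 = b.trans t.1 := by
  obtain ⟨σ, rfl⟩ := permEquivG'.surjective g
  rw [permEquivG'_coe] at h
  rw [piG_permEquivG', ← Bcl_injective h]
  rfl

theorem piG_surjective : Function.Surjective piG := by
  intro h
  obtain ⟨σ, hσ⟩ := toH'_surjective h.unop
  refine ⟨permEquivG' σ.unop, ?_⟩
  rw [piG_permEquivG', MulOpposite.op_unop, hσ, MulOpposite.op_unop]

theorem permEquivG'_mem_ker (σ : Equiv.Perm (ZMod 4)) :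
    permEquivG' σ ∈ piG.ker ↔ MulOpposite.op σ ∈ toH'.ker := by
  rw [MonoidHom.mem_ker, MonoidHom.mem_ker, piG_permEquivG', MulOpposite.op_eq_one_iff]

theorem mem_ker_piG (g : G') : g ∈ piG.ker ↔
    ∃ α : Mu4, α.1 ^ 2 = 1 ∧ (g.1 = Bcl (.diag α) ∨ g.1 = Bcl (.anti α)) := by
  obtain ⟨σ, rfl⟩ := permEquivG'.surjective g
  rw [permEquivG'_mem_ker, mem_ker_toH']
  simp only [permEquivG'_coe, Bcl_injective.eq_iff, MulOpposite.unop_op]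

theorem card_ker_piG : Nat.card piG.ker = 4 := by
  have h := Subgroup.card_mul_index piG.ker
  rw [Subgroup.index_ker, MonoidHom.range_eq_top.2 piG_surjective, Subgroup.card_top,
    Nat.card_congr MulOpposite.opEquiv.symm, Nat.card_congr equivH'.toEquiv,
    Nat.card_congr permEquivG'.symm.toEquiv, Nat.card_eq_fintype_card (α := Equiv.Perm (Fin 3)),
    Nat.card_eq_fintype_card (α := Equiv.Perm (ZMod 4)), Fintype.card_perm, Fintype.card_perm,
    Fintype.card_fin, ZMod.card] at h
  simp only [Nat.factorial] at h
  omega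

theorem isKleinFour_ker_piG : IsKleinFour piG.ker := by
  refine ⟨card_ker_piG, ?_⟩
  have : Finite piG.ker := Nat.finite_of_card_ne_zero (by rw [card_ker_piG]; norm_num)
  have : Nontrivial piG.ker := Finite.one_lt_card_iff_nontrivial.1 (by rw [card_ker_piG]; norm_num)
  rw [Monoid.exponent_eq_prime_iff Nat.prime_two]
  rintro ⟨g, hg⟩ h1
  refine orderOf_eq_prime (Subtype.ext ?_) h1
  obtain ⟨σ, rfl⟩ := permEquivG'.surjective g
  obtain ⟨k, rfl⟩ := octEquiv.surjective σ
  rw [permEquivG'_mem_ker, mem_ker_toH'_octEquiv] at hg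
  change permEquivG' (octEquiv k) ^ 2 = 1
  rw [← map_pow, map_eq_one_iff _ permEquivG'.injective, sq]
  apply octEquiv.symm.injective
  rw [octEquiv_symm_mul, octEquiv_symm_one, Equiv.symm_apply_apply]
  obtain ⟨a, ha, rfl | rfl⟩ := hg
  · rw [Oct.mul, ← two_mul, ha]
  · rw [Oct.mul, sub_self]

/-! ### The group of the matrices `B̃` -/
-- Composing substitutions multiplies their matrices in the opposite order, hence τ * σ. Normalising
-- the product matrix by its scalar e divides the factor of z by e².
theorem Bt_mul (σ τ : Equiv.Perm (ZMod 4)) : ∃ e : ℂˣ, ∀ γ δ : ℂˣ,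
    Bt (permIdx σ) γ * Bt (permIdx τ) δ = Bt (permIdx (τ * σ)) (δ * γ / e ^ 2) := by
  obtain ⟨e, he, h⟩ := permIdx_mat_mul τ σ
  have h00 := congrFun (congrFun h 0) 0
  have h01 := congrFun (congrFun h 0) 1
  have h10 := congrFun (congrFun h 1) 0
  have h11 := congrFun (congrFun h 1) 1
  simp only [Matrix.mul_apply, Fin.sum_univ_two, Matrix.smul_apply, smul_eq_mul] at h00 h01 h10 h11
  refine ⟨Units.mk0 e he, fun γ δ => ?_⟩
  have hσ := isTri_Bt (permIdx σ) γ
  have hτ := isTri_Bt (permIdx τ) δ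
  have key := IsTri.mk_eq_Bt (φ := blockAut (permIdx σ).gl γ * blockAut (permIdx τ).gl δ)
    (b := permIdx (τ * σ)) (e := e) (γ := (δ * γ : ℂˣ)) he (δ * γ).ne_zero ?_
  · rw [Units.mk0_val] at key
    exact key
  rw [← h00, ← h01, ← h10, ← h11]
  refine ⟨?_, ?_, ?_⟩
  · change (blockAut (permIdx σ).gl γ).1 ((blockAut (permIdx τ).gl δ).1 (X 0)) = _
    rw [hτ.h0]
    simp only [map_add, map_mul, algEquiv_C, hσ.h0, hσ.h1]
    ring
  · change (blockAut (permIdx σ).gl γ).1 ((blockAut (permIdx τ).gl δ).1 (X 1)) = _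
    rw [hτ.h1]
    simp only [map_add, map_mul, algEquiv_C, hσ.h0, hσ.h1]
    ring
  · change (blockAut (permIdx σ).gl γ).1 ((blockAut (permIdx τ).gl δ).1 (X 2)) = _
    rw [hτ.h2]
    simp only [map_add, map_mul, algEquiv_C, hσ.h0, hσ.h1, hσ.h2, map_zero, Units.val_mul]
    ring

theorem Bt_one : Bt (permIdx 1) 1 = 1 := by
  have h := isTri_Bt (permIdx 1) 1
  rw [permIdx_one_mat] at h
  have key : blockAut (permIdx 1).gl 1 = 1 := h.ext ⟨by simp, by simp, by simp⟩
  rw [Bt, key]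
  rfl

theorem Bt_inv (σ : Equiv.Perm (ZMod 4)) (γ : ℂˣ) : ∃ δ : ℂˣ,
    (Bt (permIdx σ) γ)⁻¹ = Bt (permIdx σ⁻¹) δ := by
  obtain ⟨e, he⟩ := Bt_mul σ σ⁻¹
  refine ⟨e ^ 2 / γ, ?_⟩
  rw [inv_eq_iff_mul_eq_one, he, inv_mul_cancel, div_mul_cancel, div_self', Bt_one]

/-- Equal classes differ by a scaling; normalisation of the 2×2 blocks forces its parameter to be 1,
so the factors of z agree as well. -/
theorem Bt_injective : Function.Injective (fun p : BIdx × ℂˣ => Bt p.1 p.2) := by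
  rintro ⟨b, γ⟩ ⟨c, δ⟩ h
  have h' : (blockAut b.gl γ)⁻¹ * blockAut c.gl δ ∈ Scalings := QuotientGroup.eq.1 h
  obtain ⟨e, he⟩ := h'
  have hb := isTri_Bt b γ
  have hc := isTri_Bt c δ
  have key : ∀ i, (blockAut c.gl δ).1 (X i) = C ((e : ℂ) ^ wt i) * (blockAut b.gl γ).1 (X i) := by
    intro i
    have := congrArg (blockAut b.gl γ).1 (he i)
    rw [map_mul, algEquiv_C] at this
    rw [← this]
    exact ((blockAut b.gl γ).1.apply_symm_apply _).symm
  have k0 := key 0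
  have k1 := key 1
  have k2 := key 2
  rw [hc.h0, hb.h0] at k0
  rw [hc.h1, hb.h1] at k1
  rw [hc.h2, hb.h2] at k2
  have x2 : (X 2 : O) = mon 0 0 1 := by simp [mon]
  have ev : ∀ {u v w p q : ℂ}, (C u * X 0 + C v * X 1 : O) = C w * (C p * X 0 + C q * X 1) →
      w * p = u ∧ w * q = v := by
    intro u v w p q h
    have h1 := congrArg (cf 1 0 0) h
    have h2 := congrArg (cf 0 1 0) h
    rw [cf_C_mul, (cf_linear _ _).1, (cf_linear _ _).1] at h1
    rw [cf_C_mul, (cf_linear _ _).2, (cf_linear _ _).2] at h2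
    exact ⟨h1.symm, h2.symm⟩
  have hm : ((e : ℂ) ^ 1) • b.mat = c.mat := by
    ext i j
    fin_cases i <;> fin_cases j
    · exact (ev k0).1
    · exact (ev k0).2
    · exact (ev k1).1
    · exact (ev k1).2
  obtain ⟨h1, rfl⟩ := BIdx.eq_of_smul hm
  rw [pow_one] at h1
  rw [h1] at k2
  have h2 := congrArg (cf 0 0 1) k2
  simp only [x2, cf_C_mul_mon, map_zero, zero_mul, add_zero, one_pow, map_one, one_mul] at h2
  norm_num at h2
  rw [Units.ext h2]

theorem exists_eq_Bt_of_mem {g : PGLw} (hg : g ∈ BtGroup) :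
    ∃ (σ : Equiv.Perm (ZMod 4)) (γ : ℂˣ), g = Bt (permIdx σ) γ := by
  induction hg using Subgroup.closure_induction with
  | mem x hx =>
    obtain ⟨⟨b, γ⟩, rfl⟩ := hx
    obtain ⟨σ, rfl⟩ := permIdx_bijective.2 b
    exact ⟨σ, γ, rfl⟩
  | one => exact ⟨1, 1, Bt_one.symm⟩
  | mul x y _ _ hx hy =>
    obtain ⟨σ, γ, rfl⟩ := hx
    obtain ⟨τ, δ, rfl⟩ := hy
    obtain ⟨e, he⟩ := Bt_mul σ τ
    exact ⟨_, _, he γ δ⟩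
  | inv x _ hx =>
    obtain ⟨σ, γ, rfl⟩ := hx
    obtain ⟨δ, hδ⟩ := Bt_inv σ γ
    exact ⟨_, _, hδ⟩

theorem Bt_mem_BtGroup (b : BIdx) (γ : ℂˣ) : Bt b γ ∈ BtGroup :=
  Subgroup.subset_closure ⟨(b, γ), rfl⟩

theorem coe_BtGroup : (BtGroup : Set PGLw) = Set.range (fun p : BIdx × ℂˣ => Bt p.1 p.2) := by
  refine Set.Subset.antisymm (fun g hg => ?_) Subgroup.subset_closure
  obtain ⟨σ, γ, rfl⟩ := exists_eq_Bt_of_mem hg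
  exact ⟨(permIdx σ, γ), rfl⟩

/-- The permutation attached to an element of the group of the matrices `B̃`. -/
noncomputable def btPerm (g : BtGroup) : Equiv.Perm (ZMod 4) := (exists_eq_Bt_of_mem g.2).choose

theorem btPerm_eq {g : BtGroup} {σ : Equiv.Perm (ZMod 4)} {γ : ℂˣ} (h : g.1 = Bt (permIdx σ) γ) :
    btPerm g = σ := by
  obtain ⟨δ, hδ⟩ := (exists_eq_Bt_of_mem g.2).choose_spec
  have := @Bt_injective (permIdx _, δ) (permIdx σ, γ) (hδ.symm.trans h)
  exact permIdx_bijective.1 (Prod.ext_iff.1 this).1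

/-- The homomorphism from the group of the matrices `B̃` to the opposite symmetric group. -/
noncomputable def btPermHom : BtGroup →* (Equiv.Perm (ZMod 4))ᵐᵒᵖ :=
  MonoidHom.mk' (fun g => MulOpposite.op (btPerm g)) fun g h => by
    obtain ⟨σ, γ, hg⟩ := exists_eq_Bt_of_mem g.2
    obtain ⟨τ, δ, hh⟩ := exists_eq_Bt_of_mem h.2
    obtain ⟨e, he⟩ := Bt_mul σ τ
    have hm : (g * h).1 = Bt (permIdx (τ * σ)) (δ * γ / e ^ 2) := by
      rw [← he, ← hg, ← hh]
      rfl
    rw [btPerm_eq hg, btPerm_eq hh, btPerm_eq hm, MulOpposite.op_mul]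

/-- The action of the group of the matrices `B̃` on the parameters. -/
noncomputable def rhoBt : BtGroup →* H' := toH'.comp btPermHom

theorem rhoBt_apply {b : BIdx} {γ : ℂˣ} {h : BtGroup} (hh : h.1 = Bt b γ) (t : Param) :
    ((rhoBt h).1 t).1 = b.trans t.1 := by
  obtain ⟨σ, rfl⟩ := permIdx_bijective.2 b
  change (permIdx (btPerm h)).trans t.1 = _
  rw [btPerm_eq hh]

theorem rhoBt_eq_piG {b : BIdx} {γ : ℂˣ} {g : G'} {h : BtGroup} (hg : g.1 = Bcl b)
    (hh : h.1 = Bt b γ) : rhoBt h = (piG g).unop :=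
  Subtype.ext (Equiv.ext fun t => Subtype.ext ((rhoBt_apply hh t).trans (piG_apply b g hg t).symm))

/-- The set {0, ±6} is permuted. For a full matrix and u = α²t, the value is 0 only for u = 6, and
its square is 36 only for u(u + 6) = 0. -/
theorem BIdx.trans_nonJump (b : BIdx) {t : Param} (ht : NonJump t) :
    b.trans t.1 ≠ 0 ∧ b.trans t.1 ^ 2 ≠ 36 := by
  obtain ⟨h0, h6, h6'⟩ := ht
  have h36 : t.1 ^ 2 ≠ 36 := by
    intro h
    have : (t.1 - 6) * (t.1 + 6) = 0 := by linear_combination h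
    rcases mul_eq_zero.1 this with h | h
    · exact h6 (by linear_combination h)
    · exact h6' (by linear_combination h)
  cases b with
  | diag α =>
    refine ⟨mul_ne_zero (pow_ne_zero 2 α.ne_zero) h0, fun h => h36 ?_⟩
    simp only [BIdx.trans] at h
    linear_combination h - t.1 ^ 2 * α.pow_four
  | anti α =>
    refine ⟨mul_ne_zero (pow_ne_zero 2 α.ne_zero) h0, fun h => h36 ?_⟩
    simp only [BIdx.trans] at h
    linear_combination h - t.1 ^ 2 * α.pow_four
  | full α β =>
    have hl : (2 + α.1 ^ 2 * t.1) ≠ 0 := lam_full_ne_zero α t.2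
    have hα := α.pow_four
    have hβ := β.pow_four
    simp only [BIdx.trans]
    constructor
    · refine div_ne_zero (mul_ne_zero (pow_ne_zero 2 β.ne_zero) fun h => h36 ?_) hl
      linear_combination (-(6 + α.1 ^ 2 * t.1) / 2) * h - t.1 ^ 2 * hα
    · intro h
      rw [div_pow, div_eq_iff (pow_ne_zero 2 hl)] at h
      have : (α.1 ^ 2 * t.1) * (α.1 ^ 2 * t.1 + 6) = 0 := by
        linear_combination (-1 / 32) * h + (12 - 2 * α.1 ^ 2 * t.1) ^ 2 / 32 * hβ
      rcases mul_eq_zero.1 this with h | h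
      · exact mul_ne_zero (pow_ne_zero 2 α.ne_zero) h0 h
      · exact h36 (by linear_combination (α.1 ^ 2 * t.1 - 6) * h - t.1 ^ 2 * hα)

theorem sq_ne_36 {t : Param} (ht : NonJump t) : t.1 ^ 2 ≠ 36 := by
  have h := (BIdx.trans_nonJump (.diag mu1) ht).2
  simpa [BIdx.trans, mu1] using h

theorem nonJump_of {t : Param} (h0 : t.1 ≠ 0) (h : t.1 ^ 2 ≠ 36) : NonJump t :=
  ⟨h0, fun h6 => h (by rw [h6]; norm_num), fun h6 => h (by rw [h6]; norm_num)⟩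

theorem rhoBt_nonJump (h : BtGroup) {t : Param} (ht : NonJump t) : NonJump ((rhoBt h).1 t) := by
  obtain ⟨σ, γ, hh⟩ := exists_eq_Bt_of_mem h.2
  have := (permIdx σ).trans_nonJump ht
  rw [← rhoBt_apply hh] at this
  exact nonJump_of this.1 this.2

theorem homs_eq_action {k : ℕ∞} (hk : k = 0 ∨ k = 1) {t s : Param} (hs : NonJump s) :
    homs k t s = {g : PGLw | ∃ h : g ∈ BtGroup, (rhoBt ⟨g, h⟩).1 t = s} := by
  ext g
  rw [homs_eq, mem_homSet_of_le_one hk t.2 s.2 hs.1 (sq_ne_36 hs)]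
  constructor
  · rintro ⟨b, γ, rfl, h⟩
    exact ⟨Bt_mem_BtGroup b γ, Subtype.ext ((rhoBt_apply rfl t).trans h.symm)⟩
  · rintro ⟨h, hs⟩
    obtain ⟨σ, γ, rfl⟩ := exists_eq_Bt_of_mem h
    refine ⟨_, γ, rfl, ?_⟩
    rw [← hs]
    exact rhoBt_apply rfl t

theorem homs_eq_union {k : ℕ∞} (hk : 2 ≤ k) (t s : Param) :
    homs k t s =
      {g : PGLw | ∃ (α : Mu4) (γ : ℂˣ), s.1 = α.1 ^ 2 * t.1 ∧ (γ : ℂ) ^ 2 = 1 ∧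
        (g = Bt (.diag α) γ ∨ g = Bt (.anti α) γ)} ∪
      {g : PGLw | ∃ (α β : Mu4) (γ : ℂˣ),
        s.1 = β.1 ^ 2 * (12 - 2 * α.1 ^ 2 * t.1) / (2 + α.1 ^ 2 * t.1) ∧
        (γ : ℂ) ^ 2 = 2 + α.1 ^ 2 * t.1 ∧ g = Bt (.full α β) γ} := by
  ext g
  rw [homs_eq, mem_homSet_of_two_le hk t.2]
  constructor
  · rintro ⟨b, γ, rfl, h, hγ⟩
    cases b with
    | diag α => exact Or.inl ⟨α, γ, h, hγ, Or.inl rfl⟩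
    | anti α => exact Or.inl ⟨α, γ, h, hγ, Or.inr rfl⟩
    | full α β => exact Or.inr ⟨α, β, γ, h, hγ, rfl⟩
  · rintro (⟨α, γ, h, hγ, rfl | rfl⟩ | ⟨α, β, γ, h, hγ, rfl⟩)
    · exact ⟨.diag α, γ, rfl, h, hγ⟩
    · exact ⟨.anti α, γ, rfl, h, hγ⟩
    · exact ⟨.full α β, γ, rfl, h, hγ⟩

theorem homs_self_eq {k : ℕ∞} (hk : 2 ≤ k) {t : Param} (ht : NonJump t) (ht' : t.1 ^ 2 ≠ -12) :
    homs k t t =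
      {g : PGLw | ∃ (α : Mu4) (γ : ℂˣ), α.1 ^ 2 = 1 ∧ (γ : ℂ) ^ 2 = 1 ∧
        (g = Bt (.diag α) γ ∨ g = Bt (.anti α) γ)} := by
  rw [homs_eq_union hk]
  ext g
  constructor
  · rintro (⟨α, γ, h, hγ, hg⟩ | ⟨α, β, γ, h, hγ, rfl⟩)
    · refine ⟨α, γ, mul_right_cancel₀ ht.1 ?_, hγ, hg⟩
      rw [← h, one_mul]
    · exfalso
      rw [eq_div_iff (lam_full_ne_zero α t.2)] at h
      -- The fixed points of the four fractional transformations are -6 and 2, twice the roots of t²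
      -- = -12, and 6 and -2.
      rcases α.sq with ha | ha <;> rcases β.sq with hb | hb <;> rw [ha, hb] at h
      · have : (t.1 + 6) * (t.1 - 2) = 0 := by linear_combination h
        rcases mul_eq_zero.1 this with h | h
        · exact ht.2.2 (by linear_combination h)
        · exact t.2 (by linear_combination (t.1 + 2) * h)
      · exact ht' (by linear_combination h)
      · exact ht' (by linear_combination -h)
      · have : (t.1 - 6) * (t.1 + 2) = 0 := by linear_combination -h
        rcases mul_eq_zero.1 this with h | h
        · exact ht.2.1 (by linear_combination h)
        · exact t.2 (by linear_combination (t.1 - 2) * h)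
  · rintro ⟨α, γ, h, hγ, hg⟩
    exact Or.inl ⟨α, γ, by rw [h, one_mul], hγ, hg⟩

/-! ### The first moduli algebra -/

/-- The class of `x`. -/
noncomputable def xA (t : ℂ) : A 1 t := cl t (X 0)

/-- The class of `y`. -/
noncomputable def yA (t : ℂ) : A 1 t := cl t (X 1)

/-- The class of `z`. -/
noncomputable def zA (t : ℂ) : A 1 t := cl t (X 2)

/-- The class map as an algebra homomorphism. -/
noncomputable def clHom (t : ℂ) : O →ₐ[ℂ] A 1 t := Ideal.Quotient.mkₐ ℂ (I 1 t)

theorem clHom_apply (t : ℂ) (f : O) : clHom t f = cl t f := rfl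

theorem clHom_surjective (t : ℂ) : Function.Surjective (clHom t) := Ideal.Quotient.mk_surjective

theorem cl_eq_zero_iff {t : ℂ} {f : O} : cl t f = 0 ↔ f ∈ I 1 t := Ideal.Quotient.eq_zero_iff_mem

theorem cl_add (t : ℂ) (f g : O) : cl t (f + g) = cl t f + cl t g := map_add (clHom t) f g

theorem cl_neg (t : ℂ) (f : O) : cl t (-f) = -cl t f := map_neg (clHom t) f

theorem cl_mul (t : ℂ) (f g : O) : cl t (f * g) = cl t f * cl t g := map_mul (clHom t) f g

theorem cl_pow (t : ℂ) (f : O) (n : ℕ) : cl t (f ^ n) = cl t f ^ n := map_pow (clHom t) f n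

theorem cl_C (t c : ℂ) : cl t (C c) = algebraMap ℂ (A 1 t) c := (clHom t).commutes c

theorem smul_eq_mul_A {t : ℂ} (c : ℂ) (α : A 1 t) : c • α = algebraMap ℂ (A 1 t) c * α :=
  Algebra.smul_def c α

/-- The functionals on power series that give the coordinates in the first moduli algebra. -/
noncomputable def preCo (t : ℂ) : Fin 12 → O →ₗ[ℂ] ℂ :=
  ![cf 0 0 0, cf 1 0 0, cf 0 1 0, cf 0 0 1, cf 2 0 0, cf 1 1 0, cf 0 2 0, cf 3 0 0, cf 2 1 0,
    cf 1 2 0, cf 0 3 0, socle t]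

theorem preCo_eq_zero {t : ℂ} (ht : t ^ 2 ≠ 4) (i : Fin 12) {f : O} (hf : f ∈ I 1 t) :
    preCo t i f = 0 := by
  fin_cases i
  all_goals first
    | exact socle_eq_zero ht hf
    | exact cf_eq_zero_of_mem ht hf (by omega)

/-- The coordinates in the basis `1, x, y, z, x², xy, y², x³, x²y, xy², y³, x²y²`. -/
noncomputable def co (t : Param) (i : Fin 12) : A 1 t.1 →ₗ[ℂ] ℂ :=
  ((I 1 t.1).restrictScalars ℂ).liftQ (preCo t.1 i) fun _ hf => preCo_eq_zero t.2 i hf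

theorem co_cl (t : Param) (i : Fin 12) (f : O) : co t i (cl t.1 f) = preCo t.1 i f := rfl

section
variable (t : Param) (α : A 1 t.1)

theorem co_one : (co t 0 1 = 1) ∧ ∀ i, i ≠ 0 → co t i 1 = 0 := by
  have h : (1 : A 1 t.1) = cl t.1 1 := rfl
  constructor
  · rw [h, co_cl]
    simp [preCo, cf_one]
  · intro i hi
    rw [h, co_cl]
    fin_cases i
    · exact absurd rfl hi
    all_goals simp [preCo, cf_one, socle_apply]

theorem co_x_mul : co t 0 (xA t.1 * α) = 0 ∧ co t 1 (xA t.1 * α) = co t 0 α ∧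
    co t 2 (xA t.1 * α) = 0 ∧ co t 3 (xA t.1 * α) = 0 ∧ co t 4 (xA t.1 * α) = co t 1 α ∧
    co t 5 (xA t.1 * α) = co t 2 α ∧ co t 6 (xA t.1 * α) = 0 ∧ co t 7 (xA t.1 * α) = co t 4 α ∧
    co t 8 (xA t.1 * α) = co t 5 α ∧ co t 9 (xA t.1 * α) = co t 6 α ∧ co t 10 (xA t.1 * α) = 0 ∧
    co t 11 (xA t.1 * α) = co t 9 α - t.1 / 2 * co t 7 α := by
  obtain ⟨f, rfl⟩ := clHom_surjective t.1 α
  rw [clHom_apply, xA, ← cl_mul]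
  simp only [co_cl]
  simp [preCo, cf_X0_mul, socle_apply]

theorem co_y_mul : co t 0 (yA t.1 * α) = 0 ∧ co t 1 (yA t.1 * α) = 0 ∧
    co t 2 (yA t.1 * α) = co t 0 α ∧ co t 3 (yA t.1 * α) = 0 ∧ co t 4 (yA t.1 * α) = 0 ∧
    co t 5 (yA t.1 * α) = co t 1 α ∧ co t 6 (yA t.1 * α) = co t 2 α ∧ co t 7 (yA t.1 * α) = 0 ∧
    co t 8 (yA t.1 * α) = co t 4 α ∧ co t 9 (yA t.1 * α) = co t 5 α ∧
    co t 10 (yA t.1 * α) = co t 6 α ∧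
    co t 11 (yA t.1 * α) = co t 8 α - t.1 / 2 * co t 10 α := by
  obtain ⟨f, rfl⟩ := clHom_surjective t.1 α
  rw [clHom_apply, yA, ← cl_mul]
  simp only [co_cl]
  simp [preCo, cf_X1_mul, socle_apply]

theorem co_z_mul : co t 3 (zA t.1 * α) = co t 0 α ∧ ∀ i, i ≠ 3 → co t i (zA t.1 * α) = 0 := by
  obtain ⟨f, rfl⟩ := clHom_surjective t.1 α
  rw [clHom_apply, zA, ← cl_mul]
  simp only [co_cl]
  constructor
  · simp [preCo, cf_X2_mul]
  · intro i hi
    fin_cases i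
    all_goals first
      | exact absurd rfl hi
      | simp [preCo, cf_X2_mul, socle_apply]

end

theorem relations (t : Param) : zA t.1 * xA t.1 = 0 ∧ zA t.1 * yA t.1 = 0 ∧ zA t.1 * zA t.1 = 0 ∧
    xA t.1 ^ 3 * yA t.1 = 0 ∧ xA t.1 * yA t.1 ^ 3 = 0 ∧
    xA t.1 ^ 4 = (-(t.1 / 2)) • (xA t.1 ^ 2 * yA t.1 ^ 2) ∧
    yA t.1 ^ 4 = (-(t.1 / 2)) • (xA t.1 ^ 2 * yA t.1 ^ 2) := by
  have m : ∀ g ∈ gens t.1, cl t.1 g = 0 := fun g hg => by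
    rw [cl_eq_zero_iff, I_one_eq t.2]
    exact Ideal.subset_span hg
  have m1 := m (mon 1 0 1) (by simp [gens])
  have m2 := m (mon 0 1 1) (by simp [gens])
  have m3 := m (mon 0 0 2) (by simp [gens])
  have m4 := m (mon 3 1 0) (by simp [gens])
  have m5 := m (mon 1 3 0) (by simp [gens])
  have m6 := m (C 2 * mon 4 0 0 + C t.1 * mon 2 2 0) (by simp [gens])
  have m7 := m (C 2 * mon 0 4 0 + C t.1 * mon 2 2 0) (by simp [gens])
  have ex : cl t.1 (X 0) = xA t.1 := rfl
  have ey : cl t.1 (X 1) = yA t.1 := rfl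
  have ez : cl t.1 (X 2) = zA t.1 := rfl
  simp only [mon, pow_zero, pow_one, mul_one, one_mul, cl_add, cl_mul, cl_pow, cl_C, ex, ey, ez] at *
  refine ⟨(mul_comm _ _).trans m1, (mul_comm _ _).trans m2, (sq _).symm.trans m3, m4, m5, ?_, ?_⟩
  all_goals
    rw [smul_eq_mul_A]
    have h : algebraMap ℂ (A 1 t.1) (1 / 2) * algebraMap ℂ (A 1 t.1) 2 = 1 := by
      rw [← map_mul]; norm_num
    have h' : algebraMap ℂ (A 1 t.1) (-(t.1 / 2)) =
        -(algebraMap ℂ (A 1 t.1) (1 / 2) * algebraMap ℂ (A 1 t.1) t.1) := by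
      rw [← map_mul, ← map_neg]; congr 1; ring
    rw [h']
  · linear_combination algebraMap ℂ (A 1 t.1) (1 / 2) * m6 - xA t.1 ^ 4 * h
  · linear_combination algebraMap ℂ (A 1 t.1) (1 / 2) * m7 - yA t.1 ^ 4 * h

/-- Variables are split off one degree at a time. Products of z with x, y, z vanish, so z
contributes only itself; in degree four everything reduces to x²y², and degree five is zero. -/
theorem exists_expansion (t : Param) (α : A 1 t.1) : ∃ c : Fin 12 → ℂ,
    α = c 0 • 1 + c 1 • xA t.1 + c 2 • yA t.1 + c 3 • zA t.1 + c 4 • (xA t.1 * xA t.1) +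
      c 5 • (xA t.1 * yA t.1) + c 6 • (yA t.1 * yA t.1) + c 7 • (xA t.1 * (xA t.1 * xA t.1)) +
      c 8 • (xA t.1 * (xA t.1 * yA t.1)) + c 9 • (xA t.1 * (yA t.1 * yA t.1)) +
      c 10 • (yA t.1 * (yA t.1 * yA t.1)) + c 11 • (xA t.1 * (xA t.1 * (yA t.1 * yA t.1))) := by
  obtain ⟨r1, r2, r3, r4, r5, r6, r7⟩ := relations t
  have ht := t.2
  have dec : ∀ β : A 1 t.1, ∃ (c : ℂ) (β0 β1 β2 : A 1 t.1),
      β = algebraMap ℂ _ c + xA t.1 * β0 + yA t.1 * β1 + zA t.1 * β2 := by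
    intro β
    obtain ⟨f, rfl⟩ := clHom_surjective t.1 β
    obtain ⟨c, f0, f1, f2, h⟩ := exists_decomp f
    refine ⟨c, cl t.1 f0, cl t.1 f1, cl t.1 f2, ?_⟩
    conv_lhs => rw [h]
    rw [clHom_apply, cl_add, cl_add, cl_add, cl_C, cl_mul, cl_mul, cl_mul]
    rfl
  simp only [smul_eq_mul_A] at *
  generalize xA t.1 = x at *
  generalize yA t.1 = y at *
  generalize zA t.1 = z at *
  have mul : ∀ m : A 1 t.1, z * m = 0 → ∀ β : A 1 t.1, ∃ (c : ℂ) (β0 β1 : A 1 t.1),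
      m * β = algebraMap ℂ _ c * m + m * x * β0 + m * y * β1 := by
    intro m hm β
    obtain ⟨c, β0, β1, β2, h⟩ := dec β
    exact ⟨c, β0, β1, by rw [h]; linear_combination β2 * hm⟩
  have hx3 : x ^ 3 * y ^ 2 = 0 := by linear_combination y * r4
  have hy3 : x ^ 2 * y ^ 3 = 0 := by linear_combination x * r5
  obtain ⟨c0, α0, α1, α2, e0⟩ := dec α
  obtain ⟨c3, u0, u1, u2, ez⟩ := dec α2
  obtain ⟨c1, β0, β1, ex⟩ := mul x r1 α0
  obtain ⟨c2, β2, β3, ey⟩ := mul y r2 α1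
  obtain ⟨c4, γ0, γ1, exx⟩ := mul (x * x) (by linear_combination x * r1) β0
  obtain ⟨c5, γ2, γ3, exy⟩ := mul (x * y) (by linear_combination y * r1) (β1 + β2)
  obtain ⟨c6, γ4, γ5, eyy⟩ := mul (y * y) (by linear_combination y * r2) β3
  obtain ⟨c7, δ0, δ1, exxx⟩ := mul (x * (x * x)) (by linear_combination x * x * r1) γ0
  obtain ⟨c8, δ2, δ3, exxy⟩ := mul (x * (x * y)) (by linear_combination x * y * r1) (γ1 + γ2)
  obtain ⟨c9, δ4, δ5, exyy⟩ := mul (x * (y * y)) (by linear_combination y * y * r1) (γ3 + γ4)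
  obtain ⟨c10, δ6, δ7, eyyy⟩ := mul (y * (y * y)) (by linear_combination y * y * r2) γ5
  -- The factor -t/2 collects the remainders at x⁴ and y⁴; the other two are direct multiples of
  -- x²y².
  obtain ⟨c11, ε0, ε1, ew⟩ := mul (x * (x * (y * y))) (by linear_combination x * y * y * r1)
    (algebraMap ℂ _ (-(t.1 / 2)) * (δ0 + δ7) + δ3 + δ4)
  refine ⟨![c0, c1, c2, c3, c4, c5, c6, c7, c8, c9, c10, c11], ?_⟩
  change α = algebraMap ℂ _ c0 * 1 + algebraMap ℂ _ c1 * x + algebraMap ℂ _ c2 * y +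
    algebraMap ℂ _ c3 * z + algebraMap ℂ _ c4 * (x * x) + algebraMap ℂ _ c5 * (x * y) +
    algebraMap ℂ _ c6 * (y * y) + algebraMap ℂ _ c7 * (x * (x * x)) +
    algebraMap ℂ _ c8 * (x * (x * y)) + algebraMap ℂ _ c9 * (x * (y * y)) +
    algebraMap ℂ _ c10 * (y * (y * y)) + algebraMap ℂ _ c11 * (x * (x * (y * y)))
  linear_combination e0 + z * ez + u0 * r1 + u1 * r2 + u2 * r3 + ex + ey + exx + exy + eyy + exxx +
    exxy + exyy + eyyy + ew + δ0 * r6 + δ7 * r7 + (δ1 + δ2) * r4 + (δ5 + δ6) * r5 + ε0 * hx3 +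
    ε1 * hy3

theorem co_x (t : Param) : co t 1 (xA t.1) = 1 ∧ ∀ i, i ≠ 1 → co t i (xA t.1) = 0 := by
  have ex : xA t.1 = xA t.1 * 1 := (mul_one _).symm
  rw [ex]
  refine ⟨by simp [co_x_mul, co_one, -mul_one], fun i hi => ?_⟩
  fin_cases i
  all_goals first
    | exact absurd rfl hi
    | simp [co_x_mul, co_one, -mul_one]

theorem co_y (t : Param) : co t 2 (yA t.1) = 1 ∧ ∀ i, i ≠ 2 → co t i (yA t.1) = 0 := by
  have ex : yA t.1 = yA t.1 * 1 := (mul_one _).symm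
  rw [ex]
  refine ⟨by simp [co_y_mul, co_one, -mul_one], fun i hi => ?_⟩
  fin_cases i
  all_goals first
    | exact absurd rfl hi
    | simp [co_y_mul, co_one, -mul_one]

theorem co_z (t : Param) : co t 3 (zA t.1) = 1 ∧ ∀ i, i ≠ 3 → co t i (zA t.1) = 0 := by
  have ex : zA t.1 = zA t.1 * 1 := (mul_one _).symm
  rw [ex]
  exact ⟨by simp [co_z_mul, co_one, -mul_one], fun i hi => (co_z_mul t 1).2 i hi⟩

/-- Applying the twelve functionals to some expansion returns its coefficients; in particular the
monomials form a basis. -/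
theorem expansion (t : Param) (α : A 1 t.1) :
    α = co t 0 α • 1 + co t 1 α • xA t.1 + co t 2 α • yA t.1 + co t 3 α • zA t.1 +
      co t 4 α • (xA t.1 * xA t.1) + co t 5 α • (xA t.1 * yA t.1) + co t 6 α • (yA t.1 * yA t.1) +
      co t 7 α • (xA t.1 * (xA t.1 * xA t.1)) + co t 8 α • (xA t.1 * (xA t.1 * yA t.1)) +
      co t 9 α • (xA t.1 * (yA t.1 * yA t.1)) + co t 10 α • (yA t.1 * (yA t.1 * yA t.1)) +
      co t 11 α • (xA t.1 * (xA t.1 * (yA t.1 * yA t.1))) := by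
  obtain ⟨c, h⟩ := exists_expansion t α
  have key : ∀ i, co t i α = c i := by
    intro i
    rw [h]
    simp only [map_add, map_smul, smul_eq_mul]
    fin_cases i <;> simp [co_x_mul, co_y_mul, co_x, co_y, co_z, co_one]
  simp only [key]
  exact h

theorem co_ext (t : Param) {α β : A 1 t.1} (h : ∀ i, co t i α = co t i β) : α = β := by
  rw [expansion t α, expansion t β]
  simp only [h]

theorem co_add (t : Param) (i : Fin 12) (α β : A 1 t.1) : co t i (α + β) = co t i α + co t i β :=
  map_add _ _ _

theorem co_smul (t : Param) (i : Fin 12) (c : ℂ) (α : A 1 t.1) : co t i (c • α) = c * co t i α :=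
  map_smul _ _ _

theorem co_zero (t : Param) (i : Fin 12) : co t i 0 = 0 := map_zero _

theorem co_ext12 (t : Param) {α β : A 1 t.1} (h0 : co t 0 α = co t 0 β) (h1 : co t 1 α = co t 1 β)
    (h2 : co t 2 α = co t 2 β) (h3 : co t 3 α = co t 3 β) (h4 : co t 4 α = co t 4 β)
    (h5 : co t 5 α = co t 5 β) (h6 : co t 6 α = co t 6 β) (h7 : co t 7 α = co t 7 β)
    (h8 : co t 8 α = co t 8 β) (h9 : co t 9 α = co t 9 β) (h10 : co t 10 α = co t 10 β)
    (h11 : co t 11 α = co t 11 β) : α = β :=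
  co_ext t fun i => by fin_cases i <;> assumption

theorem der_mul {t : ℂ} (δ : L1 t) (α β : A 1 t) : δ (α * β) = α * δ β + β * δ α := δ.leibniz α β

theorem der_smul {t : ℂ} (δ : L1 t) (c : ℂ) (α : A 1 t) : δ (c • α) = c • δ α := δ.map_smul c α

theorem der_one {t : ℂ} (δ : L1 t) : δ 1 = 0 := δ.map_one_eq_zero

theorem der_add {t : ℂ} (δ : L1 t) (α β : A 1 t) : δ (α + β) = δ α + δ β := map_add δ α β

/-- The products are nested to the right so that `co_x_mul` and `co_y_mul` evaluate every coordinate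
by rewriting. -/
theorem der_expansion (t : Param) (δ : L1 t.1) (α : A 1 t.1) :
    δ α = co t 1 α • δ (xA t.1) + co t 2 α • δ (yA t.1) + co t 3 α • δ (zA t.1) +
      co t 4 α • (xA t.1 * δ (xA t.1) + xA t.1 * δ (xA t.1)) +
      co t 5 α • (xA t.1 * δ (yA t.1) + yA t.1 * δ (xA t.1)) +
      co t 6 α • (yA t.1 * δ (yA t.1) + yA t.1 * δ (yA t.1)) +
      co t 7 α • (xA t.1 * (xA t.1 * δ (xA t.1)) + xA t.1 * (xA t.1 * δ (xA t.1)) +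
        xA t.1 * (xA t.1 * δ (xA t.1))) +
      co t 8 α • (xA t.1 * (xA t.1 * δ (yA t.1)) + xA t.1 * (yA t.1 * δ (xA t.1)) +
        xA t.1 * (yA t.1 * δ (xA t.1))) +
      co t 9 α • (yA t.1 * (yA t.1 * δ (xA t.1)) + xA t.1 * (yA t.1 * δ (yA t.1)) +
        xA t.1 * (yA t.1 * δ (yA t.1))) +
      co t 10 α • (yA t.1 * (yA t.1 * δ (yA t.1)) + yA t.1 * (yA t.1 * δ (yA t.1)) +
        yA t.1 * (yA t.1 * δ (yA t.1))) +
      co t 11 α • (xA t.1 * (xA t.1 * (yA t.1 * δ (yA t.1))) +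
        xA t.1 * (xA t.1 * (yA t.1 * δ (yA t.1))) + xA t.1 * (yA t.1 * (yA t.1 * δ (xA t.1))) +
        xA t.1 * (yA t.1 * (yA t.1 * δ (xA t.1)))) := by
  conv_lhs => rw [expansion t α]
  simp only [der_add, der_smul, der_mul, der_one]
  simp only [smul_eq_mul_A]
  ring

theorem L1_ext (t : Param) {δ ε : L1 t.1} (hx : δ (xA t.1) = ε (xA t.1))
    (hy : δ (yA t.1) = ε (yA t.1)) (hz : δ (zA t.1) = ε (zA t.1)) : δ = ε := by
  ext1 α
  rw [der_expansion t δ, der_expansion t ε, hx, hy, hz]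

section
variable (t : Param) (δ : L1 t.1) (α : A 1 t.1)

/-- The coordinates of `δ α` in terms of those of `δ x`, `δ y`, `δ z`. -/
theorem co_der (i : Fin 12) : co t i (δ α) =
    co t 1 α * co t i (δ (xA t.1)) + co t 2 α * co t i (δ (yA t.1)) +
      co t 3 α * co t i (δ (zA t.1)) + co t 4 α * (2 * co t i (xA t.1 * δ (xA t.1))) +
      co t 5 α * (co t i (xA t.1 * δ (yA t.1)) + co t i (yA t.1 * δ (xA t.1))) +
      co t 6 α * (2 * co t i (yA t.1 * δ (yA t.1))) +
      co t 7 α * (3 * co t i (xA t.1 * (xA t.1 * δ (xA t.1)))) +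
      co t 8 α * (co t i (xA t.1 * (xA t.1 * δ (yA t.1))) +
        2 * co t i (xA t.1 * (yA t.1 * δ (xA t.1)))) +
      co t 9 α * (co t i (yA t.1 * (yA t.1 * δ (xA t.1))) +
        2 * co t i (xA t.1 * (yA t.1 * δ (yA t.1)))) +
      co t 10 α * (3 * co t i (yA t.1 * (yA t.1 * δ (yA t.1)))) +
      co t 11 α * (2 * co t i (xA t.1 * (xA t.1 * (yA t.1 * δ (yA t.1)))) +
        2 * co t i (xA t.1 * (yA t.1 * (yA t.1 * δ (xA t.1))))) := by
  rw [der_expansion t δ α]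
  simp only [map_add, map_smul, smul_eq_mul]
  ring

end

/-! ### Derivations of the first moduli algebra in coordinates -/

/-- The conditions on the images of `x, y, z` under a derivation of the first moduli algebra. -/
structure NF (t : Param) (p q r : A 1 t.1) : Prop where
  p0 : co t 0 p = 0
  p2 : co t 2 p = 0
  q0 : co t 0 q = 0
  q1 : co t 1 q = 0
  pq : co t 2 q = co t 1 p
  r0 : co t 0 r = 0
  r1 : co t 1 r = 0
  r2 : co t 2 r = 0
  r4 : co t 4 r = 0
  r5 : co t 5 r = 0
  r6 : co t 6 r = 0
  r9 : co t 9 r = t.1 / 2 * co t 7 r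
  r8 : co t 8 r = t.1 / 2 * co t 10 r

/-- Obtained by differentiating the relations of the algebra. The hypothesis on t leaves only the
Euler field and z∂_z in degree zero; with `exists_der` the conditions characterise derivations. -/
theorem nf_der {t : Param} (ht : NonJump t) (δ : L1 t.1) :
    NF t (δ (xA t.1)) (δ (yA t.1)) (δ (zA t.1)) := by
  obtain ⟨e1, e2, -, e4, e5, e6, e7⟩ := relations t
  have h0 := ht.1
  have h36 := sq_ne_36 ht
  have d1 := congrArg δ e1
  have d2 := congrArg δ e2
  have d4 := congrArg δ e4
  have d5 := congrArg δ e5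
  have d6 := congrArg δ (e6.trans (e7.symm))
  simp only [pow_succ, pow_zero, one_mul, mul_assoc, der_mul, map_zero] at d1 d2 d4 d5 d6
  have c1 := fun i => congrArg (co t i) d1
  have c2 := fun i => congrArg (co t i) d2
  have c4 := congrArg (co t 11) d4
  have c5 := congrArg (co t 11) d5
  have c6 := congrArg (co t 11) d6
  simp only [mul_add, map_add, map_zero, co_x_mul, co_y_mul] at c1 c2 c4 c5 c6
  have a3 := c1 3
  have a1 := c1 1
  have a4 := c1 4
  have a5 := c1 5
  have a7 := c1 7
  have a8 := c1 8
  have a9 := c1 9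
  have a11 := c1 11
  have b3 := c2 3
  have b11 := c2 11
  simp [co_x_mul, co_y_mul, co_z_mul] at a3 a1 a4 a5 a7 a8 a9 a11 b3 b11
  -- For p the coefficient of y in δx and q that of x in δy, the relations x³y = 0 and xy³ = 0 give
  -- 3p = (t/2)q and 3q = (t/2)p. This system is singular only for t² = 36.
  have k : co t 1 (δ (yA t.1)) * (t.1 ^ 2 - 36) = 0 := by
    linear_combination (-2 * t.1) * c4 - 12 * c5
  have k1 : co t 1 (δ (yA t.1)) = 0 := by
    rcases mul_eq_zero.1 k with h | h
    · exact h
    · exact absurd (sub_eq_zero.1 h) h36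
  exact ⟨a3, by linear_combination (1 / 3 : ℂ) * c4 + t.1 / 6 * k1, b3, k1,
    mul_left_cancel₀ h0 (by linear_combination (1 / 2 : ℂ) * c6), a1, a4, a5, a7, a8, a9,
    sub_eq_zero.1 a11, sub_eq_zero.1 b11⟩

/-- Lift p, q, r to a vector field on power series. The conditions say that it maps the seven
generators into the ideal, so it descends to the quotient. -/
theorem exists_der {t : Param} {p q r : A 1 t.1} (h : NF t p q r) :
    ∃ δ : L1 t.1, δ (xA t.1) = p ∧ δ (yA t.1) = q ∧ δ (zA t.1) = r := by
  have k1 : zA t.1 * p + xA t.1 * r = 0 := by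
    apply co_ext12 t <;> simp [co_add, co_x_mul, co_z_mul, h.p0, h.r0, h.r1, h.r2, h.r4, h.r5, h.r6,
      h.r9, -map_add]
  have k2 : zA t.1 * q + yA t.1 * r = 0 := by
    apply co_ext12 t <;> simp [co_add, co_y_mul, co_z_mul, h.q0, h.r0, h.r1, h.r2, h.r4, h.r5, h.r6,
      h.r8, -map_add]
  have k3 : zA t.1 * r + zA t.1 * r = 0 := by
    apply co_ext12 t <;> simp [co_add, co_z_mul, h.r0, -map_add]
  have k4 : xA t.1 * (xA t.1 * (xA t.1 * q)) + (xA t.1 * (xA t.1 * (yA t.1 * p)) +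
      xA t.1 * (xA t.1 * (yA t.1 * p)) + xA t.1 * (xA t.1 * (yA t.1 * p))) = 0 := by
    apply co_ext12 t <;> simp only [co_add, co_x_mul, co_y_mul, co_zero, h.p0, h.q0, h.p2, h.q1] <;>
      ring
  have k5 : yA t.1 * (yA t.1 * (yA t.1 * p)) + (xA t.1 * (yA t.1 * (yA t.1 * q)) +
      xA t.1 * (yA t.1 * (yA t.1 * q)) + xA t.1 * (yA t.1 * (yA t.1 * q))) = 0 := by
    apply co_ext12 t <;> simp only [co_add, co_x_mul, co_y_mul, co_zero, h.p0, h.q0, h.p2, h.q1] <;>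
      ring
  have k6 : (4 : ℂ) • (xA t.1 * (xA t.1 * (xA t.1 * p))) + t.1 • (xA t.1 * (yA t.1 * (yA t.1 * p)) +
      xA t.1 * (xA t.1 * (yA t.1 * q))) = 0 := by
    apply co_ext12 t <;>
      simp only [co_add, co_smul, co_x_mul, co_y_mul, co_zero, h.p0, h.q0, h.pq] <;> ring
  have k7 : (4 : ℂ) • (yA t.1 * (yA t.1 * (yA t.1 * q))) + t.1 • (xA t.1 * (yA t.1 * (yA t.1 * p)) +
      xA t.1 * (xA t.1 * (yA t.1 * q))) = 0 := by
    apply co_ext12 t <;>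
      simp only [co_add, co_smul, co_x_mul, co_y_mul, co_zero, h.p0, h.q0, h.pq] <;> ring
  obtain ⟨P, hP⟩ : ∃ P : Fin 3 → O, cl t.1 (P 0) = p ∧ cl t.1 (P 1) = q ∧ cl t.1 (P 2) = r := by
    obtain ⟨p', hp⟩ := clHom_surjective t.1 p
    obtain ⟨q', hq⟩ := clHom_surjective t.1 q
    obtain ⟨r', hr⟩ := clHom_surjective t.1 r
    exact ⟨![p', q', r'], hp, hq, hr⟩
  obtain ⟨hp, hq, hr⟩ := hP
  have D_mul : ∀ f g : O, cl t.1 (vf P (f * g)) =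
      cl t.1 f * cl t.1 (vf P g) + cl t.1 g * cl t.1 (vf P f) := by
    intro f g
    rw [Derivation.leibniz, cl_add, smul_eq_mul, smul_eq_mul, cl_mul, cl_mul]
  have D_C : ∀ c : ℂ, cl t.1 (vf P (C c)) = 0 := by
    intro c
    have : vf P (C c) = 0 := (vf P).map_algebraMap c
    rw [this]
    exact map_zero (clHom t.1)
  have ex : cl t.1 (X 0) = xA t.1 := rfl
  have ey : cl t.1 (X 1) = yA t.1 := rfl
  have ez : cl t.1 (X 2) = zA t.1 := rfl
  have D_gen : ∀ g ∈ gens t.1, cl t.1 (vf P g) = 0 := by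
    simp only [smul_eq_mul_A] at k6 k7
    have two : algebraMap ℂ (A 1 t.1) 2 = 2 := map_ofNat _ 2
    have four : algebraMap ℂ (A 1 t.1) 4 = 4 := map_ofNat _ 4
    rw [four] at k6 k7
    rintro _ (rfl | rfl | rfl | rfl | rfl | rfl | rfl) <;>
      simp only [mon, pow_succ, pow_zero, one_mul, mul_one, map_add, cl_add, D_mul, D_C, cl_mul,
        vf_X, hp, hq, hr, ex, ey, ez, cl_C, two]
    · linear_combination k1
    · linear_combination k2
    · linear_combination k3
    · linear_combination k4
    · linear_combination k5
    · linear_combination 2 * k6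
    · linear_combination 2 * k7
  have key : ∀ f, clHom t.1 f = 0 → clHom t.1 (vf P f) = 0 := by
    intro f hf
    have hf' : f ∈ I 1 t.1 := cl_eq_zero_iff.1 hf
    rw [I_one_eq t.2] at hf'
    clear hf
    change cl t.1 (vf P f) = 0
    induction hf' using Submodule.span_induction with
    | mem g hg => exact D_gen g hg
    | zero => rw [map_zero]; exact map_zero (clHom t.1)
    | add f g _ _ ihf ihg =>
      rw [map_add, cl_add, ihf, ihg, add_zero]
    | smul g f hf ihf =>
      change f ∈ Ideal.span _ at hf
      rw [← I_one_eq t.2] at hf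
      have h0 := cl_eq_zero_iff.2 hf
      rw [smul_eq_mul, D_mul, ihf, h0, mul_zero, zero_mul, add_zero]
  refine ⟨Derivation.liftOfSurjective (clHom_surjective t.1) key, ?_, ?_, ?_⟩
  · exact (Derivation.liftOfSurjective_apply (clHom_surjective t.1) key (X 0)).trans
      ((congrArg (clHom t.1) (vf_X P 0)).trans hp)
  · exact (Derivation.liftOfSurjective_apply (clHom_surjective t.1) key (X 1)).trans
      ((congrArg (clHom t.1) (vf_X P 1)).trans hq)
  · exact (Derivation.liftOfSurjective_apply (clHom_surjective t.1) key (X 2)).trans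
      ((congrArg (clHom t.1) (vf_X P 2)).trans hr)

set_option linter.unusedSimpArgs false

/-! ### The graded pieces of the first Yau algebra -/

/-- The derivation has no part of degree zero, and its part of degree one is
`∑ (u i z ∂_i + v i f_i ∂_z)` plus a quadratic vector field with the coordinates `g, m, n`. -/
structure Deg1 (t : Param) (δ : L1 t.1) (u v g m n : Fin 2 → ℂ) : Prop where
  x0 : co t 0 (δ (xA t.1)) = 0
  x1 : co t 1 (δ (xA t.1)) = 0
  x2 : co t 2 (δ (xA t.1)) = 0
  y0 : co t 0 (δ (yA t.1)) = 0
  y1 : co t 1 (δ (yA t.1)) = 0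
  y2 : co t 2 (δ (yA t.1)) = 0
  z0 : co t 0 (δ (zA t.1)) = 0
  z1 : co t 1 (δ (zA t.1)) = 0
  z2 : co t 2 (δ (zA t.1)) = 0
  z3 : co t 3 (δ (zA t.1)) = 0
  z4 : co t 4 (δ (zA t.1)) = 0
  z5 : co t 5 (δ (zA t.1)) = 0
  z6 : co t 6 (δ (zA t.1)) = 0
  x3 : co t 3 (δ (xA t.1)) = u 0
  y3 : co t 3 (δ (yA t.1)) = u 1
  z7 : co t 7 (δ (zA t.1)) = 4 * v 0
  z9 : co t 9 (δ (zA t.1)) = 2 * t.1 * v 0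
  z10 : co t 10 (δ (zA t.1)) = 4 * v 1
  z8 : co t 8 (δ (zA t.1)) = 2 * t.1 * v 1
  x5 : co t 5 (δ (xA t.1)) = g 0 + 4 * t.1 * m 0 + 2 * (t.1 ^ 2 - 12) * n 0
  y4 : co t 4 (δ (yA t.1)) = -12 * m 0 + 12 * t.1 * n 0
  y6 : co t 6 (δ (yA t.1)) = g 0 - 2 * t.1 * m 0 - (t.1 ^ 2 - 12) * n 0
  y5 : co t 5 (δ (yA t.1)) = -(g 1 + 4 * t.1 * m 1 + 2 * (t.1 ^ 2 - 12) * n 1)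
  x6 : co t 6 (δ (xA t.1)) = -(-12 * m 1 + 12 * t.1 * n 1)
  x4 : co t 4 (δ (xA t.1)) = -(g 1 - 2 * t.1 * m 1 - (t.1 ^ 2 - 12) * n 1)

/-- The derivation has no parts of degree at most one, and its part of degree two is
`∑ (E i j f_i + K i j h_i) ∂_j + w x²y² ∂_z`, where `h` is the Hessian of `f`. -/
structure Deg2 (t : Param) (δ : L1 t.1) (E K : Fin 2 → Fin 2 → ℂ) (w : ℂ) : Prop where
  deg1 : Deg1 t δ 0 0 0 0 0
  x7 : co t 7 (δ (xA t.1)) = 4 * E 0 0 - 4 * t.1 * K 0 0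
  x9 : co t 9 (δ (xA t.1)) = 2 * t.1 * E 0 0 + (t.1 ^ 2 - 12) * K 0 0
  x10 : co t 10 (δ (xA t.1)) = 4 * E 1 0 - 4 * t.1 * K 1 0
  x8 : co t 8 (δ (xA t.1)) = 2 * t.1 * E 1 0 + (t.1 ^ 2 - 12) * K 1 0
  y7 : co t 7 (δ (yA t.1)) = 4 * E 0 1 - 4 * t.1 * K 0 1
  y9 : co t 9 (δ (yA t.1)) = 2 * t.1 * E 0 1 + (t.1 ^ 2 - 12) * K 0 1
  y10 : co t 10 (δ (yA t.1)) = 4 * E 1 1 - 4 * t.1 * K 1 1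
  y8 : co t 8 (δ (yA t.1)) = 2 * t.1 * E 1 1 + (t.1 ^ 2 - 12) * K 1 1
  z11 : co t 11 (δ (zA t.1)) = w

/-- The determinant of this system is a multiple of t² - 4, so g, m, n are coordinates on the
quadratic fields. -/
theorem quad_coords_unique {t : ℂ} (ht : t ^ 2 ≠ 4) {g m n g' m' n' : ℂ}
    (h1 : g + 4 * t * m + 2 * (t ^ 2 - 12) * n = g' + 4 * t * m' + 2 * (t ^ 2 - 12) * n')
    (h2 : -12 * m + 12 * t * n = -12 * m' + 12 * t * n')
    (h3 : g - 2 * t * m - (t ^ 2 - 12) * n = g' - 2 * t * m' - (t ^ 2 - 12) * n') :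
    g = g' ∧ m = m' ∧ n = n' := by
  have hD : t ^ 2 - 4 ≠ 0 := sub_ne_zero.2 ht
  have hn : n = n' := mul_left_cancel₀ hD (by
    linear_combination (1 / 9 : ℂ) * h1 - (1 / 9 : ℂ) * h3 + t / 18 * h2)
  subst hn
  have hm : m = m' := by linear_combination (-1 / 12 : ℂ) * h2
  subst hm
  exact ⟨by linear_combination h3, rfl, rfl⟩

theorem exists_quad_coords {t : ℂ} (ht : t ^ 2 ≠ 4) (a b c : ℂ) : ∃ g m n : ℂ,
    a = g + 4 * t * m + 2 * (t ^ 2 - 12) * n ∧ b = -12 * m + 12 * t * n ∧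
      c = g - 2 * t * m - (t ^ 2 - 12) * n := by
  have hD : t ^ 2 - 4 ≠ 0 := sub_ne_zero.2 ht
  obtain ⟨n, hn⟩ : ∃ n : ℂ, 9 * (t ^ 2 - 4) * n = a - c + t / 2 * b :=
    ⟨(a - c + t / 2 * b) / (9 * (t ^ 2 - 4)), by field_simp⟩
  refine ⟨c + 2 * t * (t * n - b / 12) + (t ^ 2 - 12) * n, t * n - b / 12, n, ?_, ?_, ?_⟩
  · linear_combination -hn
  · ring
  · ring

/-- The corresponding partials of the quartic and of its Hessian are linearly independent when t² ≠
4. -/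
theorem cubic_coords_unique {t : ℂ} (ht : t ^ 2 ≠ 4) {e k e' k' : ℂ}
    (h1 : 4 * e - 4 * t * k = 4 * e' - 4 * t * k')
    (h2 : 2 * t * e + (t ^ 2 - 12) * k = 2 * t * e' + (t ^ 2 - 12) * k') : e = e' ∧ k = k' := by
  have hD : t ^ 2 - 4 ≠ 0 := sub_ne_zero.2 ht
  have hk : k = k' := mul_left_cancel₀ hD (by linear_combination (1 / 3 : ℂ) * h2 - t / 6 * h1)
  subst hk
  exact ⟨by linear_combination (1 / 4 : ℂ) * h1, rfl⟩

theorem fin2_ext {α : Type*} {f g : Fin 2 → α} (h0 : f 0 = g 0) (h1 : f 1 = g 1) : f = g :=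
  funext fun i => by fin_cases i <;> assumption

section
variable {t : Param} {δ ε : L1 t.1} {u v g m n u' v' g' m' n' : Fin 2 → ℂ}
  {E K E' K' : Fin 2 → Fin 2 → ℂ} {w w' : ℂ}

theorem Deg1.unique (h : Deg1 t δ u v g m n) (h' : Deg1 t δ u' v' g' m' n') :
    u = u' ∧ v = v' ∧ g = g' ∧ m = m' ∧ n = n' := by
  obtain ⟨e1, e2, e3⟩ := quad_coords_unique t.2 (h.x5.symm.trans h'.x5) (h.y4.symm.trans h'.y4)
    (h.y6.symm.trans h'.y6)
  obtain ⟨f1, f2, f3⟩ := quad_coords_unique t.2 (neg_injective (h.y5.symm.trans h'.y5))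
    (neg_injective (h.x6.symm.trans h'.x6)) (neg_injective (h.x4.symm.trans h'.x4))
  have four : (4 : ℂ) ≠ 0 := by norm_num
  exact ⟨fin2_ext (h.x3.symm.trans h'.x3) (h.y3.symm.trans h'.y3),
    fin2_ext (mul_left_cancel₀ four (h.z7.symm.trans h'.z7))
      (mul_left_cancel₀ four (h.z10.symm.trans h'.z10)),
    fin2_ext e1 f1, fin2_ext e2 f2, fin2_ext e3 f3⟩

theorem Deg2.unique (h : Deg2 t δ E K w) (h' : Deg2 t δ E' K' w') : E = E' ∧ K = K' ∧ w = w' := by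
  obtain ⟨a1, a2⟩ := cubic_coords_unique t.2 (h.x7.symm.trans h'.x7) (h.x9.symm.trans h'.x9)
  obtain ⟨b1, b2⟩ := cubic_coords_unique t.2 (h.x10.symm.trans h'.x10) (h.x8.symm.trans h'.x8)
  obtain ⟨c1, c2⟩ := cubic_coords_unique t.2 (h.y7.symm.trans h'.y7) (h.y9.symm.trans h'.y9)
  obtain ⟨d1, d2⟩ := cubic_coords_unique t.2 (h.y10.symm.trans h'.y10) (h.y8.symm.trans h'.y8)
  exact ⟨fin2_ext (fin2_ext a1 c1) (fin2_ext b1 d1), fin2_ext (fin2_ext a2 c2) (fin2_ext b2 d2),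
    h.z11.symm.trans h'.z11⟩

theorem co_der_add (i : Fin 12) (α : A 1 t.1) :
    co t i ((δ + ε) α) = co t i (δ α) + co t i (ε α) :=
  co_add t i _ _

theorem co_der_smul (i : Fin 12) (c : ℂ) (α : A 1 t.1) : co t i ((c • δ) α) = c * co t i (δ α) :=
  co_smul t i _ _

theorem Deg1.add (h : Deg1 t δ u v g m n) (h' : Deg1 t ε u' v' g' m' n') :
    Deg1 t (δ + ε) (u + u') (v + v') (g + g') (m + m') (n + n') := by
  constructor <;> rw [co_der_add] <;>
    simp only [h.x0, h.x1, h.x2, h.y0, h.y1, h.y2, h.z0, h.z1, h.z2, h.z3, h.z4, h.z5,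
      h.z6, h'.x0, h'.x1, h'.x2, h'.y0, h'.y1, h'.y2, h'.z0, h'.z1, h'.z2, h'.z3, h'.z4, h'.z5, h'.z6,
      h.x3, h.y3, h.z7, h.z8, h.z9, h.z10, h.x4, h.x5, h.x6, h.y4, h.y5, h.y6,
      h'.x3, h'.y3, h'.z7, h'.z8, h'.z9, h'.z10, h'.x4, h'.x5, h'.x6, h'.y4, h'.y5, h'.y6,
      Pi.add_apply] <;> ring

theorem Deg1.smul (h : Deg1 t δ u v g m n) (c : ℂ) :
    Deg1 t (c • δ) (c • u) (c • v) (c • g) (c • m) (c • n) := by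
  constructor <;> rw [co_der_smul] <;>
    simp only [h.x0, h.x1, h.x2, h.y0, h.y1, h.y2, h.z0, h.z1, h.z2, h.z3, h.z4, h.z5,
      h.z6, h.x3, h.y3, h.z7, h.z8, h.z9, h.z10, h.x4, h.x5, h.x6, h.y4, h.y5, h.y6,
      Pi.smul_apply, smul_eq_mul] <;> ring

theorem Deg2.add (h : Deg2 t δ E K w) (h' : Deg2 t ε E' K' w') :
    Deg2 t (δ + ε) (E + E') (K + K') (w + w') := by
  refine ⟨by simpa using h.deg1.add h'.deg1, ?_, ?_, ?_, ?_, ?_, ?_, ?_, ?_, ?_⟩ <;>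
    rw [co_der_add] <;>
    simp only [h.x7, h.x8, h.x9, h.x10, h.y7, h.y8, h.y9, h.y10, h.z11, h'.x7, h'.x8, h'.x9, h'.x10,
      h'.y7, h'.y8, h'.y9, h'.y10, h'.z11, Pi.add_apply] <;> ring

theorem Deg2.smul (h : Deg2 t δ E K w) (c : ℂ) : Deg2 t (c • δ) (c • E) (c • K) (c * w) := by
  refine ⟨by simpa using h.deg1.smul c, ?_, ?_, ?_, ?_, ?_, ?_, ?_, ?_, ?_⟩ <;>
    rw [co_der_smul] <;>
    simp only [h.x7, h.x8, h.x9, h.x10, h.y7, h.y8, h.y9, h.y10, h.z11, Pi.smul_apply,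
      smul_eq_mul] <;> ring

theorem exists_deg1 (ht : NonJump t) (hx : co t 1 (δ (xA t.1)) = 0) (hz : co t 3 (δ (zA t.1)) = 0) :
    ∃ u v g m n, Deg1 t δ u v g m n := by
  obtain ⟨p0, p2, q0, q1, pq, r0, r1, r2, r4, r5, r6, r9, r8⟩ := nf_der ht δ
  obtain ⟨g0, m0, n0, e1, e2, e3⟩ := exists_quad_coords t.2 (co t 5 (δ (xA t.1)))
    (co t 4 (δ (yA t.1))) (co t 6 (δ (yA t.1)))
  obtain ⟨g1, m1, n1, f1, f2, f3⟩ := exists_quad_coords t.2 (-co t 5 (δ (yA t.1)))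
    (-co t 6 (δ (xA t.1))) (-co t 4 (δ (xA t.1)))
  refine ⟨![co t 3 (δ (xA t.1)), co t 3 (δ (yA t.1))],
    ![co t 7 (δ (zA t.1)) / 4, co t 10 (δ (zA t.1)) / 4], ![g0, g1], ![m0, m1], ![n0, n1],
    p0, hx, p2, q0, q1, pq.trans hx, r0, r1, r2, hz, r4, r5, r6, rfl, rfl, ?_, ?_, ?_, ?_, e1, e2, e3,
    by rw [← neg_eq_iff_eq_neg]; exact f1, by rw [← neg_eq_iff_eq_neg]; exact f2,
    by rw [← neg_eq_iff_eq_neg]; exact f3⟩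
  · simp only [Matrix.cons_val_zero]; ring
  · simp only [Matrix.cons_val_zero]; rw [r9]; ring
  · simp only [Matrix.cons_val_one, Matrix.cons_val_fin_one]; ring
  · simp only [Matrix.cons_val_one, Matrix.cons_val_fin_one]; rw [r8]; ring

theorem co_bracket (i : Fin 12) (α : A 1 t.1) :
    co t i (⁅δ, ε⁆ α) = co t i (δ (ε α)) - co t i (ε (δ α)) := by
  rw [Derivation.commutator_apply]
  exact map_sub _ _ _

/-- The structure constants from degree one to degree two. Only the parts of degree one of the two
factors enter; all later arguments use special cases of this formula. -/
theorem Deg1.bracket (h : Deg1 t δ u v g m n) (h' : Deg1 t ε u' v' g' m' n') :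
    Deg2 t ⁅δ, ε⁆
      ![![3 * (g 0 * m' 0 - g' 0 * m 0) + (72 - 6 * t.1 ^ 2) * (m 0 * n' 0 - m' 0 * n 0) +
            72 * t.1 * (m 1 * n' 1 - m' 1 * n 1) - (u 0 * v' 0 - u' 0 * v 0),
          3 * (g 1 * m' 0 - g' 1 * m 0) - 144 * (m 0 * n' 1 - m' 0 * n 1) +
            12 * t.1 ^ 2 * (m 1 * n' 0 - m' 1 * n 0) -
            (6 * t.1 ^ 3 - 216 * t.1) * (n 0 * n' 1 - n 1 * n' 0) - (u 1 * v' 0 - u' 1 * v 0)],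
        ![3 * (g 0 * m' 1 - g' 0 * m 1) + 12 * t.1 ^ 2 * (m 0 * n' 1 - m' 0 * n 1) -
            144 * (m 1 * n' 0 - m' 1 * n 0) +
            (6 * t.1 ^ 3 - 216 * t.1) * (n 0 * n' 1 - n 1 * n' 0) - (u 0 * v' 1 - u' 0 * v 1),
          3 * (g 1 * m' 1 - g' 1 * m 1) + 72 * t.1 * (m 0 * n' 0 - m' 0 * n 0) +
            (72 - 6 * t.1 ^ 2) * (m 1 * n' 1 - m' 1 * n 1) - (u 1 * v' 1 - u' 1 * v 1)]]
      ![![3 * (g 0 * n' 0 - g' 0 * n 0) + 12 * t.1 * (m 0 * n' 0 - m' 0 * n 0) +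
            72 * (m 1 * n' 1 - m' 1 * n 1),
          3 * (g 1 * n' 0 - g' 1 * n 0) - 12 * t.1 * (m 0 * n' 1 - m' 0 * n 1) -
            12 * t.1 * (m 1 * n' 0 - m' 1 * n 0) - 24 * (m 0 * m' 1 - m 1 * m' 0) +
            6 * (t.1 ^ 2 + 12) * (n 0 * n' 1 - n 1 * n' 0)],
        ![3 * (g 0 * n' 1 - g' 0 * n 1) - 12 * t.1 * (m 0 * n' 1 - m' 0 * n 1) -
            12 * t.1 * (m 1 * n' 0 - m' 1 * n 0) + 24 * (m 0 * m' 1 - m 1 * m' 0) -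
            6 * (t.1 ^ 2 + 12) * (n 0 * n' 1 - n 1 * n' 0),
          3 * (g 1 * n' 1 - g' 1 * n 1) + 72 * (m 0 * n' 0 - m' 0 * n 0) +
            12 * t.1 * (m 1 * n' 1 - m' 1 * n 1)]]
      (36 * (t.1 ^ 2 - 4) * (m 0 * v' 1 - m 1 * v' 0 - (m' 0 * v 1 - m' 1 * v 0))) := by
  have deg1 : Deg1 t ⁅δ, ε⁆ 0 0 0 0 0 := by
    constructor <;> rw [co_bracket] <;> rw [co_der t δ (ε _), co_der t ε (δ _)] <;>
      simp only [co_x_mul, co_y_mul, h.x0, h.x1, h.x2, h.y0, h.y1, h.y2, h.z0, h.z1, h.z2, h.z3, h.z4, h.z5,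
        h.z6, h'.x0, h'.x1, h'.x2, h'.y0, h'.y1, h'.y2, h'.z0, h'.z1, h'.z2, h'.z3, h'.z4, h'.z5, h'.z6,
        h.z7, h.z8, h.z9, h.z10, h'.z7, h'.z8, h'.z9, h'.z10,
        Pi.zero_apply] <;> ring
  refine ⟨deg1, ?_, ?_, ?_, ?_, ?_, ?_, ?_, ?_, ?_⟩ <;> rw [co_bracket] <;>
    rw [co_der t δ (ε _), co_der t ε (δ _)] <;>
    simp only [co_x_mul, co_y_mul, h.x0, h.x1, h.x2, h.y0, h.y1, h.y2, h.z0, h.z1, h.z2, h.z3, h.z4, h.z5,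
      h.z6, h'.x0, h'.x1, h'.x2, h'.y0, h'.y1, h'.y2, h'.z0, h'.z1, h'.z2, h'.z3, h'.z4, h'.z5, h'.z6,
      h.x3, h.y3, h.z7, h.z8, h.z9, h.z10, h.x4, h.x5, h.x6, h.y4, h.y5, h.y6,
      h'.x3, h'.y3, h'.z7, h'.z8, h'.z9, h'.z10, h'.x4, h'.x5, h'.x6, h'.y4, h'.y5, h'.y6,
      Matrix.cons_val_zero, Matrix.cons_val_one, Matrix.cons_val_fin_one] <;> ring

/-- The derivation has only a part of degree three. -/
def Deg3 (t : Param) (δ : L1 t.1) : Prop := Deg2 t δ 0 0 0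

/-- A field without part of degree one has zero coordinates there, so the general formula gives zero
in degree two. -/
theorem Deg1.bracket_deg2 (h : Deg1 t δ u v g m n) (h' : Deg2 t ε E K w) : Deg3 t ⁅δ, ε⁆ := by
  have b := h.bracket h'.deg1
  refine ⟨b.deg1, ?_, ?_, ?_, ?_, ?_, ?_, ?_, ?_, ?_⟩
  · exact b.x7.trans (by simp)
  · exact b.x9.trans (by simp)
  · exact b.x10.trans (by simp)
  · exact b.x8.trans (by simp)
  · exact b.y7.trans (by simp)
  · exact b.y9.trans (by simp)
  · exact b.y10.trans (by simp)
  · exact b.y8.trans (by simp)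
  · exact b.z11.trans (by simp)

theorem Deg3.eq_zero (h : Deg3 t δ) (hx : co t 11 (δ (xA t.1)) = 0)
    (hy : co t 11 (δ (yA t.1)) = 0) : δ = 0 := by
  have h1 := h.deg1
  refine L1_ext t (co_ext12 t ?_ ?_ ?_ ?_ ?_ ?_ ?_ ?_ ?_ ?_ ?_ ?_)
    (co_ext12 t ?_ ?_ ?_ ?_ ?_ ?_ ?_ ?_ ?_ ?_ ?_ ?_) (co_ext12 t ?_ ?_ ?_ ?_ ?_ ?_ ?_ ?_ ?_ ?_ ?_ ?_) <;>
    rw [Derivation.zero_apply, co_zero] <;>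
    simp only [hx, hy, h1.x0, h1.x1, h1.x2, h1.y0, h1.y1, h1.y2, h1.z0, h1.z1, h1.z2, h1.z3, h1.z4, h1.z5,
      h1.z6, h1.x3, h1.y3, h1.z7, h1.z8, h1.z9, h1.z10, h1.x4, h1.x5, h1.x6, h1.y4, h1.y5, h1.y6,
      h.x7, h.x8, h.x9, h.x10, h.y7, h.y8, h.y9, h.y10, h.z11, Pi.zero_apply] <;> ring

/-- The bracket with a derivation of degree three only sees the part of degree zero. -/
theorem bracket_deg3 (ht : NonJump t) (δ : L1 t.1) (h : Deg3 t ε) : Deg3 t ⁅δ, ε⁆ ∧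
    co t 11 (⁅δ, ε⁆ (xA t.1)) = 3 * co t 1 (δ (xA t.1)) * co t 11 (ε (xA t.1)) ∧
    co t 11 (⁅δ, ε⁆ (yA t.1)) = 3 * co t 1 (δ (xA t.1)) * co t 11 (ε (yA t.1)) := by
  have k := nf_der ht δ
  have h1 := h.deg1
  refine ⟨⟨?_, ?_, ?_, ?_, ?_, ?_, ?_, ?_, ?_, ?_⟩, ?_, ?_⟩
  · constructor <;> rw [co_bracket] <;> rw [co_der t δ (ε _), co_der t ε (δ _)] <;>
      simp only [co_x_mul, co_y_mul, h1.x0, h1.x1, h1.x2, h1.y0, h1.y1, h1.y2, h1.z0, h1.z1, h1.z2, h1.z3,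
      h1.z4, h1.z5, h1.z6, h1.x3, h1.y3, h1.z7, h1.z8, h1.z9, h1.z10, h1.x4, h1.x5, h1.x6, h1.y4, h1.y5,
      h1.y6, h.x7, h.x8, h.x9, h.x10, h.y7, h.y8, h.y9, h.y10, h.z11, Pi.zero_apply, k.p0, k.p2, k.q0,
      k.q1, k.r0, k.r1, k.r2, k.r4, k.r5, k.r6, k.pq] <;> ring
  all_goals
    rw [co_bracket, co_der t δ (ε _), co_der t ε (δ _)]
    simp only [co_x_mul, co_y_mul, h1.x0, h1.x1, h1.x2, h1.y0, h1.y1, h1.y2, h1.z0, h1.z1, h1.z2, h1.z3,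
      h1.z4, h1.z5, h1.z6, h1.x3, h1.y3, h1.z7, h1.z8, h1.z9, h1.z10, h1.x4, h1.x5, h1.x6, h1.y4, h1.y5,
      h1.y6, h.x7, h.x8, h.x9, h.x10, h.y7, h.y8, h.y9, h.y10, h.z11, Pi.zero_apply, k.p0, k.p2, k.q0,
      k.q1, k.r0, k.r1, k.r2, k.r4, k.r5, k.r6, k.pq]
    ring

theorem Deg1.bracket_deg3 (h : Deg1 t δ u v g m n) (h' : Deg3 t ε) : ⁅δ, ε⁆ = 0 := by
  have h1 := h'.deg1
  refine (h.bracket_deg2 h').eq_zero ?_ ?_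
  all_goals
    rw [co_bracket, co_der t δ (ε _), co_der t ε (δ _)]
    simp only [co_x_mul, co_y_mul, h1.x0, h1.x1, h1.x2, h1.y0, h1.y1, h1.y2, h1.z0, h1.z1, h1.z2, h1.z3,
      h1.z4, h1.z5, h1.z6, h1.x3, h1.y3, h1.z7, h1.z8, h1.z9, h1.z10, h1.x4, h1.x5, h1.x6, h1.y4, h1.y5,
      h1.y6, h'.x7, h'.x8, h'.x9, h'.x10, h'.y7, h'.y8, h'.y9, h'.y10, h'.z11, Pi.zero_apply,
      h.x0, h.x1, h.x2, h.y0, h.y1, h.y2]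
    ring

/-- The degree zero part is spanned by the commuting fields x∂_x + y∂_y and z∂_z, so brackets have
no part of degree zero. -/
theorem exists_deg1_bracket (ht : NonJump t) (δ ε : L1 t.1) : ∃ u v g m n, Deg1 t ⁅δ, ε⁆ u v g m n := by
  have k := nf_der ht δ
  have k' := nf_der ht ε
  apply exists_deg1 ht
  all_goals
    rw [co_bracket, co_der t δ (ε _), co_der t ε (δ _)]
    simp only [co_x_mul, co_y_mul, k.p0, k.p2, k.q0, k.q1, k.r0, k.r1, k.r2, k.r4, k.r5, k.r6, k.pq,
      k'.p0, k'.p2, k'.q0, k'.q1, k'.r0, k'.r1, k'.r2, k'.r4, k'.r5, k'.r6, k'.pq]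
    ring

/-- If the degree zero part of δ is e(x∂_x + y∂_y) + ζ z∂_z, its eigenvalues on the three kinds of
fields are ζ - e, 3e - ζ and e. -/
theorem bracket_deg1 (ht : NonJump t) (δ : L1 t.1) (h : Deg1 t ε u v g m n) :
    Deg1 t ⁅δ, ε⁆ ((co t 3 (δ (zA t.1)) - co t 1 (δ (xA t.1))) • u)
      ((3 * co t 1 (δ (xA t.1)) - co t 3 (δ (zA t.1))) • v) (co t 1 (δ (xA t.1)) • g)
      (co t 1 (δ (xA t.1)) • m) (co t 1 (δ (xA t.1)) • n) := by
  have k := nf_der ht δ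
  constructor <;> rw [co_bracket] <;> rw [co_der t δ (ε _), co_der t ε (δ _)] <;>
    simp only [co_x_mul, co_y_mul, h.x0, h.x1, h.x2, h.y0, h.y1, h.y2, h.z0, h.z1, h.z2, h.z3, h.z4, h.z5,
      h.z6, h.x3, h.y3, h.z7, h.z8, h.z9, h.z10, h.x4, h.x5, h.x6, h.y4, h.y5, h.y6, Pi.smul_apply,
      smul_eq_mul, k.p0, k.p2, k.q0, k.q1, k.r0, k.r1, k.r2, k.r4, k.r5, k.r6, k.pq, k.r8, k.r9] <;>
    ring

end

/-! ### Derivations with prescribed coordinates. -/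

theorem exists_coords (t : Param) (c : Fin 12 → ℂ) : ∃ α : A 1 t.1, ∀ i, co t i α = c i := by
  refine ⟨c 0 • 1 + c 1 • xA t.1 + c 2 • yA t.1 + c 3 • zA t.1 +
      c 4 • (xA t.1 * xA t.1) + c 5 • (xA t.1 * yA t.1) + c 6 • (yA t.1 * yA t.1) +
      c 7 • (xA t.1 * (xA t.1 * xA t.1)) + c 8 • (xA t.1 * (xA t.1 * yA t.1)) +
      c 9 • (xA t.1 * (yA t.1 * yA t.1)) + c 10 • (yA t.1 * (yA t.1 * yA t.1)) +
      c 11 • (xA t.1 * (xA t.1 * (yA t.1 * yA t.1))), fun i => ?_⟩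
  simp only [co_add, co_smul]
  fin_cases i <;> simp [co_x_mul, co_y_mul, co_x, co_y, co_z, co_one]

/-- The derivation `∑ (u i z ∂_i + v i f_i ∂_z)` plus the quadratic vector field with the
coordinates `g, m, n`. -/
structure Gen (t : Param) (δ : L1 t.1) (u v g m n : Fin 2 → ℂ) : Prop where
  deg1 : Deg1 t δ u v g m n
  x7 : co t 7 (δ (xA t.1)) = 0
  x8 : co t 8 (δ (xA t.1)) = 0
  x9 : co t 9 (δ (xA t.1)) = 0
  x10 : co t 10 (δ (xA t.1)) = 0
  x11 : co t 11 (δ (xA t.1)) = 0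
  y7 : co t 7 (δ (yA t.1)) = 0
  y8 : co t 8 (δ (yA t.1)) = 0
  y9 : co t 9 (δ (yA t.1)) = 0
  y10 : co t 10 (δ (yA t.1)) = 0
  y11 : co t 11 (δ (yA t.1)) = 0
  z11 : co t 11 (δ (zA t.1)) = 0

theorem exists_gen (t : Param) (u v g m n : Fin 2 → ℂ) : ∃ δ, Gen t δ u v g m n := by
  obtain ⟨p, hp⟩ := exists_coords t ![0, 0, 0, u 0, -(g 1 - 2 * t.1 * m 1 - (t.1 ^ 2 - 12) * n 1),
    g 0 + 4 * t.1 * m 0 + 2 * (t.1 ^ 2 - 12) * n 0, -(-12 * m 1 + 12 * t.1 * n 1), 0, 0, 0, 0, 0]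
  obtain ⟨q, hq⟩ := exists_coords t ![0, 0, 0, u 1, -12 * m 0 + 12 * t.1 * n 0,
    -(g 1 + 4 * t.1 * m 1 + 2 * (t.1 ^ 2 - 12) * n 1),
    g 0 - 2 * t.1 * m 0 - (t.1 ^ 2 - 12) * n 0, 0, 0, 0, 0, 0]
  obtain ⟨r, hr⟩ := exists_coords t ![0, 0, 0, 0, 0, 0, 0, 4 * v 0, 2 * t.1 * v 1, 2 * t.1 * v 0,
    4 * v 1, 0]
  have nf : NF t p q r := by
    constructor <;> simp only [hp, hq, hr] <;> first | rfl | skip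
    · change 2 * t.1 * v 0 = t.1 / 2 * (4 * v 0)
      ring
    · change 2 * t.1 * v 1 = t.1 / 2 * (4 * v 1)
      ring
  obtain ⟨δ, ex, ey, ez⟩ := exists_der nf
  refine ⟨δ, ⟨?_, ?_, ?_, ?_, ?_, ?_, ?_, ?_, ?_, ?_, ?_, ?_, ?_, ?_, ?_, ?_, ?_, ?_, ?_, ?_, ?_, ?_, ?_,
    ?_, ?_⟩, ?_, ?_, ?_, ?_, ?_, ?_, ?_, ?_, ?_, ?_, ?_⟩ <;>
    simp only [ex, ey, ez, hp, hq, hr] <;> rfl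

/-- The derivation `e (x ∂_x + y ∂_y) + ζ z ∂_z`. -/
structure DiagDer (t : Param) (δ : L1 t.1) (e ζ : ℂ) : Prop where
  x : δ (xA t.1) = e • xA t.1
  y : δ (yA t.1) = e • yA t.1
  z : δ (zA t.1) = ζ • zA t.1

theorem exists_diagDer (t : Param) (e ζ : ℂ) : ∃ δ, DiagDer t δ e ζ := by
  have nf : NF t (e • xA t.1) (e • yA t.1) (ζ • zA t.1) := by
    constructor <;> simp [co_smul, co_x, co_y, co_z, -map_smul]
  obtain ⟨δ, ex, ey, ez⟩ := exists_der nf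
  exact ⟨δ, ex, ey, ez⟩

section
variable {t : Param} {δ ε : L1 t.1} {u v g m n : Fin 2 → ℂ} {e ζ c : ℂ}

theorem DiagDer.co_x_eq (h : DiagDer t δ e ζ) : co t 1 (δ (xA t.1)) = e := by
  rw [h.x, co_smul, (co_x t).1, mul_one]

/-- An exact identity, not one modulo higher degree, because all coordinates of both fields are
prescribed. -/
theorem Gen.bracket_eq (h : DiagDer t δ e ζ) (k : Gen t ε u v g m n) (hu : (ζ - e) • u = c • u)
    (hv : (3 * e - ζ) • v = c • v) (hg : e • g = c • g) (hm : e • m = c • m) (hn : e • n = c • n) :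
    ⁅δ, ε⁆ = c • ε := by
  have k1 := k.deg1
  have u0 := congrFun hu 0
  have u1 := congrFun hu 1
  have v0 := congrFun hv 0
  have v1 := congrFun hv 1
  have g0 := congrFun hg 0
  have g1 := congrFun hg 1
  have m0 := congrFun hm 0
  have m1 := congrFun hm 1
  have n0 := congrFun hn 0
  have n1 := congrFun hn 1
  simp only [Pi.smul_apply, smul_eq_mul] at u0 u1 v0 v1 g0 g1 m0 m1 n0 n1
  have X : ∀ i, co t i (δ (xA t.1)) = if i = 1 then e else 0 := fun i => by
    rw [h.x, co_smul]
    split_ifs with hi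
    · rw [hi, (co_x t).1, mul_one]
    · rw [(co_x t).2 i hi, mul_zero]
  have Y : ∀ i, co t i (δ (yA t.1)) = if i = 2 then e else 0 := fun i => by
    rw [h.y, co_smul]
    split_ifs with hi
    · rw [hi, (co_y t).1, mul_one]
    · rw [(co_y t).2 i hi, mul_zero]
  have Z : ∀ i, co t i (δ (zA t.1)) = if i = 3 then ζ else 0 := fun i => by
    rw [h.z, co_smul]
    split_ifs with hi
    · rw [hi, (co_z t).1, mul_one]
    · rw [(co_z t).2 i hi, mul_zero]
  refine L1_ext t (co_ext12 t ?_ ?_ ?_ ?_ ?_ ?_ ?_ ?_ ?_ ?_ ?_ ?_)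
    (co_ext12 t ?_ ?_ ?_ ?_ ?_ ?_ ?_ ?_ ?_ ?_ ?_ ?_) (co_ext12 t ?_ ?_ ?_ ?_ ?_ ?_ ?_ ?_ ?_ ?_ ?_ ?_) <;>
    rw [co_der_smul, co_bracket, co_der t δ (ε _), co_der t ε (δ _)] <;>
    simp only [co_x_mul, co_y_mul, X, Y, Z, k1.x0, k1.x1, k1.x2, k1.y0, k1.y1, k1.y2, k1.z0, k1.z1,
      k1.z2, k1.z3,
      k1.z4, k1.z5, k1.z6, k1.x3, k1.y3, k1.z7, k1.z8, k1.z9, k1.z10, k1.x4, k1.x5, k1.x6, k1.y4, k1.y5,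
      k1.y6, k.x7, k.x8, k.x9, k.x10, k.x11, k.y7, k.y8, k.y9, k.y10, k.y11, k.z11, Fin.reduceEq,
      if_true, if_false]
  all_goals try ring1
  · linear_combination u0
  · linear_combination -(g1 - 2 * t.1 * m1 - (t.1 ^ 2 - 12) * n1)
  · linear_combination g0 + 4 * t.1 * m0 + 2 * (t.1 ^ 2 - 12) * n0
  · linear_combination -(-12 * m1 + 12 * t.1 * n1)
  · linear_combination u1
  · linear_combination -12 * m0 + 12 * t.1 * n0
  · linear_combination -(g1 + 4 * t.1 * m1 + 2 * (t.1 ^ 2 - 12) * n1)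
  · linear_combination g0 - 2 * t.1 * m0 - (t.1 ^ 2 - 12) * n0
  · linear_combination 4 * v0
  · linear_combination 2 * t.1 * v1
  · linear_combination 2 * t.1 * v0
  · linear_combination 4 * v1

/-- The part of degree three of a bracket. -/
theorem Deg1.co_bracket_deg2 {w : ℂ} (h : Deg1 t δ u 0 0 0 0) (k : Deg2 t ε 0 0 w) :
    co t 11 (⁅δ, ε⁆ (xA t.1)) = -(u 0 * w) ∧ co t 11 (⁅δ, ε⁆ (yA t.1)) = -(u 1 * w) := by
  have k1 := k.deg1
  constructor <;> rw [co_bracket, co_der t δ (ε _), co_der t ε (δ _)] <;>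
    simp only [co_x_mul, co_y_mul, h.x0, h.x1, h.x2, h.y0, h.y1, h.y2, h.z0, h.z1, h.z2, h.z3, h.z4, h.z5,
      h.z6, h.x3, h.y3, h.z7, h.z8, h.z9, h.z10, h.x4, h.x5, h.x6, h.y4, h.y5, h.y6, k1.x0, k1.x1, k1.x2,
      k1.y0, k1.y1, k1.y2, k1.z0, k1.z1, k1.z2, k1.z3,
      k1.z4, k1.z5, k1.z6, k1.x3, k1.y3, k1.z7, k1.z8, k1.z9, k1.z10, k1.x4, k1.x5, k1.x6, k1.y4, k1.y5,
      k1.y6, k.x7, k.x8, k.x9, k.x10, k.y7, k.y8, k.y9, k.y10, k.z11, Pi.zero_apply] <;>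
    ring

end

/-! ### Isomorphisms of first Yau algebras and the filtration by degree -/

/-- The standard antisymmetric form. -/
def symp : Fin 2 → Fin 2 → ℂ := ![![0, -1], ![1, 0]]

theorem fin22_ext {E E' : Fin 2 → Fin 2 → ℂ} (h00 : E 0 0 = E' 0 0) (h01 : E 0 1 = E' 0 1)
    (h10 : E 1 0 = E' 1 0) (h11 : E 1 1 = E' 1 1) : E = E' :=
  fin2_ext (fin2_ext h00 h01) (fin2_ext h10 h11)

section
variable {t : Param} {δ ε : L1 t.1} {u v g m n u' v' g' m' n' : Fin 2 → ℂ}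
  {E K E' K' : Fin 2 → Fin 2 → ℂ} {w w' : ℂ}

theorem Deg2.congr (h : Deg2 t δ E K w) (hE : E = E') (hK : K = K') (hw : w = w') :
    Deg2 t δ E' K' w' := by subst hE hK hw; exact h

theorem Deg2.sub (h : Deg2 t δ E K w) (h' : Deg2 t ε E' K' w') :
    Deg2 t (δ - ε) (E - E') (K - K') (w - w') := by
  have e : δ - ε = δ + (-1 : ℂ) • ε := by
    ext1 α
    change δ α - ε α = δ α + (-1 : ℂ) • ε α
    rw [smul_eq_mul_A, map_neg, map_one]
    ring
  have := h.add (h'.smul (-1))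
  rw [e]
  exact this.congr (by simp [sub_eq_add_neg]) (by simp [sub_eq_add_neg]) (by ring)

theorem bracket_swap (δ ε : L1 t.1) : ⁅δ, ε⁆ = (-1 : ℂ) • ⁅ε, δ⁆ := by
  ext1 α
  change ⁅δ, ε⁆ α = (-1 : ℂ) • (⁅ε, δ⁆ α)
  rw [smul_eq_mul_A, map_neg, map_one, Derivation.commutator_apply,
    Derivation.commutator_apply]
  ring

theorem Deg1.bracket_g (h : Deg1 t δ 0 0 g 0 0) (h' : Deg1 t ε 0 0 g' m n) :
    Deg2 t ⁅δ, ε⁆ (fun p q => 3 * (g q * m p)) (fun p q => 3 * (g q * n p)) 0 :=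
  (h.bracket h').congr (fin22_ext (by simp) (by simp) (by simp) (by simp))
    (fin22_ext (by simp) (by simp) (by simp) (by simp)) (by simp)

theorem Deg1.bracket_m (h : Deg1 t δ 0 0 g m 0) (h' : Deg1 t ε 0 0 g' m' 0) :
    Deg2 t ⁅δ, ε⁆ (fun p q => 3 * (g q * m' p - g' q * m p))
      (fun p q => 24 * (m 0 * m' 1 - m 1 * m' 0) * symp p q) 0 :=
  (h.bracket h').congr (fin22_ext (by simp) (by simp) (by simp) (by simp))
    (fin22_ext (by simp [symp]) (by simp [symp]) (by simp [symp]) (by simp [symp])) (by simp)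

theorem Deg1.bracket_n (h : Deg1 t δ 0 0 g 0 n) (h' : Deg1 t ε 0 0 g' 0 n') :
    Deg2 t ⁅δ, ε⁆ (fun p q => 6 * t.1 * (t.1 ^ 2 - 36) * (n 0 * n' 1 - n 1 * n' 0) * symp p q)
      (fun p q => 3 * (g q * n' p - g' q * n p) -
        6 * (t.1 ^ 2 + 12) * (n 0 * n' 1 - n 1 * n' 0) * symp p q) 0 :=
  (h.bracket h').congr (fin22_ext (by simp [symp]) (by simp [symp]; left; ring) (by simp [symp]; left; ring)
    (by simp [symp])) (fin22_ext (by simp [symp]) (by simp [symp]) (by simp [symp])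
    (by simp [symp])) (by simp)

theorem Deg1.bracket_mn (h : Deg1 t δ 0 0 0 m 0) (h' : Deg1 t ε 0 0 g 0 n) :
    Deg2 t ⁅δ, ε⁆
      ![![-3 * (g 0 * m 0) + (72 - 6 * t.1 ^ 2) * (m 0 * n 0) + 72 * t.1 * (m 1 * n 1),
        -3 * (g 1 * m 0) - 144 * (m 0 * n 1) + 12 * t.1 ^ 2 * (m 1 * n 0)],
        ![-3 * (g 0 * m 1) + 12 * t.1 ^ 2 * (m 0 * n 1) - 144 * (m 1 * n 0),
          -3 * (g 1 * m 1) + 72 * t.1 * (m 0 * n 0) + (72 - 6 * t.1 ^ 2) * (m 1 * n 1)]]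
      ![![12 * t.1 * (m 0 * n 0) + 72 * (m 1 * n 1),
        -12 * t.1 * (m 0 * n 1) - 12 * t.1 * (m 1 * n 0)],
        ![-12 * t.1 * (m 0 * n 1) - 12 * t.1 * (m 1 * n 0),
          72 * (m 0 * n 0) + 12 * t.1 * (m 1 * n 1)]] 0 :=
  (h.bracket h').congr (fin22_ext (by simp) (by simp) (by simp) (by simp))
    (fin22_ext (by simp) (by simp) (by simp) (by simp)) (by simp)

theorem Deg1.bracket_uv (h : Deg1 t δ u v 0 0 0) (h' : Deg1 t ε u' v' 0 0 0) :
    Deg2 t ⁅δ, ε⁆ (fun p q => -(u q * v' p - u' q * v p)) 0 0 :=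
  (h.bracket h').congr (fin22_ext (by simp) (by simp) (by simp) (by simp))
    (fin22_ext (by simp) (by simp) (by simp) (by simp)) (by simp)

theorem Deg1.bracket_q_uv (h : Deg1 t δ 0 0 g m n) (h' : Deg1 t ε u v 0 0 0) :
    Deg2 t ⁅δ, ε⁆ 0 0 (36 * (t.1 ^ 2 - 4) * (m 0 * v 1 - m 1 * v 0)) :=
  (h.bracket h').congr (fin22_ext (by simp) (by simp) (by simp) (by simp))
    (fin22_ext (by simp) (by simp) (by simp) (by simp)) (by simp)

theorem Deg1.bracket_zero (h : Deg1 t δ 0 0 0 0 0) (h' : Deg1 t ε u v g m n) : Deg3 t ⁅δ, ε⁆ :=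
  (h.bracket h').congr (fin22_ext (by simp) (by simp) (by simp) (by simp))
    (fin22_ext (by simp) (by simp) (by simp) (by simp)) (by simp)

theorem Gen.euler (h : Gen t ε u v g m n) (hδ : DiagDer t δ 1 2) : ⁅δ, ε⁆ = ε := by
  rw [h.bracket_eq (c := 1) hδ (by norm_num) (by norm_num) rfl rfl rfl, one_smul]

end

section
variable {t s : Param} (ht : NonJump t) (hs : NonJump s) (φ : L1 t.1 ≃ₗ⁅ℂ⁆ L1 s.1)
  {δ ε : L1 t.1} {u v g m n : Fin 2 → ℂ}
include hs

/-- The Euler field with weights 1, 1, 2 satisfies [η, δ] = δ, so δ is a bracket and its image has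
no part of degree zero. -/
theorem Gen.exists_map_deg1 (h : Gen t δ u v g m n) :
    ∃ u' v' g' m' n', Deg1 s (φ δ) u' v' g' m' n' := by
  obtain ⟨η, hη⟩ := exists_diagDer t 1 2
  rw [← h.euler hη, LieEquiv.map_lie]
  exact exists_deg1_bracket hs _ _

-- Every field of degree three is a triple bracket of fields of degree one, which forces its image
-- into degree three under any isomorphism. The constant 36(t² - 4) is the coefficient of x²y²∂_z in
-- the inner bracket.
omit hs in
theorem exists_deg3 (t : Param) (a b : ℂ) : ∃ ω : L1 t.1, Deg3 t ω ∧ co t 11 (ω (xA t.1)) = a ∧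
    co t 11 (ω (yA t.1)) = b ∧
    ∀ s : Param, NonJump s → ∀ φ : L1 t.1 ≃ₗ⁅ℂ⁆ L1 s.1, Deg3 s (φ ω) := by
  have hD : t.1 ^ 2 - 4 ≠ 0 := sub_ne_zero.2 t.2
  obtain ⟨P, hP⟩ := exists_gen t ![-a / (36 * (t.1 ^ 2 - 4)), -b / (36 * (t.1 ^ 2 - 4))] 0 0 0 0
  obtain ⟨μ, hμ⟩ := exists_gen t 0 0 0 ![1, 0] 0
  obtain ⟨F, hF⟩ := exists_gen t 0 ![0, 1] 0 0 0
  have hW := hμ.deg1.bracket_q_uv hF.deg1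
  have hc := hP.deg1.co_bracket_deg2 hW
  refine ⟨⁅P, ⁅μ, F⁆⁆, hP.deg1.bracket_deg2 hW, ?_, ?_, fun s hs φ => ?_⟩
  · rw [hc.1]
    simp
    field_simp
  · rw [hc.2]
    simp
    field_simp
  · obtain ⟨_, _, _, _, _, h1⟩ := hP.exists_map_deg1 hs φ
    obtain ⟨_, _, _, _, _, h2⟩ := hμ.exists_map_deg1 hs φ
    obtain ⟨_, _, _, _, _, h3⟩ := hF.exists_map_deg1 hs φ
    rw [LieEquiv.map_lie, LieEquiv.map_lie]
    exact h1.bracket_deg2 (h2.bracket h3)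

theorem Deg3.map (h : Deg3 t δ) : Deg3 s (φ δ) := by
  obtain ⟨ω, h1, h2, h3, h4⟩ := exists_deg3 t (co t 11 (δ (xA t.1))) (co t 11 (δ (yA t.1)))
  have h5 : Deg3 t (δ - ω) := (Deg2.sub h h1).congr (by simp) (by simp) (by simp)
  have h6 : ∀ α, co t 11 ((δ - ω) α) = co t 11 (δ α) - co t 11 (ω α) := fun α => map_sub (co t 11) _ _
  have h7 := h5.eq_zero (by rw [h6, h2, sub_self]) (by rw [h6, h3, sub_self])
  have h8 : δ = ω := sub_eq_zero.1 h7
  rw [h8]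
  exact h4 s hs φ

include ht

/-- The degree zero part of the image of z∂_z is c z∂_z with c ≠ 0: there is no Euler component
because z∂_z kills degree three, and c = 0 would make its adjoint action nilpotent on the image of
z∂_x. -/
theorem exists_bracket_map_diagDer {η : L1 t.1} (hη : DiagDer t η 0 1) : ∃ c : ℂ, c ≠ 0 ∧
    ∀ (ε : L1 s.1) (u v g m n : Fin 2 → ℂ), Deg1 s ε u v g m n →
      Deg1 s ⁅φ η, ε⁆ (c • u) (-c • v) 0 0 0 := by
  have he : co s 1 (φ η (xA s.1)) = 0 := by
    obtain ⟨ω, h1, h2, h3, -⟩ := exists_deg3 t 1 0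
    have h4 : ⁅η, ω⁆ = 0 := by
      obtain ⟨k1, k2, k3⟩ := bracket_deg3 ht η h1
      rw [hη.co_x_eq] at k2 k3
      exact k1.eq_zero (by rw [k2]; ring) (by rw [k3]; ring)
    have h5 : ⁅φ η, φ ω⁆ = 0 := by rw [← LieEquiv.map_lie, h4, map_zero]
    obtain ⟨-, k2, k3⟩ := bracket_deg3 hs (φ η) (h1.map hs φ)
    rw [h5, Derivation.zero_apply, co_zero] at k2 k3
    by_contra hne
    have hx : co s 11 (φ ω (xA s.1)) = 0 := by simpa [hne] using k2.symm
    have hy : co s 11 (φ ω (yA s.1)) = 0 := by simpa [hne] using k3.symm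
    have h6 := (h1.map hs φ).eq_zero hx hy
    have h7 : ω = 0 := by simpa using h6
    rw [h7, Derivation.zero_apply, co_zero] at h2
    exact zero_ne_one h2
  refine ⟨co s 3 (φ η (zA s.1)), fun hz => ?_, fun ε u v g m n h => ?_⟩
  -- With c = 0, bracketing with the image of η raises the degree, while the image of P = z∂_x is
  -- fixed by it; three steps give P = 0.
  · obtain ⟨P, hP⟩ := exists_gen t ![1, 0] 0 0 0 0
    have h1 : ⁅η, P⁆ = P := by
      rw [hP.bracket_eq (c := 1) hη (by norm_num) (by simp) (by simp) (by simp) (by simp), one_smul]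
    have h2 : ⁅φ η, φ P⁆ = φ P := by rw [← LieEquiv.map_lie, h1]
    obtain ⟨_, _, _, _, _, k1⟩ := exists_deg1 hs he hz
    obtain ⟨_, _, _, _, _, k2⟩ := hP.exists_map_deg1 hs φ
    have k3 := k1.bracket k2
    rw [h2] at k3
    have k4 := k1.bracket_deg2 k3
    rw [h2] at k4
    have k5 := k1.bracket_deg3 k4
    rw [h2] at k5
    have k6 : P = 0 := by simpa using k5
    have k7 := hP.deg1.x3
    rw [k6, Derivation.zero_apply, co_zero] at k7
    simp at k7
  · have := bracket_deg1 hs (φ η) h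
    rw [he] at this
    simpa using this

/-- Quadratic fields commute with z∂_z, and the image of z∂_z acts by ±c ≠ 0 on the coordinates u
and v. -/
theorem Gen.exists_map_q (h : Gen t δ 0 0 g m n) : ∃ g' m' n', Deg1 s (φ δ) 0 0 g' m' n' := by
  obtain ⟨η, hη⟩ := exists_diagDer t 0 1
  obtain ⟨c, hc, k⟩ := exists_bracket_map_diagDer ht hs φ hη
  obtain ⟨u', v', g', m', n', h1⟩ := h.exists_map_deg1 hs φ
  have h2 : ⁅η, δ⁆ = 0 := by
    rw [h.bracket_eq (c := 0) hη (by simp) (by simp) (by simp) (by simp) (by simp), zero_smul]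
  have h3 := k _ _ _ _ _ _ h1
  rw [← LieEquiv.map_lie, h2, map_zero] at h3
  have h4 : Deg1 s (0 : L1 s.1) 0 0 0 0 0 := by simpa using h1.smul 0
  obtain ⟨e1, e2, -⟩ := h3.unique h4
  have e1' : u' = 0 := by simpa [hc] using e1
  have e2' : v' = 0 := by simpa [hc] using e2
  subst e1' e2'
  exact ⟨g', m', n', h1⟩

/-- An eigenvector of z∂_z with nonzero eigenvalue has no quadratic part in its image. Whether u and
v are interchanged is left open. -/
theorem exists_map_of_bracket_eq {η : L1 t.1} (hη : DiagDer t η 0 1) {c' : ℂ} (hc' : c' ≠ 0)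
    (h : Gen t δ u v 0 0 0) (hδ : ⁅η, δ⁆ = c' • δ) : ∃ u' v', Deg1 s (φ δ) u' v' 0 0 0 := by
  obtain ⟨c, hc, k⟩ := exists_bracket_map_diagDer ht hs φ hη
  obtain ⟨u', v', g', m', n', h1⟩ := h.exists_map_deg1 hs φ
  have h3 := k _ _ _ _ _ _ h1
  rw [← LieEquiv.map_lie, hδ, map_smul] at h3
  obtain ⟨-, -, e1, e2, e3⟩ := (h1.smul c').unique h3
  have e1' : g' = 0 := by simpa [hc'] using e1
  have e2' : m' = 0 := by simpa [hc'] using e2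
  have e3' : n' = 0 := by simpa [hc'] using e3
  subst e1' e2' e3'
  exact ⟨u', v', h1⟩

theorem Gen.exists_map_u (h : Gen t δ u 0 0 0 0) : ∃ u' v', Deg1 s (φ δ) u' v' 0 0 0 := by
  obtain ⟨η, hη⟩ := exists_diagDer t 0 1
  exact exists_map_of_bracket_eq ht hs φ hη one_ne_zero h
    (h.bracket_eq hη (by simp) (by simp) (by simp) (by simp) (by simp))

theorem Gen.exists_map_v (h : Gen t δ 0 v 0 0 0) : ∃ u' v', Deg1 s (φ δ) u' v' 0 0 0 := by
  obtain ⟨η, hη⟩ := exists_diagDer t 0 1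
  exact exists_map_of_bracket_eq ht hs φ hη (neg_ne_zero.2 one_ne_zero) h
    (h.bracket_eq hη (by simp) (by simp) (by simp) (by simp) (by simp))

/-- Among quadratic fields, m = 0 means that the brackets with all u- and v-fields have degree
three, and this condition is invariant under isomorphisms. -/
theorem Gen.exists_map_gn (h : Gen t δ 0 0 g 0 n) : ∃ g' n', Deg1 s (φ δ) 0 0 g' 0 n' := by
  obtain ⟨g', m', n', h1⟩ := h.exists_map_q ht hs φ
  have key : ∀ v : Fin 2 → ℂ, m' 0 * v 1 - m' 1 * v 0 = 0 := by
    intro v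
    obtain ⟨F, hF⟩ := exists_gen s 0 v 0 0 0
    obtain ⟨u', v', h2⟩ := hF.exists_map_v hs ht φ.symm
    have h3 : Deg3 t ⁅δ, φ.symm F⁆ := (h.deg1.bracket_q_uv h2).congr rfl rfl (by simp)
    have h4 := h3.map hs φ
    rw [LieEquiv.map_lie, LieEquiv.apply_symm_apply] at h4
    have h5 := (Deg2.unique (h1.bracket_q_uv hF.deg1) h4).2.2
    have hD : s.1 ^ 2 - 4 ≠ 0 := sub_ne_zero.2 s.2
    simpa [hD] using h5
  have e : m' = 0 := fin2_ext (by simpa using key ![0, 1]) (by simpa using key ![1, 0])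
  subst e
  exact ⟨g', n', h1⟩

/-- The brackets of δ with quadratic fields are mapped into degree three, hence lie in degree three.
Those with g-fields detect m and n, and those with m-fields then detect g. -/
theorem eq_zero_of_map_deg1 (h : Deg1 t δ 0 0 g m n) (h' : Deg1 s (φ δ) 0 0 0 0 0) :
    g = 0 ∧ m = 0 ∧ n = 0 := by
  have key : ∀ (g' m' n' : Fin 2 → ℂ) (X : L1 t.1), Gen t X 0 0 g' m' n' → Deg3 t ⁅δ, X⁆ := by
    intro g' m' n' X hX
    obtain ⟨_, _, _, _, _, h1⟩ := hX.exists_map_deg1 hs φ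
    have h2 := (h'.bracket_zero h1).map ht φ.symm
    rwa [← LieEquiv.map_lie, LieEquiv.symm_apply_apply] at h2
  have key1 : ∀ g' : Fin 2 → ℂ, (∀ p q, g' q * m p = 0) ∧ (∀ p q, g' q * n p = 0) := by
    intro g'
    obtain ⟨X, hX⟩ := exists_gen t 0 0 g' 0 0
    have h1 : Deg2 t ⁅X, δ⁆ 0 0 0 := by
      rw [bracket_swap]
      exact (Deg2.smul (key _ _ _ X hX) (-1)).congr (by simp) (by simp) (by simp)
    obtain ⟨e1, e2, -⟩ := (hX.deg1.bracket_g h).unique h1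
    exact ⟨fun p q => by simpa using congrFun (congrFun e1 p) q,
      fun p q => by simpa using congrFun (congrFun e2 p) q⟩
  have hm : m = 0 := funext fun p => by simpa using (key1 ![1, 0]).1 p 0
  have hn : n = 0 := funext fun p => by simpa using (key1 ![1, 0]).2 p 0
  subst hm hn
  refine ⟨funext fun q => ?_, rfl, rfl⟩
  obtain ⟨X, hX⟩ := exists_gen t 0 0 0 ![1, 0] 0
  obtain ⟨e1, -, -⟩ := (h.bracket_g hX.deg1).unique (key _ _ _ X hX)
  simpa using congrFun (congrFun e1 0) q

end

/-! ### The invariants of the bracket of quadratic vector fields -/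

/-- The determinant of the matrix with the given rows. -/
def det2 (G : Fin 2 → Fin 2 → ℂ) : ℂ := G 0 0 * G 1 1 - G 0 1 * G 1 0

/-- Cramer's rule for B; it turns each bracket relation into proportionality with one matrix G. -/
theorem symp_solve {G B : Fin 2 → Fin 2 → ℂ} {c : ℂ} (hG : det2 G ≠ 0)
    (h : ∀ p q, G 0 q * B 1 p - G 1 q * B 0 p = c * symp p q) (i : Fin 2) :
    B i = (c / det2 G) • G i := by
  have h00 := h 0 0
  have h01 := h 0 1
  have h10 := h 1 0
  have h11 := h 1 1
  simp [symp] at h00 h01 h10 h11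
  have key : ∀ i p, det2 G * B i p = c * G i p := by
    intro i p
    unfold det2
    fin_cases i <;> fin_cases p <;> simp only [Fin.zero_eta, Fin.mk_one]
    · linear_combination G 0 1 * h00 - G 0 0 * h01
    · linear_combination G 0 1 * h10 - G 0 0 * h11
    · linear_combination G 1 1 * h00 - G 1 0 * h01
    · linear_combination G 1 1 * h10 - G 1 0 * h11
  funext p
  rw [Pi.smul_apply, smul_eq_mul, div_mul_eq_mul_div, eq_div_iff hG, mul_comm]
  exact key i p

theorem symp_self (G : Fin 2 → Fin 2 → ℂ) (p q : Fin 2) :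
    G 0 q * G 1 p - G 1 q * G 0 p = det2 G * symp p q := by
  fin_cases p <;> fin_cases q <;> simp [symp, det2] <;> ring

/-- The first invariant of the parameter. -/
def invA (t : ℂ) : ℂ := t ^ 2 + 12

/-- The second invariant of the parameter. -/
def invB (t : ℂ) : ℂ := 4 * t * (t ^ 2 - 36)

theorem invB_ne_zero {t : Param} (ht : NonJump t) : invB t.1 ≠ 0 :=
  mul_ne_zero (mul_ne_zero (by norm_num) ht.1) (sub_ne_zero.2 (sq_ne_36 ht))

section
variable {t s : Param} (ht : NonJump t) (hs : NonJump s) (φ : L1 t.1 ≃ₗ⁅ℂ⁆ L1 s.1)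
  {x a b z f : Fin 2 → L1 t.1}
  (hx : ∀ i, Gen t (x i) 0 0 (Pi.single i 1) 0 0) (ha : ∀ i, Gen t (a i) 0 0 0 (Pi.single i 1) 0)
  (hb : ∀ i, Gen t (b i) 0 0 0 0 (Pi.single i 1)) (hz : ∀ i, Gen t (z i) (Pi.single i 1) 0 0 0 0)
  (hf : ∀ i, Gen t (f i) 0 (Pi.single i 1) 0 0 0)

omit hx in
theorem lieEquiv_sub (δ ε : L1 t.1) : φ (δ - ε) = φ δ - φ ε := map_sub φ δ ε

include ht hs hx

/-- The g-fields commute modulo degree three. On their images this says, as s ≠ 0, ±6, that the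
n-coordinates N are dependent, and by the same coefficients as the g-coordinates; injectivity gives
N = 0, and then det G ≠ 0. -/
theorem exists_map_g : ∃ G : Fin 2 → Fin 2 → ℂ, det2 G ≠ 0 ∧
    ∀ i, Deg1 s (φ (x i)) 0 0 (G i) 0 0 := by
  choose G N h using fun i => (hx i).exists_map_gn ht hs φ
  have h1 : Deg3 t ⁅x 0, x 1⁆ := ((hx 0).deg1.bracket_g (hx 1).deg1).congr
    (by funext; simp) (by funext; simp) rfl
  have h2 := h1.map hs φ
  rw [LieEquiv.map_lie] at h2
  obtain ⟨e1, e2, -⟩ := ((h 0).bracket_n (h 1)).unique h2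
  have nn : N 0 0 * N 1 1 - N 0 1 * N 1 0 = 0 := by
    have := congrFun (congrFun e1 1) 0
    have h36 := sub_ne_zero.2 (sq_ne_36 hs)
    simpa [symp, hs.1, h36] using this
  rw [nn] at e2
  have gn : ∀ p q, G 0 q * N 1 p - G 1 q * N 0 p = 0 := fun p q => by
    simpa using congrFun (congrFun e2 p) q
  have inj : ∀ c0 c1 : ℂ, c0 • G 0 + c1 • G 1 = 0 → c0 • N 0 + c1 • N 1 = 0 → c0 = 0 ∧ c1 = 0 := by
    intro c0 c1 hG hN
    have k1 := ((hx 0).deg1.smul c0).add ((hx 1).deg1.smul c1)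
    have k2 := ((h 0).smul c0).add ((h 1).smul c1)
    rw [← map_smul, ← map_smul, ← map_add, hG, hN] at k2
    simp only [smul_zero, add_zero] at k1 k2
    have k3 := (eq_zero_of_map_deg1 ht hs φ k1 k2).1
    exact ⟨by simpa using congrFun k3 0, by simpa using congrFun k3 1⟩
  have nn' : ∀ p q, N 0 q * N 1 p - N 1 q * N 0 p = 0 := by
    intro p q
    fin_cases p <;> fin_cases q <;> simp only [Fin.zero_eta, Fin.mk_one] <;>
      first | ring1 | linear_combination nn | linear_combination -nn
  have hN : ∀ j, N 1 j = 0 ∧ N 0 j = 0 := by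
    intro j
    have := inj (N 1 j) (-N 0 j)
      (funext fun q => by
        simp only [Pi.add_apply, Pi.smul_apply, smul_eq_mul, Pi.zero_apply]
        linear_combination gn j q)
      (funext fun q => by
        simp only [Pi.add_apply, Pi.smul_apply, smul_eq_mul, Pi.zero_apply]
        linear_combination nn' j q)
    simpa using this
  have N0 : ∀ i, N i = 0 := fun i => funext fun j => by
    fin_cases i
    · exact (hN j).2
    · exact (hN j).1
  refine ⟨G, fun hd => ?_, fun i => ?_⟩
  · have gg : ∀ p q, G 0 q * G 1 p - G 1 q * G 0 p = 0 := fun p q => by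
      rw [symp_self, hd, zero_mul]
    have hG : ∀ j, G 1 j = 0 ∧ G 0 j = 0 := by
      intro j
      have := inj (G 1 j) (-G 0 j)
        (funext fun q => by
          simp only [Pi.add_apply, Pi.smul_apply, smul_eq_mul, Pi.zero_apply]
          linear_combination gg j q)
        (by simp [N0])
      simpa using this
    have G0 : G 0 = 0 := funext fun j => (hG j).2
    exact one_ne_zero (inj 1 0 (by simp [G0]) (by simp [N0])).1
  · have := h i
    rwa [N0 i] at this

-- The bracket of a g-field and an m-field equals, modulo degree three, -3 times one of a u-field
-- and a v-field. The latter have no Hessian component, also after φ, so the image of an m-field has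
-- no n-coordinate.
include ha hz hf in
theorem exists_map_m (i : Fin 2) : ∃ γ M, Deg1 s (φ (a i)) 0 0 γ M 0 := by
  obtain ⟨G, hG, h⟩ := exists_map_g ht hs φ hx
  obtain ⟨γ, M, N, h1⟩ := (ha i).exists_map_q ht hs φ
  have key : ∀ j q p, G j q * N p = 0 := by
    intro j q p
    obtain ⟨u, v, h2⟩ := (hz j).exists_map_u ht hs φ
    obtain ⟨u', v', h3⟩ := (hf i).exists_map_v ht hs φ
    have h4 : Deg3 t (⁅x j, a i⁆ + (3 : ℂ) • ⁅z j, f i⁆) :=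
      (((hx j).deg1.bracket_g (ha i).deg1).add
        (((hz j).deg1.bracket_uv (hf i).deg1).smul 3)).congr (by funext p q; simp)
        (by funext p q; simp) (by simp)
    have h5 := h4.map hs φ
    rw [map_add, map_smul, LieEquiv.map_lie, LieEquiv.map_lie] at h5
    have h6 := (Deg2.unique (((h j).bracket_g h1).add ((h2.bracket_uv h3).smul 3)) h5).2.1
    simpa using congrFun (congrFun h6 p) q
  have N0 : N = 0 := by
    funext p
    by_contra hp
    have : ∀ j q, G j q = 0 := fun j q => (mul_eq_zero.1 (key j q p)).resolve_right hp
    exact hG (by simp [det2, this])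
  subst N0
  exact ⟨γ, M, h1⟩

include ha hb hz hf in
/-- An isomorphism of first Yau algebras acts in degree one through one matrix and one scalar. -/
theorem exists_map_coords : ∃ (G : Fin 2 → Fin 2 → ℂ) (ρ : ℂ), det2 G ≠ 0 ∧ ρ ≠ 0 ∧
    invA t.1 = ρ ^ 2 * invA s.1 ∧ invB t.1 = ρ ^ 3 * invB s.1 ∧
    (∀ i, Deg1 s (φ (x i)) 0 0 (G i) 0 0) ∧ (∀ i, Deg1 s (φ (a i)) 0 0 0 (ρ • G i) 0) ∧
    ∀ i, Deg1 s (φ (b i)) 0 0 0 0 (ρ ^ 2 • G i) := by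
  obtain ⟨G, hG, hxG⟩ := exists_map_g ht hs φ hx
  choose γ M haM using exists_map_m ht hs φ hx ha hz hf
  choose Δ N hbN using fun i => (hb i).exists_map_gn ht hs φ
  have hBt := invB_ne_zero ht
  have hBs := invB_ne_zero hs
  -- Modulo degree three these three antisymmetric brackets are multiples of those of g-fields with
  -- m- and n-fields, with coefficients in A and B only. Their images compare the two parameters.
  have R1 : Deg3 t (⁅a 0, a 1⁆ - (8 : ℂ) • (⁅x 0, b 1⁆ - ⁅x 1, b 0⁆)) :=
    (((ha 0).deg1.bracket_m (ha 1).deg1).sub ((((hx 0).deg1.bracket_g (hb 1).deg1).sub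
      ((hx 1).deg1.bracket_g (hb 0).deg1)).smul 8)).congr
      (fin22_ext (by simp) (by simp) (by simp) (by simp))
      (fin22_ext (by simp [symp]) (by simp [symp]; norm_num) (by simp [symp]; norm_num)
        (by simp [symp])) (by simp)
  have R2 : Deg3 t (⁅b 0, b 1⁆ - ((invB t.1 / 2) • (⁅x 0, a 1⁆ - ⁅x 1, a 0⁆) -
      (2 * invA t.1) • (⁅x 0, b 1⁆ - ⁅x 1, b 0⁆))) :=
    (((hb 0).deg1.bracket_n (hb 1).deg1).sub (((((hx 0).deg1.bracket_g (ha 1).deg1).sub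
      ((hx 1).deg1.bracket_g (ha 0).deg1)).smul (invB t.1 / 2)).sub
      ((((hx 0).deg1.bracket_g (hb 1).deg1).sub
      ((hx 1).deg1.bracket_g (hb 0).deg1)).smul (2 * invA t.1)))).congr
      (fin22_ext (by simp [symp]) (by simp [symp, invB]; ring) (by simp [symp, invB]; ring)
        (by simp [symp]))
      (fin22_ext (by simp [symp]) (by simp [symp, invA]; ring) (by simp [symp, invA]; ring)
        (by simp [symp])) (by simp)
  have R3 : Deg3 t ((⁅a 0, b 1⁆ - ⁅a 1, b 0⁆) - (4 * invA t.1) • (⁅x 0, a 1⁆ - ⁅x 1, a 0⁆)) :=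
    ((((ha 0).deg1.bracket_mn (hb 1).deg1).sub ((ha 1).deg1.bracket_mn (hb 0).deg1)).sub
      ((((hx 0).deg1.bracket_g (ha 1).deg1).sub
      ((hx 1).deg1.bracket_g (ha 0).deg1)).smul (4 * invA t.1))).congr
      (fin22_ext (by simp) (by simp [invA]; ring) (by simp [invA]; ring) (by simp))
      (fin22_ext (by simp) (by simp) (by simp) (by simp)) (by simp)
  have S1 := R1.map hs φ
  have S2 := R2.map hs φ
  have S3 := R3.map hs φ
  rw [lieEquiv_sub, map_smul, lieEquiv_sub, LieEquiv.map_lie, LieEquiv.map_lie, LieEquiv.map_lie] at S1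
  rw [lieEquiv_sub, lieEquiv_sub, map_smul, map_smul, lieEquiv_sub, lieEquiv_sub, LieEquiv.map_lie, LieEquiv.map_lie,
    LieEquiv.map_lie, LieEquiv.map_lie, LieEquiv.map_lie] at S2
  rw [lieEquiv_sub, lieEquiv_sub, map_smul, lieEquiv_sub, LieEquiv.map_lie, LieEquiv.map_lie, LieEquiv.map_lie,
    LieEquiv.map_lie] at S3
  obtain ⟨E1, K1, -⟩ := Deg2.unique (((haM 0).bracket_m (haM 1)).sub
    ((((hxG 0).bracket_g (hbN 1)).sub ((hxG 1).bracket_g (hbN 0))).smul 8)) S1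
  obtain ⟨E2, K2, -⟩ := Deg2.unique (((hbN 0).bracket_n (hbN 1)).sub
    (((((hxG 0).bracket_g (haM 1)).sub ((hxG 1).bracket_g (haM 0))).smul (invB t.1 / 2)).sub
      ((((hxG 0).bracket_g (hbN 1)).sub ((hxG 1).bracket_g (hbN 0))).smul (2 * invA t.1)))) S2
  replace E1 := fun p q => congrFun (congrFun E1 p) q
  replace K1 := fun p q => congrFun (congrFun K1 p) q
  replace E2 := fun p q => congrFun (congrFun E2 p) q
  replace K2 := fun p q => congrFun (congrFun K2 p) q
  simp only [Pi.sub_apply, Pi.smul_apply, smul_eq_mul, Pi.zero_apply, mul_zero, sub_zero, sub_self]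
    at E1 K1 E2 K2
  -- The Hessian part of the first relation makes N a multiple of G, and the other part of the
  -- second makes M one. With M = ρG this gives N = ρ²G and ρB_t = ρ⁴B_s.
  have hN := symp_solve hG (B := N) (c := det2 M) fun p q => by
    unfold det2
    linear_combination (-1 / 24 : ℂ) * K1 p q
  have hM := symp_solve hG (B := M) (c := invB s.1 / invB t.1 * det2 N) fun p q => by
    have := E2 p q
    have e : invB s.1 = 4 * s.1 * (s.1 ^ 2 - 36) := rfl
    rw [div_mul_eq_mul_div, div_mul_eq_mul_div, eq_div_iff hBt, e, det2]
    linear_combination (-2 / 3 : ℂ) * this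
  have hdet : ∀ (c : ℂ) (B : Fin 2 → Fin 2 → ℂ), (∀ i, B i = c • G i) → det2 B = c ^ 2 * det2 G := by
    intro c B hB
    simp only [det2, hB, Pi.smul_apply, smul_eq_mul]
    ring
  obtain ⟨ρ, hρ⟩ : ∃ ρ, ρ = invB s.1 / invB t.1 * det2 N / det2 G := ⟨_, rfl⟩
  rw [← hρ] at hM
  have dM := hdet _ _ hM
  rw [dM, mul_div_assoc, div_self hG, mul_one] at hN
  have dN := hdet _ _ hN
  have hρ3 : ρ * invB t.1 = ρ * (ρ ^ 3 * invB s.1) := by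
    rw [dN] at hρ
    field_simp at hρ
    linear_combination hρ
  -- If ρ = 0, the image of a 0 agrees in degree one with a combination of the images of the
  -- g-fields. The coefficients below solve for γ 0 in the basis G 0, G 1, and injectivity is
  -- contradicted.
  have hρ0 : ρ ≠ 0 := by
    intro h0
    have hM0 : M 0 = 0 := by rw [hM, h0, zero_smul]
    have k0 := haM 0
    rw [hM0] at k0
    have k1 := (((ha 0).deg1.add ((hx 0).deg1.smul (-(γ 0 0 * G 1 1 - γ 0 1 * G 1 0) / det2 G))).add
      ((hx 1).deg1.smul (-(γ 0 1 * G 0 0 - γ 0 0 * G 0 1) / det2 G)))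
    have k2 := ((k0.add ((hxG 0).smul (-(γ 0 0 * G 1 1 - γ 0 1 * G 1 0) / det2 G))).add
      ((hxG 1).smul (-(γ 0 1 * G 0 0 - γ 0 0 * G 0 1) / det2 G)))
    have e : γ 0 + (-(γ 0 0 * G 1 1 - γ 0 1 * G 1 0) / det2 G) • G 0 +
        (-(γ 0 1 * G 0 0 - γ 0 0 * G 0 1) / det2 G) • G 1 = 0 := by
      refine fin2_ext ?_ ?_ <;> simp only [Pi.add_apply, Pi.smul_apply, smul_eq_mul, Pi.zero_apply] <;>
        field_simp <;> unfold det2 <;> ring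
    rw [← map_smul, ← map_smul, ← map_add, ← map_add, e] at k2
    simp only [smul_zero, add_zero, zero_add] at k1 k2
    have k3 := congrFun (eq_zero_of_map_deg1 ht hs φ k1 k2).2.1 0
    simp at k3
  have hb3 : invB t.1 = ρ ^ 3 * invB s.1 := mul_left_cancel₀ hρ0 hρ3
  have hγ := symp_solve hG (B := γ) (c := 0) fun p q => by
    have := E1 q p
    simp only [hM, Pi.smul_apply, smul_eq_mul] at this
    have h3 : (3 * ρ) * (G 0 q * γ 1 p - G 1 q * γ 0 p) = 0 := by linear_combination -this
    rw [zero_mul]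
    exact (mul_eq_zero.1 h3).resolve_left (mul_ne_zero (by norm_num) hρ0)
  simp only [zero_div, zero_smul] at hγ
  -- The g-coordinates of the images of the n-fields form κG with κ = 2(ρ²A_s - A_t). The third
  -- relation gives κ = 4(A_t - ρ²A_s) instead, so both sides vanish.
  have hΔ := symp_solve hG (B := Δ) (c := 2 * (invA s.1 * ρ ^ 2 - invA t.1) * det2 G) fun p q => by
    have h2 := K2 q p
    have h3 := symp_self G q p
    have h4 : symp q p = -symp p q := by fin_cases p <;> fin_cases q <;> simp [symp]
    simp only [hN, Pi.smul_apply, smul_eq_mul] at h2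
    refine mul_left_cancel₀ (mul_ne_zero three_ne_zero (pow_ne_zero 2 hρ0)) ?_
    unfold det2 at h3 ⊢
    unfold invA at h2 ⊢
    linear_combination -h2 + 6 * ρ ^ 2 * (t.1 ^ 2 + 12) * h3 + 6 * ρ ^ 2 * (t.1 ^ 2 + 12 -
      ρ ^ 2 * (s.1 ^ 2 + 12)) * (G 0 0 * G 1 1 - G 0 1 * G 1 0) * h4
  obtain ⟨κ, hκ⟩ : ∃ κ, κ = 2 * (invA s.1 * ρ ^ 2 - invA t.1) := ⟨_, rfl⟩
  rw [← hκ] at hΔ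
  simp only [mul_div_assoc, div_self hG, mul_one] at hΔ
  simp only [hγ, hM] at haM
  simp only [hΔ, hN] at hbN
  obtain ⟨E3, -, -⟩ := Deg2.unique ((((haM 0).bracket_mn (hbN 1)).sub
    ((haM 1).bracket_mn (hbN 0))).sub
      ((((hxG 0).bracket_g (haM 1)).sub ((hxG 1).bracket_g (haM 0))).smul (4 * invA t.1))) S3
  have e3 := congrFun (congrFun E3 0) 1
  simp at e3
  have hκ' : κ = 4 * (invA t.1 - invA s.1 * ρ ^ 2) := by
    refine mul_left_cancel₀ (mul_ne_zero hρ0 hG) ?_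
    unfold invA at e3 ⊢
    unfold det2
    linear_combination (-1 / 3 : ℂ) * e3
  have hκ0 : κ = 0 := by linear_combination (2 / 3 : ℂ) * hκ + (1 / 3 : ℂ) * hκ'
  subst hκ0
  simp only [zero_smul] at hbN
  exact ⟨G, ρ, hG, hρ0, by linear_combination (1 / 2 : ℂ) * hκ, hb3, hxG, haM, hbN⟩

end

/-! ### The first Yau algebra determines the contact class -/

section
variable {B B' : Type*} [CommRing B] [CommRing B'] [Algebra ℂ B] [Algebra ℂ B']

/-- Transport of a derivation along an isomorphism of algebras. -/
noncomputable def conjDer (e : B ≃ₐ[ℂ] B') (δ : Derivation ℂ B B) : Derivation ℂ B' B' :=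
  Derivation.mk' (e.toLinearMap ∘ₗ (δ : B →ₗ[ℂ] B) ∘ₗ e.symm.toLinearMap) fun a b => by
    simp

theorem conjDer_apply (e : B ≃ₐ[ℂ] B') (δ : Derivation ℂ B B) (b : B') :
    conjDer e δ b = e (δ (e.symm b)) := rfl

/-- Isomorphic algebras have isomorphic Lie algebras of derivations. -/
noncomputable def derLieEquiv (e : B ≃ₐ[ℂ] B') : Derivation ℂ B B ≃ₗ⁅ℂ⁆ Derivation ℂ B' B' where
  toFun := conjDer e
  map_add' δ ε := by ext b; simp [conjDer_apply]
  map_smul' c δ := by ext b; simp [conjDer_apply]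
  map_lie' {δ ε} := by ext b; simp [conjDer_apply, Derivation.commutator_apply]
  invFun := conjDer e.symm
  left_inv δ := by ext b; simp [conjDer_apply]
  right_inv δ := by ext b; simp [conjDer_apply]

end

theorem nonempty_lieEquiv_of_contact {t s : ℂ} (h : ContactEquiv (fam t) (fam s)) :
    Nonempty (L1 t ≃ₗ⁅ℂ⁆ L1 s) := by
  obtain ⟨φ, u, h⟩ := h
  exact ⟨derLieEquiv (Ideal.quotientEquivAlg (I 1 t) (I 1 s) φ (map_I_of_contact h 1).symm)⟩

theorem contact_trans (b : BIdx) {t : ℂ} (ht : t ^ 2 ≠ 4) :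
    ContactEquiv (fam t) (fam (b.trans t)) := by
  obtain ⟨γ, hγ⟩ := IsAlgClosed.exists_pow_nat_eq (b.lam t) (n := 2) (by norm_num)
  have hγ0 : γ ≠ 0 := by
    rintro rfl
    exact b.lam_ne_zero ht (by rw [← hγ]; simp)
  obtain ⟨u, hu⟩ := isUnit_C (b.lam_ne_zero ht)
  have hr := b.quarticRel ht 1
  simp only [one_mul, one_pow] at hr
  exact ⟨(blockAut b.gl (Units.mk0 γ hγ0)).1, u, by
    rw [hu]; exact (isTri_Bt b (Units.mk0 γ hγ0)).map_fam hr hγ⟩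

/-- The difference of the two sides is, up to the constant 1728, the product of six polynomials of
degree one in s, one for each transformation. -/
theorem exists_trans_eq {t s : Param} (h : invA t.1 ^ 3 * invB s.1 ^ 2 = invA s.1 ^ 3 * invB t.1 ^ 2) :
    ∃ b : BIdx, b.trans t.1 = s.1 := by
  obtain ⟨t, ht⟩ := t
  obtain ⟨s, hs⟩ := s
  change invA t ^ 3 * invB s ^ 2 = invA s ^ 3 * invB t ^ 2 at h
  change ∃ b : BIdx, b.trans t = s
  have key : (s - t) * ((s + t) * ((s * (2 + t) - (12 - 2 * t)) * ((s * (2 + t) + (12 - 2 * t)) *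
      ((s * (2 - t) - (12 + 2 * t)) * (s * (2 - t) + (12 + 2 * t)))))) = 0 := by
    unfold invA invB at h
    linear_combination (1 / 1728 : ℂ) * h
  have hp : 2 + t ≠ 0 := fun h0 => ht (by linear_combination (t - 2) * h0)
  have hm : 2 - t ≠ 0 := fun h0 => ht (by linear_combination (-t - 2) * h0)
  have hI : Complex.I ^ 2 = -1 := Complex.I_sq
  rcases mul_eq_zero.1 key with e | key
  · exact ⟨.diag mu1, by simp only [BIdx.trans, mu1]; linear_combination -e⟩
  rcases mul_eq_zero.1 key with e | key
  · exact ⟨.diag muI, by simp only [BIdx.trans, muI, hI]; linear_combination -e⟩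
  rcases mul_eq_zero.1 key with e | key
  · refine ⟨.full mu1 mu1, ?_⟩
    simp only [BIdx.trans, mu1, one_pow, mul_one, one_mul]
    rw [div_eq_iff hp]
    linear_combination -e
  rcases mul_eq_zero.1 key with e | key
  · refine ⟨.full mu1 muI, ?_⟩
    simp only [BIdx.trans, mu1, muI, hI, one_pow, mul_one, one_mul]
    rw [div_eq_iff hp]
    linear_combination -e
  have hm' : 2 + -1 * t ≠ 0 := by
    intro h0
    exact hm (by linear_combination h0)
  rcases mul_eq_zero.1 key with e | e
  · refine ⟨.full muI mu1, ?_⟩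
    simp only [BIdx.trans, mu1, muI, hI, one_pow, one_mul]
    rw [div_eq_iff hm']
    linear_combination -e
  · refine ⟨.full muI muI, ?_⟩
    simp only [BIdx.trans, muI, hI]
    rw [div_eq_iff hm']
    linear_combination -e

theorem exists_generators (t : Param) : ∃ x a b z f : Fin 2 → L1 t.1,
    (∀ i, Gen t (x i) 0 0 (Pi.single i 1) 0 0) ∧ (∀ i, Gen t (a i) 0 0 0 (Pi.single i 1) 0) ∧
    (∀ i, Gen t (b i) 0 0 0 0 (Pi.single i 1)) ∧ (∀ i, Gen t (z i) (Pi.single i 1) 0 0 0 0) ∧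
    ∀ i, Gen t (f i) 0 (Pi.single i 1) 0 0 0 := by
  choose x hx using fun i : Fin 2 => exists_gen t 0 0 (Pi.single i 1) 0 0
  choose a ha using fun i : Fin 2 => exists_gen t 0 0 0 (Pi.single i 1) 0
  choose b hb using fun i : Fin 2 => exists_gen t 0 0 0 0 (Pi.single i 1)
  choose z hz using fun i : Fin 2 => exists_gen t (Pi.single i 1) 0 0 0 0
  choose f hf using fun i : Fin 2 => exists_gen t 0 (Pi.single i 1) 0 0 0
  exact ⟨x, a, b, z, f, hx, ha, hb, hz, hf⟩

/-- The Torelli-type theorem. -/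
theorem nonempty_lieEquiv_iff {t s : Param} (ht : NonJump t) (hs : NonJump s) :
    Nonempty (L1 t.1 ≃ₗ⁅ℂ⁆ L1 s.1) ↔ ContactEquiv (fam t.1) (fam s.1) := by
  refine ⟨fun ⟨φ⟩ => ?_, nonempty_lieEquiv_of_contact⟩
  obtain ⟨x, a, b, z, f, hx, ha, hb, hz, hf⟩ := exists_generators t
  obtain ⟨G, ρ, -, -, hA, hB, -⟩ := exists_map_coords ht hs φ hx ha hb hz hf
  obtain ⟨c, hc⟩ := exists_trans_eq (t := t) (s := s) (by rw [hA, hB]; ring)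
  rw [← hc]
  exact contact_trans c t.2

/-! ### The four lines and their cross-ratio -/
-- Weighted homogeneous series are polynomials, so the product rule propagates the condition from
-- the variables.
theorem isHomogDer_of_vars {t : ℂ} {k : ℕ} {δ : L1 t}
    (h : ∀ i, ∃ g : O, WH g (wt i + k) ∧ δ (cl t (X i)) = cl t g) : IsHomogDer t k δ := by
  have X_mem := h
  have C_mem : ∀ c : ℂ, ∃ g : O, WH g (0 + k) ∧ δ (cl t (C c)) = cl t g := fun c =>
    ⟨0, wh_zero _, by rw [cl_C, Derivation.map_algebraMap]; exact (map_zero (clHom t)).symm⟩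
  have mul_mem : ∀ {f g : O} {n m : ℕ}, WH f n → WH g m →
      (∃ p : O, WH p (n + k) ∧ δ (cl t f) = cl t p) → (∃ q : O, WH q (m + k) ∧ δ (cl t g) = cl t q) →
      ∃ r : O, WH r (n + m + k) ∧ δ (cl t (f * g)) = cl t r := by
    rintro f g n m hf hg ⟨p, hp, ep⟩ ⟨q, hq, eq⟩
    refine ⟨f * q + g * p, wh_add ?_ ?_, ?_⟩
    · rw [add_assoc]; exact wh_mul hf hq
    · rw [add_comm n, add_assoc]; exact wh_mul hg hp
    · rw [cl_mul, der_mul, ep, eq, cl_add, cl_mul, cl_mul]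
  have pow_mem : ∀ (i : Fin 3) (m : ℕ), ∃ g : O, WH g (m * wt i + k) ∧
      δ (cl t (X i ^ m)) = cl t g := by
    intro i m
    induction m with
    | zero =>
      have := C_mem 1
      rw [map_one] at this
      rwa [Nat.zero_mul, pow_zero]
    | succ m ih =>
      rw [pow_succ, Nat.succ_mul]
      exact mul_mem (wh_pow (wh_X i) m) (wh_X i) ih (X_mem i)
  have main : ∀ (n : ℕ) (f : O), WH f n → ∃ g : O, WH g (n + k) ∧ δ (cl t f) = cl t g := by
    intro n f hf
    obtain ⟨p, hp, rfl⟩ := exists_poly hf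
    have e := apply_coe (AlgHom.id ℂ O) p
    rw [MvPolynomial.aeval_def, MvPolynomial.eval₂_eq'] at e
    rw [AlgHom.id_apply] at e
    rw [e]
    have sum_mem : ∀ (s : Finset (Fin 3 →₀ ℕ)) (F : (Fin 3 →₀ ℕ) → O),
        (∀ d ∈ s, ∃ g : O, WH g (n + k) ∧ δ (cl t (F d)) = cl t g) →
        ∃ g : O, WH g (n + k) ∧ δ (cl t (∑ d ∈ s, F d)) = cl t g := by
      classical
      intro s F
      induction s using Finset.induction_on with
      | empty =>
        intro _
        refine ⟨0, wh_zero _, ?_⟩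
        rw [Finset.sum_empty]
        exact (congrArg δ (map_zero (clHom t))).trans ((map_zero δ).trans (map_zero (clHom t)).symm)
      | insert a s ha ih =>
        intro hF
        obtain ⟨g1, w1, e1⟩ := hF a (Finset.mem_insert_self a s)
        obtain ⟨g2, w2, e2⟩ := ih fun d hd => hF d (Finset.mem_insert_of_mem hd)
        refine ⟨g1 + g2, wh_add w1 w2, ?_⟩
        rw [Finset.sum_insert ha, cl_add, der_add, e1, e2, cl_add]
    refine sum_mem _ _ fun d hd => ?_
    have hw : Finsupp.weight wt d = n := hp (MvPolynomial.mem_support_iff.mp hd)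
    rw [Finsupp.weight_apply, Finsupp.sum_fintype _ _ (by simp)] at hw
    simp only [Fin.sum_univ_three, smul_eq_mul] at hw
    simp only [AlgHom.id_apply, Fin.prod_univ_three]
    rw [← hw, ← zero_add (_ + _ + d 2 * wt 2)]
    have w := fun i => wh_pow (wh_X i) (d i)
    exact mul_mem (wh_C _) (wh_mul (wh_mul (w 0) (w 1)) (w 2)) (C_mem _)
      (mul_mem (wh_mul (w 0) (w 1)) (w 2) (mul_mem (w 0) (w 1) (pow_mem 0 _) (pow_mem 1 _))
        (pow_mem 2 _))
  intro n f hf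
  obtain ⟨g, hg, e⟩ := main n f hf
  exact ⟨g, fun d hd => by rw [hg d hd]; push_cast; rfl, e⟩

/-- The values on x and y have weight three, whereas x²y² has weight four. For graded isomorphisms
this removes the ambiguity modulo degree three. -/
theorem IsHomogDer.co11_eq_zero {t : Param} {δ : L1 t.1} (h : IsHomogDer t.1 2 δ) :
    co t 11 (δ (xA t.1)) = 0 ∧ co t 11 (δ (yA t.1)) = 0 := by
  have key : ∀ g : O, (∀ d, coeff d g ≠ 0 → ((Finsupp.weight wt d : ℕ) : ℤ) = (1 : ℕ) + 2) →
      co t 11 (cl t.1 g) = 0 := by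
    intro g hg
    have w : WH g 3 := fun d hd => by
      have := hg d hd
      omega
    rw [co_cl]
    change socle t.1 g = 0
    rw [socle_apply, w.cf_eq_zero (by norm_num), w.cf_eq_zero (by norm_num),
      w.cf_eq_zero (by norm_num)]
    simp
  constructor
  · obtain ⟨g, hg, e⟩ := h 1 (X 0) (wh_X 0)
    exact (congrArg (co t 11) e).trans (key g hg)
  · obtain ⟨g, hg, e⟩ := h 1 (X 1) (wh_X 1)
    exact (congrArg (co t 11) e).trans (key g hg)

theorem exists_hamDer (t : Param) (a b : ℂ) : ∃ δ : L1 t.1,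
    δ (xA t.1) = a • (xA t.1 * (xA t.1 * yA t.1)) + b • (yA t.1 * (yA t.1 * yA t.1)) ∧
    δ (yA t.1) = (-a) • (xA t.1 * (yA t.1 * yA t.1)) + (-b) • (xA t.1 * (xA t.1 * xA t.1)) ∧
    δ (zA t.1) = 0 := by
  apply exists_der
  constructor <;> simp only [co_add, co_smul, co_x_mul, co_y_mul, co_zero] <;> simp

open Classical in
/-- The derivation `(a x² y + b y³) ∂_x - (a x y² + b x³) ∂_y`. -/
noncomputable def hamDer (t a b : ℂ) : L1 t :=
  -- The families of derivations are indexed by all complex t; the default value at t = ±2 is never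
  -- used.
  if h : t ^ 2 ≠ 4 then (exists_hamDer ⟨t, h⟩ a b).choose else 0

theorem hamDer_spec (t : Param) (a b : ℂ) :
    hamDer t.1 a b (xA t.1) = a • (xA t.1 * (xA t.1 * yA t.1)) + b • (yA t.1 * (yA t.1 * yA t.1)) ∧
    hamDer t.1 a b (yA t.1) =
      (-a) • (xA t.1 * (yA t.1 * yA t.1)) + (-b) • (xA t.1 * (xA t.1 * xA t.1)) ∧
    hamDer t.1 a b (zA t.1) = 0 := by
  rw [hamDer, dif_pos t.2]
  exact (exists_hamDer ⟨t.1, t.2⟩ a b).choose_spec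

theorem hamDer_cl (t : Param) (a b : ℂ) :
    hamDer t.1 a b (cl t.1 (X 0)) = cl t.1 (C a * (X 0 ^ 2 * X 1) + C b * X 1 ^ 3) ∧
    hamDer t.1 a b (cl t.1 (X 1)) = cl t.1 (-(C a * (X 1 ^ 2 * X 0) + C b * X 0 ^ 3)) ∧
    hamDer t.1 a b (cl t.1 (X 2)) = 0 := by
  obtain ⟨e1, e2, e3⟩ := hamDer_spec t a b
  have ex : cl t.1 (X 0) = xA t.1 := rfl
  have ey : cl t.1 (X 1) = yA t.1 := rfl
  refine ⟨e1.trans ?_, e2.trans ?_, e3⟩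
  · simp only [cl_add, cl_mul, cl_pow, cl_C, ex, ey, smul_eq_mul_A]
    ring
  · simp only [cl_neg, cl_add, cl_mul, cl_pow, cl_C, ex, ey, smul_eq_mul_A, map_neg]
    ring

theorem isHomogDer_hamDer (t : Param) (a b : ℂ) : IsHomogDer t.1 2 (hamDer t.1 a b) := by
  obtain ⟨e1, e2, e3⟩ := hamDer_cl t a b
  refine isHomogDer_of_vars (k := 2) fun i => ?_
  have w : ∀ i : Fin 3, i ≠ 2 → ∀ (c : ℂ) (n : ℕ), WH (C c * X i ^ n : O) n := by
    intro i hi c n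
    have h1 : wt i = 1 := by fin_cases i <;> simp_all [wt]
    simpa [h1] using wh_mul (wh_C c) (wh_pow (wh_X i) n)
  have w2 : ∀ c : ℂ, ∀ i j : Fin 3, i ≠ 2 → j ≠ 2 → WH (C c * (X i ^ 2 * X j) : O) 3 := by
    intro c i j hi hj
    have := wh_mul (w i hi c 2) (w j hj 1 1)
    simpa [mul_assoc] using this
  fin_cases i
  · exact ⟨_, wh_add (w2 a 0 1 (by decide) (by decide)) (w 1 (by decide) b 3), e1⟩
  · have : (-(C a * (X 1 ^ 2 * X 0) + C b * X 0 ^ 3) : O) =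
        C (-a) * (X 1 ^ 2 * X 0) + C (-b) * X 0 ^ 3 := by rw [map_neg, map_neg]; ring
    rw [this] at e2
    exact ⟨_, wh_add (w2 (-a) 1 0 (by decide) (by decide)) (w 0 (by decide) (-b) 3), e2⟩
  · exact ⟨0, wh_zero _, e3.trans (map_zero (clHom t.1)).symm⟩

/-- This field is the Hamiltonian field of e q_t + k h, where h is -1/24 times the Hessian. For h₁
one has e = 1/2, k = 0, and for h₂ one has e = 0, k = 1. -/
theorem deg2_hamDer (t : Param) (a b e k : ℂ) (ha : a = 2 * t.1 * e + (t.1 ^ 2 - 12) * k)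
    (hb : b = 4 * e - 4 * t.1 * k) :
    Deg2 t (hamDer t.1 a b) (e • symp) (k • symp) 0 := by
  obtain ⟨e1, e2, e3⟩ := hamDer_spec t a b
  refine ⟨⟨?_, ?_, ?_, ?_, ?_, ?_, ?_, ?_, ?_, ?_, ?_, ?_, ?_, ?_, ?_, ?_, ?_, ?_, ?_, ?_, ?_, ?_, ?_,
    ?_, ?_⟩, ?_, ?_, ?_, ?_, ?_, ?_, ?_, ?_, ?_⟩ <;>
    simp only [e1, e2, e3, co_add, co_smul, co_x_mul, co_y_mul, co_zero] <;>
    simp [co_x, co_y, symp] <;> subst ha hb <;> ring1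

/-- The derivation `h₁`. -/
noncomputable def h1Der (t : ℂ) : L1 t := hamDer t t 2

/-- The derivation `h₂`. -/
noncomputable def h2Der (t : ℂ) : L1 t := hamDer t (t ^ 2 - 12) (-(4 * t))

theorem deg2_h1Der (t : Param) : Deg2 t (h1Der t.1) ((1 / 2 : ℂ) • symp) 0 0 := by
  have := deg2_hamDer t t.1 2 (1 / 2) 0 (by ring) (by ring)
  rwa [zero_smul] at this

theorem deg2_h2Der (t : Param) : Deg2 t (h2Der t.1) 0 symp 0 := by
  have := deg2_hamDer t (t.1 ^ 2 - 12) (-(4 * t.1)) 0 1 (by ring) (by ring)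
  rwa [zero_smul, one_smul] at this

/-- The four lines. -/
noncomputable def fourLines (t : ℂ) : Fin 4 → Submodule ℂ (L1 t) :=
  ![Submodule.span ℂ {h1Der t}, Submodule.span ℂ {h2Der t},
    Submodule.span ℂ {(4 * t * (t ^ 2 - 36)) • h1Der t - (t ^ 2 + 12) • h2Der t},
    Submodule.span ℂ {(5 * (t ^ 2 + 12) ^ 2) • h1Der t + (4 * t * (t ^ 2 - 36)) • h2Der t}]

theorem linearIndependent_h (t : Param) : LinearIndependent ℂ ![h1Der t.1, h2Der t.1] := by
  refine LinearIndependent.pair_iffₛ.2 fun c d c' d' h => ?_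
  have h1 := ((deg2_h1Der t).smul c).add ((deg2_h2Der t).smul d)
  rw [h] at h1
  obtain ⟨e1, e2, -⟩ := h1.unique (((deg2_h1Der t).smul c').add ((deg2_h2Der t).smul d'))
  exact ⟨by simpa [symp] using congrFun (congrFun e1 1) 0,
    by simpa [symp] using congrFun (congrFun e2 1) 0⟩

/-- In the coordinates given by h₁, h₂ the cross-ratio is -5A³/B², and 1 - j = -B²/(1728(t² - 4)²)
gives j/(1 - j) = -16A³/B². -/
theorem hasCrossRatio_fourLines {t : Param} (ht : NonJump t) :
    HasCrossRatio (fourLines t.1) (5 / 16 * (jFun t.1 / (1 - jFun t.1))) := by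
  have hb : 4 * t.1 * (t.1 ^ 2 - 36) ≠ 0 := invB_ne_zero ht
  have hD : t.1 ^ 2 - 4 ≠ 0 := sub_ne_zero.2 t.2
  refine ⟨h1Der t.1, h2Der t.1, ![1, 0, 4 * t.1 * (t.1 ^ 2 - 36), 5 * (t.1 ^ 2 + 12) ^ 2],
    ![0, 1, -(t.1 ^ 2 + 12), 4 * t.1 * (t.1 ^ 2 - 36)], linearIndependent_h t, ?_, ?_, ?_, ?_⟩
  · intro i
    fin_cases i
    · exact ⟨Or.inl one_ne_zero, by simp [fourLines]⟩
    · exact ⟨Or.inr one_ne_zero, by simp [fourLines]⟩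
    · refine ⟨Or.inl hb, congrArg (fun v => Submodule.span ℂ {v}) ?_⟩
      change (4 * t.1 * (t.1 ^ 2 - 36)) • h1Der t.1 - (t.1 ^ 2 + 12) • h2Der t.1 =
        (4 * t.1 * (t.1 ^ 2 - 36)) • h1Der t.1 + (-(t.1 ^ 2 + 12)) • h2Der t.1
      module
    · exact ⟨Or.inr hb, by simp [fourLines]⟩
  · simpa using hb
  · simpa using hb
  · have e : 1 - jFun t.1 = -(4 * t.1 * (t.1 ^ 2 - 36)) ^ 2 / (16 * 108 * (t.1 ^ 2 - 4) ^ 2) := by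
      unfold jFun
      field_simp
      ring
    have hj : jFun t.1 / (1 - jFun t.1) =
        -16 * (t.1 ^ 2 + 12) ^ 3 / (4 * t.1 * (t.1 ^ 2 - 36)) ^ 2 := by
      rw [e, jFun]
      generalize 4 * t.1 * (t.1 ^ 2 - 36) = b at hb
      field_simp
      ring
    rw [hj]
    simp only [Matrix.cons_val]
    generalize 4 * t.1 * (t.1 ^ 2 - 36) = b at hb
    simp only [mul_zero, zero_mul, one_mul, mul_one, sub_zero, zero_sub]
    field_simp

/-- Homogeneous fields of degree two have no part of degree three, so proportionality modulo degree
three is exact. -/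
theorem eq_smul_of_homog {s : Param} {δ ε η : L1 s.1} {E K E' K' : Fin 2 → Fin 2 → ℂ} {c : ℂ}
    (h : Deg3 s (ε - η)) (hη : Deg2 s η E K 0) (hδ : Deg2 s δ E' K' 0) (hE : E = c • E')
    (hK : K = c • K') (h1 : IsHomogDer s.1 2 ε) (h2 : IsHomogDer s.1 2 δ) : ε = c • δ := by
  have e : (ε - η) + (η - c • δ) = ε + (-c) • δ := by module
  have h3 : Deg3 s (ε + (-c) • δ) := by
    rw [← e]
    refine (Deg2.add h (hη.sub (hδ.smul c))).congr ?_ ?_ (by simp)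
    · rw [hE]; simp
    · rw [hK]; simp
  have h4 := h3.eq_zero
    (by rw [co_der_add, co_der_smul, h1.co11_eq_zero.1, h2.co11_eq_zero.1]; ring)
    (by rw [co_der_add, co_der_smul, h1.co11_eq_zero.2, h2.co11_eq_zero.2]; ring)
  calc ε = (ε + (-c) • δ) + c • δ := by module
    _ = c • δ := by rw [h4]; exact zero_add _

/-- Modulo degree three, h₁ and h₂ are antisymmetrised brackets of the g-fields with the m- and
n-fields, on which φ acts by G, ρG, ρ²G. Hence the factors ρ det G and ρ² det G. -/
theorem exists_map_h {t s : Param} (ht : NonJump t) (hs : NonJump s) (φ : L1 t.1 ≃ₗ⁅ℂ⁆ L1 s.1)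
    (hφ : IsHomogIso φ) : ∃ c ρ : ℂ, c ≠ 0 ∧ ρ ≠ 0 ∧ invA t.1 = ρ ^ 2 * invA s.1 ∧
      invB t.1 = ρ ^ 3 * invB s.1 ∧ φ (h1Der t.1) = c • h1Der s.1 ∧
      φ (h2Der t.1) = (c * ρ) • h2Der s.1 := by
  obtain ⟨x, a, b, z, f, hx, ha, hb, hz, hf⟩ := exists_generators t
  obtain ⟨G, ρ, hG, hρ, hA, hB, kx, ka, kb⟩ := exists_map_coords ht hs φ hx ha hb hz hf
  refine ⟨ρ * det2 G, ρ, mul_ne_zero hρ hG, hρ, hA, hB, ?_, ?_⟩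
  · have r : Deg3 t (h1Der t.1 - (1 / 6 : ℂ) • (⁅x 0, a 1⁆ - ⁅x 1, a 0⁆)) :=
      ((deg2_h1Der t).sub ((((hx 0).deg1.bracket_g (ha 1).deg1).sub
        ((hx 1).deg1.bracket_g (ha 0).deg1)).smul (1 / 6))).congr
        (fin22_ext (by simp [symp]) (by simp [symp]; norm_num) (by simp [symp]; norm_num)
          (by simp [symp])) (fin22_ext (by simp) (by simp) (by simp) (by simp)) (by simp)
    have r' := r.map hs φ
    rw [lieEquiv_sub, map_smul, lieEquiv_sub, LieEquiv.map_lie, LieEquiv.map_lie] at r'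
    refine eq_smul_of_homog r' (((((kx 0).bracket_g (ka 1)).sub
      ((kx 1).bracket_g (ka 0))).smul (1 / 6)).congr rfl rfl (by simp)) (deg2_h1Der s) ?_ ?_
      ((hφ 2 _).1 (isHomogDer_hamDer t _ _)) (isHomogDer_hamDer s _ _)
    · refine fin22_ext ?_ ?_ ?_ ?_ <;> simp [symp, det2] <;> ring
    · refine fin22_ext ?_ ?_ ?_ ?_ <;> simp
  · have r : Deg3 t (h2Der t.1 - (1 / 3 : ℂ) • (⁅x 0, b 1⁆ - ⁅x 1, b 0⁆)) :=
      ((deg2_h2Der t).sub ((((hx 0).deg1.bracket_g (hb 1).deg1).sub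
        ((hx 1).deg1.bracket_g (hb 0).deg1)).smul (1 / 3))).congr
        (fin22_ext (by simp) (by simp) (by simp) (by simp))
        (fin22_ext (by simp [symp]) (by simp [symp]) (by simp [symp]) (by simp [symp])) (by simp)
    have r' := r.map hs φ
    rw [lieEquiv_sub, map_smul, lieEquiv_sub, LieEquiv.map_lie, LieEquiv.map_lie] at r'
    refine eq_smul_of_homog r' (((((kx 0).bracket_g (kb 1)).sub
      ((kx 1).bracket_g (kb 0))).smul (1 / 3)).congr rfl rfl (by simp)) (deg2_h2Der s) ?_ ?_
      ((hφ 2 _).1 (isHomogDer_hamDer t _ _)) (isHomogDer_hamDer s _ _)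
    · refine fin22_ext ?_ ?_ ?_ ?_ <;> simp
    · refine fin22_ext ?_ ?_ ?_ ?_ <;> simp [symp, det2] <;> ring

/-- With A, B, h₁, h₂ scaling by ρ², ρ³, c, cρ, the vectors Bh₁ - Ah₂ and 5A²h₁ + Bh₂ are multiplied
by cρ³ and cρ⁴. -/
theorem map_fourLines {t s : Param} (ht : NonJump t) (hs : NonJump s) (φ : L1 t.1 ≃ₗ⁅ℂ⁆ L1 s.1)
    (hφ : IsHomogIso φ) (i : Fin 4) :
    (fourLines t.1 i).map (φ : L1 t.1 →ₗ[ℂ] L1 s.1) = fourLines s.1 i := by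
  obtain ⟨c, ρ, hc, hρ, hA, hB, e1, e2⟩ := exists_map_h ht hs φ hφ
  have key : ∀ (v : L1 t.1) (w : L1 s.1) (d : ℂ), d ≠ 0 → φ v = d • w →
      (Submodule.span ℂ {v}).map (φ : L1 t.1 →ₗ[ℂ] L1 s.1) = Submodule.span ℂ {w} := by
    intro v w d hd h
    rw [Submodule.map_span, Set.image_singleton]
    change Submodule.span ℂ {φ v} = _
    rw [h]
    exact Submodule.span_singleton_smul_eq (IsUnit.mk0 d hd) w
  unfold invA at hA
  unfold invB at hB
  fin_cases i
  · exact key _ _ c hc e1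
  · exact key _ _ (c * ρ) (mul_ne_zero hc hρ) e2
  · refine key _ _ (c * ρ ^ 3) (mul_ne_zero hc (pow_ne_zero 3 hρ)) ?_
    rw [lieEquiv_sub, map_smul, map_smul, e1, e2, hA, hB]
    module
  · refine key _ _ (c * ρ ^ 4) (mul_ne_zero hc (pow_ne_zero 4 hρ)) ?_
    rw [map_add, map_smul, map_smul, e1, e2, hA, hB]
    module

end E7

open E7

theorem theoremB :
    -- the groups: `G' ≅ S₄`, `H' ≅ S₃`, the group of the `B̃`, and `π'` with its kernel
    (G' : Set PGL(2, ℂ)) = Set.range Bcl ∧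
    Nonempty (G' ≃* Equiv.Perm (Fin 4)) ∧
    (H' : Set (Equiv.Perm Param)) = sixTrans ∧
    Nonempty (H' ≃* Equiv.Perm (Fin 3)) ∧
    (BtGroup : Set PGLw) = Set.range (fun p : BIdx × ℂˣ => Bt p.1 p.2) ∧
    Function.Injective (fun p : BIdx × ℂˣ => Bt p.1 p.2) ∧
    (∃ (π : G' →* (H')ᵐᵒᵖ) (ρ : BtGroup →* H'),
      (∀ (b : BIdx) (g : G'), g.1 = Bcl b → ∀ t : Param, ((π g).unop.1 t).1 = b.trans t.1) ∧
      Function.Surjective π ∧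
      IsKleinFour π.ker ∧
      (∀ g : G', g ∈ π.ker ↔ ∃ α : Mu4, α.1 ^ 2 = 1 ∧ (g.1 = Bcl (.diag α) ∨ g.1 = Bcl (.anti α))) ∧
      -- the matrices `B̃` act through `π'`, and preserve the set of the points that do not jump
      (∀ (b : BIdx) (γ : ℂˣ) (g : G') (h : BtGroup), g.1 = Bcl b → h.1 = Bt b γ →
        ρ h = (π g).unop) ∧
      (∀ (h : BtGroup) (t : Param), NonJump t → NonJump ((ρ h).1 t)) ∧
      -- (1) the groupoids for `k = 0, 1` off the jump points are the action groupoid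
      (∀ k : ℕ∞, k = 0 ∨ k = 1 → ∀ t s : Param, NonJump t → NonJump s →
        homs k t s = {g : PGLw | ∃ h : g ∈ BtGroup, (ρ ⟨g, h⟩).1 t = s})) ∧
    -- (2) all morphisms for `k ≥ 2`, including `k = ∞`
    (∀ k : ℕ∞, 2 ≤ k → ∀ t s : Param,
      homs k t s =
        {g : PGLw | ∃ (α : Mu4) (γ : ℂˣ), s.1 = α.1 ^ 2 * t.1 ∧ (γ : ℂ) ^ 2 = 1 ∧
          (g = Bt (.diag α) γ ∨ g = Bt (.anti α) γ)} ∪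
        {g : PGLw | ∃ (α β : Mu4) (γ : ℂˣ),
          s.1 = β.1 ^ 2 * (12 - 2 * α.1 ^ 2 * t.1) / (2 + α.1 ^ 2 * t.1) ∧
          (γ : ℂ) ^ 2 = 2 + α.1 ^ 2 * t.1 ∧ g = Bt (.full α β) γ}) ∧
    (∀ k : ℕ∞, 2 ≤ k → ∀ t : Param, NonJump t → t.1 ^ 2 ≠ -12 →
      homs k t t =
        {g : PGLw | ∃ (α : Mu4) (γ : ℂˣ), α.1 ^ 2 = 1 ∧ (γ : ℂ) ^ 2 = 1 ∧
          (g = Bt (.diag α) γ ∨ g = Bt (.anti α) γ)}) ∧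
    -- (3) the Torelli-type theorem
    (∀ t s : Param, NonJump t → NonJump s →
      (Nonempty (L1 t.1 ≃ₗ⁅ℂ⁆ L1 s.1) ↔ ContactEquiv (fam t.1) (fam s.1))) ∧
    (∃ (h₁ h₂ : ∀ t : ℂ, L1 t) (H : ∀ t : ℂ, Fin 4 → Submodule ℂ (L1 t)),
      (∀ t : Param, NonJump t →
        h₁ t.1 (cl t.1 (X 0)) = cl t.1 (C t.1 * (X 0 ^ 2 * X 1) + 2 * X 1 ^ 3) ∧
        h₁ t.1 (cl t.1 (X 1)) = cl t.1 (-(C t.1 * (X 1 ^ 2 * X 0) + 2 * X 0 ^ 3)) ∧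
        h₁ t.1 (cl t.1 (X 2)) = 0 ∧
        h₂ t.1 (cl t.1 (X 0)) =
          cl t.1 (C (t.1 ^ 2 - 12) * (X 0 ^ 2 * X 1) - C (4 * t.1) * X 1 ^ 3) ∧
        h₂ t.1 (cl t.1 (X 1)) =
          cl t.1 (-(C (t.1 ^ 2 - 12) * (X 1 ^ 2 * X 0) - C (4 * t.1) * X 0 ^ 3)) ∧
        h₂ t.1 (cl t.1 (X 2)) = 0 ∧
        H t.1 = ![Submodule.span ℂ {h₁ t.1}, Submodule.span ℂ {h₂ t.1},
          Submodule.span ℂ {(4 * t.1 * (t.1 ^ 2 - 36)) • h₁ t.1 - (t.1 ^ 2 + 12) • h₂ t.1},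
          Submodule.span ℂ {(5 * (t.1 ^ 2 + 12) ^ 2) • h₁ t.1 +
            (4 * t.1 * (t.1 ^ 2 - 36)) • h₂ t.1}] ∧
        HasCrossRatio (H t.1) (5 / 16 * (jFun t.1 / (1 - jFun t.1)))) ∧
      (∀ t s : Param, NonJump t → NonJump s → ∀ φ : L1 t.1 ≃ₗ⁅ℂ⁆ L1 s.1, IsHomogIso φ →
        ∀ i, (H t.1 i).map (φ : L1 t.1 →ₗ[ℂ] L1 s.1) = H s.1 i)) := by
  refine ⟨?_, ⟨permEquivG'.symm⟩, coe_H', ⟨equivH'⟩, coe_BtGroup, Bt_injective,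
    ⟨piG, rhoBt, piG_apply, piG_surjective, isKleinFour_ker_piG, mem_ker_piG,
      fun b γ g h hg hh => rhoBt_eq_piG hg hh, fun h t ht => rhoBt_nonJump h ht,
      fun k hk t s _ hs => homs_eq_action hk hs⟩,
    fun k hk t s => homs_eq_union hk t s, fun k hk t ht ht' => homs_self_eq hk ht ht', ?_, ?_⟩
  · rw [G'_eq, MonoidHom.coe_range, range_octRep]
  · exact fun t s ht hs => nonempty_lieEquiv_iff ht hs
  · refine ⟨h1Der, h2Der, fourLines, fun t ht => ?_, fun t s ht hs φ hφ i =>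
      map_fourLines ht hs φ hφ i⟩
    obtain ⟨e1, e2, e3⟩ := hamDer_cl t t.1 2
    obtain ⟨k1, k2, k3⟩ := hamDer_cl t (t.1 ^ 2 - 12) (-(4 * t.1))
    have h2 : (C 2 : O) = 2 := map_ofNat C 2
    rw [h2] at e1 e2
    rw [map_neg] at k1 k2
    exact ⟨e1, e2, e3, k1.trans (congrArg _ (by ring)), k2.trans (congrArg _ (by ring)), k3, rfl,
      hasCrossRatio_fourLines ht⟩
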